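/- A housing market $D=(A,F)$ is a finite directed graph without loops in which every agent $a\in A$ has a strict partial order on the arcs leaving $a$; the arc $(a,a')\in F$ means that $a$ would rather have the house of $a'$ than her own. An allocation in $D$ is a set $S\subseteq F$ of arcs that forms pairwise node-disjoint directed cycles (possibly $S=\emptyset$). Agent $a$ prefers an allocation $S$ to an allocation $S'$ if $S$ covers $a$ but $S'$ does not, or if $(a,a_1)\in S$, $(a,a_2)\in S'$ and $a$ prefers $(a,a_1)$ to $(a,a_2)$. An allocation $S$ is popular if for every allocation $S'$ the number of agents who prefer $S'$ to $S$ is at most the number of agents who prefer $S$ to $S'$. Theorem. There is an algorithm that, for every housing market $D=(A,F)$ with $n$ agents and $m$ arcs, decides whether $D$ admits a popular allocation and, if so, outputs one, in time $O((m+n)\cdot n^{5/2})$ (for $n\ge 1$). Here the algorithm is a single random access machine program, independent of $D$, that works with unit cost per operation on words of $O(\log(n+m+2))$ bits. The input consists of $n$, $m$, the list of the arcs in an arbitrary order (agents being numbered $0,\dots,n-1$), and a table that says, for any two arcs $e,e'$, whether they leave the same agent and she prefers $e$ to $e'$. The remaining memory is initially $0$. The output is a yes/no answer together with, if yes, a popular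 allocation, given by the successor of each agent (the agent herself if she does not trade). -/

import Mathlib

/-! ### Housing markets and popular allocations -/

namespace PopAlloc

/-- A housing market on the set `A` of agents. The house of an agent is identified with the agent
herself. An arc `(a, b)` means that `a` finds the house of `b` acceptable, that is, prefers it to
her own house (so there are no loops). Every agent has a strict partial order on the arcs leaving
her: `pref a b b'` says that `a` prefers the house of `b` to the house of `b'`. -/
structure HousingMarket (A : Type*) where
  arcs : Set (A × A)
  loopless : ∀ a, (a, a) ∉ arcs
  pref : A → A → A → Prop
  pref_arcs : ∀ a b b', pref a b b' → (a, b) ∈ arcs ∧ (a, b') ∈ arcs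
  pref_irrefl : ∀ a b, ¬ pref a b b
  pref_trans : ∀ a b b' b'', pref a b b' → pref a b' b'' → pref a b b''

/-- The nodes covered by a set of arcs. -/
def covered {A : Type*} (S : Set (A × A)) : Set A :=
  {a | ∃ b, (a, b) ∈ S ∨ (b, a) ∈ S}

/-- `C` is the arc set of a directed cycle `v 0 → v 1 → ⋯ → v (k - 1) → v 0` through `k ≥ 2`
distinct nodes. -/
def IsDirectedCycle {A : Type*} (C : Set (A × A)) : Prop :=
  ∃ k : ℕ, 2 ≤ k ∧ ∃ v : ZMod k → A, Function.Injective v ∧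
    C = Set.range fun i => (v i, v (i + 1))

namespace HousingMarket

variable {A : Type*} (D : HousingMarket A)

/-- An allocation: a set of arcs of the market that forms (node-)disjoint cycles. -/
def IsAllocation (S : Set (A × A)) : Prop :=
  S ⊆ D.arcs ∧ ∃ 𝒞 : Set (Set (A × A)),
    (∀ C ∈ 𝒞, IsDirectedCycle C) ∧ 𝒞.PairwiseDisjoint covered ∧ S = ⋃₀ 𝒞

/-- Agent `a` prefers the allocation `S` to the allocation `S'`. -/
def Prefers (a : A) (S S' : Set (A × A)) : Prop :=
  (a ∈ covered S ∧ a ∉ covered S') ∨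
    ∃ a₁ a₂, (a, a₁) ∈ S ∧ (a, a₂) ∈ S' ∧ D.pref a a₁ a₂

/-- `S` is more popular than `S'` (for finitely many agents). -/
def MorePopular (S S' : Set (A × A)) : Prop :=
  {a | D.Prefers a S' S}.ncard < {a | D.Prefers a S S'}.ncard

/-- A popular allocation. -/
def IsPopular (S : Set (A × A)) : Prop :=
  D.IsAllocation S ∧ ∀ S', D.IsAllocation S' → ¬ D.MorePopular S' S

end HousingMarket

/-! ### A random access machine with structured programs

The memory consists of registers and of arrays, all holding natural numbers; a program names
registers and arrays by constants, so that it uses only finitely many of them, and addresses the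
cells of an array by computed indices. All numbers that occur in a computation have to be smaller
than a bound `W` (the machine works on words of `log₂ W` bits): an operation whose result is `W` or
more cannot be executed. Every operation costs one step. -/

/-- A memory state. -/
structure State where
  reg : ℕ → ℕ
  arr : ℕ → ℕ → ℕ

inductive Expr where
  | const (k : ℕ)
  | var (x : ℕ)
  | get (x : ℕ) (i : Expr)
  | add (e f : Expr)
  | sub (e f : Expr)
  | mul (e f : Expr)
  | lt (e f : Expr)

namespace Expr

/-- The value of an expression; subtraction is truncated, a comparison gives `1` or `0`. -/
def eval (s : State) : Expr → ℕ
  | const k => k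
  | var x => s.reg x
  | get x i => s.arr x (i.eval s)
  | add e f => e.eval s + f.eval s
  | sub e f => e.eval s - f.eval s
  | mul e f => e.eval s * f.eval s
  | lt e f => if e.eval s < f.eval s then 1 else 0

/-- No operation in the expression overflows. (Memory cells hold words, and the result of `sub` is
not larger than its first argument.) -/
def Fits (W : ℕ) (s : State) : Expr → Prop
  | const k => k < W
  | var _ => True
  | get _ i => i.Fits W s
  | add e f => e.Fits W s ∧ f.Fits W s ∧ e.eval s + f.eval s < W
  | sub e f => e.Fits W s ∧ f.Fits W s
  | mul e f => e.Fits W s ∧ f.Fits W s ∧ e.eval s * f.eval s < W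
  | lt e f => e.Fits W s ∧ f.Fits W s ∧ 1 < W

/-- The number of steps that the evaluation of an expression takes. -/
def cost : Expr → ℕ
  | const _ => 1
  | var _ => 1
  | get _ i => i.cost + 1
  | add e f => e.cost + f.cost + 1
  | sub e f => e.cost + f.cost + 1
  | mul e f => e.cost + f.cost + 1
  | lt e f => e.cost + f.cost + 1

end Expr

/-- Programs. -/
inductive Prog where
  | skip
  | assign (x : ℕ) (e : Expr)
  | store (x : ℕ) (i e : Expr)
  | seq (p q : Prog)
  | cond (e : Expr) (p q : Prog)
  | loop (e : Expr) (p : Prog)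

namespace State

/-- Write `v` into register `x`. -/
def setReg (s : State) (x v : ℕ) : State :=
  { s with reg := Function.update s.reg x v }

/-- Write `v` into cell `i` of array `x`. -/
def setArr (s : State) (x i v : ℕ) : State :=
  { s with arr := Function.update s.arr x (Function.update (s.arr x) i v) }

end State

/-- `Exec W p s s' t`: on words smaller than `W`, the program `p` started in state `s` halts
in state `s'` after exactly `t` steps. The guards of `cond` and `loop` count as true if they are not
zero. -/
inductive Exec (W : ℕ) : Prog → State → State → ℕ → Prop where
  | skip (s : State) : Exec W Prog.skip s s 1
  | assign (s : State) (x : ℕ) (e : Expr) (he : e.Fits W s) :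
      Exec W (Prog.assign x e) s (s.setReg x (e.eval s)) (e.cost + 1)
  | store (s : State) (x : ℕ) (i e : Expr) (hi : i.Fits W s) (he : e.Fits W s) :
      Exec W (Prog.store x i e) s (s.setArr x (i.eval s) (e.eval s)) (i.cost + e.cost + 1)
  | seq {p q : Prog} {s s' s'' : State} {t t' : ℕ} (hp : Exec W p s s' t)
      (hq : Exec W q s' s'' t') : Exec W (Prog.seq p q) s s'' (t + t')
  | cond_true {e : Expr} {p q : Prog} {s s' : State} {t : ℕ} (he : e.Fits W s)
      (h : e.eval s ≠ 0) (hp : Exec W p s s' t) :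
      Exec W (Prog.cond e p q) s s' (e.cost + 1 + t)
  | cond_false {e : Expr} {p q : Prog} {s s' : State} {t : ℕ} (he : e.Fits W s)
      (h : e.eval s = 0) (hq : Exec W q s s' t) :
      Exec W (Prog.cond e p q) s s' (e.cost + 1 + t)
  | loop_true {e : Expr} {p : Prog} {s s' s'' : State} {t t' : ℕ} (he : e.Fits W s)
      (h : e.eval s ≠ 0) (hp : Exec W p s s' t) (hl : Exec W (Prog.loop e p) s' s'' t') :
      Exec W (Prog.loop e p) s s'' (e.cost + 1 + t + t')
  | loop_false {e : Expr} {p : Prog} {s : State} (he : e.Fits W s) (h : e.eval s = 0) :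
      Exec W (Prog.loop e p) s s (e.cost + 1)

/-! ### Input and output -/

open Classical in
/-- The memory that holds a housing market on the agents `0, …, n - 1` whose arcs are numbered
`0, …, m - 1` in an arbitrary way: registers `0` and `1` hold `n` and `m`; arrays `0` and `1` hold
the tails and the heads of the arcs; cell `i * m + j` of array `2` holds `1` if arcs `i` and `j`
leave the same agent and she prefers arc `i` to arc `j`. All other cells are `0`. -/
noncomputable def HousingMarket.input {n m : ℕ} (D : HousingMarket (Fin n))
    (arc : Fin m ≃ D.arcs) : State where
  reg x := if x = 0 then n else if x = 1 then m else 0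
  arr x k :=
    if x = 0 then (if h : k < m then ((arc ⟨k, h⟩).1.1 : ℕ) else 0)
    else if x = 1 then (if h : k < m then ((arc ⟨k, h⟩).1.2 : ℕ) else 0)
    else if x = 2 then
      (if ∃ i j : Fin m, k = i * m + j ∧ (arc i).1.1 = (arc j).1.1 ∧
          D.pref (arc i).1.1 (arc i).1.2 (arc j).1.2 then 1 else 0)
    else 0

/-- The set of arcs that a final memory state describes: array `3` holds, for each agent, the agent
whose house she obtains (herself if she does not trade). -/
def outputArcs (n : ℕ) (s : State) : Set (Fin n × Fin n) :=
  {e | e.1 ≠ e.2 ∧ s.arr 3 e.1 = e.2}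

/-- The final state `s` is a correct answer to the popular allocation problem for `D`: either
register `2` is `1` and a popular allocation is written down, or register `2` is `0` and the market
admits no popular allocation. -/
def HousingMarket.CorrectOutput {n : ℕ} (D : HousingMarket (Fin n)) (s : State) : Prop :=
  (s.reg 2 = 1 ∧ D.IsPopular (outputArcs n s)) ∨ (s.reg 2 = 0 ∧ ¬ ∃ S, D.IsPopular S)

end PopAlloc

/-! If an agent who does not trade keeps her own house as her last choice, allocations become
permutations `σ` of the agents along arcs and loops. Compare `τ` with `σ` by counting one for every
agent who prefers `τ` and minus one for every agent who prefers `σ`. Then `σ` is popular if and only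
if this total gain is never positive: `σ` is a maximum weight perfect matching for weights that
depend on `σ` itself. Duality turns this into a condition on prices (levels) of the houses: there
are levels below `n` at which no house that an agent accepts beats the one assigned to her.
`exists_isStable` obtains them from longest paths, and `sum_gain_nonpos` is the converse. So a
popular allocation exists if and only if, at some levels, the unbeaten arcs contain a perfect
matching.

The levels are approached from below. Start with zero and match houses with agents along unbeaten
arcs. If some house is unmatched and has no augmenting path, raise its level by one. By
`lt_of_unmatched` the levels never exceed those of any solution: otherwise the houses reachable from
the unmatched one whose level already equals that of the solution would be mapped injectively into
themselves while missing a member. A perfect matching of unbeaten arcs is popular; a level that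
reaches `n` shows that there is no popular allocation. This bounds the number of rounds by `n ^ 2 +
1`.

A round costs `O(√n * (m + n))`. Let `L` be the square root of `n`, rounded up. In an auction the
houses bid for the agents at integer prices below `L`; by `Auction.size_le_size` the resulting
matching is at most `L` smaller than any other, so at most `L` breadth-first searches can succeed
and one can fail. The marks of the beaten arcs are updated in `O(m + n)`: raising a level affects
only comparisons with arcs into that house, and an adjacency matrix yields the one relevant
competitor of each arc at unit cost.

For the machine, `Runs` is a total correctness judgement that includes the running time. Loop-free
pieces are executed symbolically by `Wp`, and loops are paid for by potentials. -/

/-! ### Executing programs -/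

namespace PopAlloc

/-- On words smaller than `W`, the program `p` started in `s` halts, and its final state and running
time satisfy `Q`. -/
def Runs (W : ℕ) (p : Prog) (s : State) (Q : State → ℕ → Prop) : Prop :=
  ∃ s' t, Exec W p s s' t ∧ Q s' t

namespace Prog

/-- The program writes to the register `x`. -/
def writesReg : Prog → ℕ → Bool
  | skip, _ => false
  | assign y _, x => y == x
  | store _ _ _, _ => false
  | seq p q, x => p.writesReg x || q.writesReg x
  | cond _ p q, x => p.writesReg x || q.writesReg x
  | loop _ p, x => p.writesReg x

/-- The program writes to the array `x`. -/
def writesArr : Prog → ℕ → Bool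
  | skip, _ => false
  | assign _ _, _ => false
  | store y _ _, x => y == x
  | seq p q, x => p.writesArr x || q.writesArr x
  | cond _ p q, x => p.writesArr x || q.writesArr x
  | loop _ p, x => p.writesArr x

/-- The loop-free program `p` halts without an overflow in a state that satisfies `Q`. -/
def Wp (W : ℕ) : Prog → State → (State → Prop) → Prop
  | skip, s, Q => Q s
  | assign x e, s, Q => e.Fits W s ∧ Q (s.setReg x (e.eval s))
  | store x i e, s, Q => i.Fits W s ∧ e.Fits W s ∧ Q (s.setArr x (i.eval s) (e.eval s))
  | seq p q, s, Q => p.Wp W s fun s' => q.Wp W s' Q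
  | cond e p q, s, Q => e.Fits W s ∧ (e.eval s ≠ 0 → p.Wp W s Q) ∧ (e.eval s = 0 → q.Wp W s Q)
  | loop _ _, _, _ => False

/-- A bound for the running time of a loop-free program. -/
def maxCost : Prog → ℕ
  | skip => 1
  | assign _ e => e.cost + 1
  | store _ i e => i.cost + e.cost + 1
  | seq p q => p.maxCost + q.maxCost
  | cond e p q => e.cost + 1 + max p.maxCost q.maxCost
  -- A dummy value: `Wp` is false for loops, so this bound is never applied to one.
  | loop _ _ => 0

theorem Wp.exec {W : ℕ} : ∀ {p : Prog} {s : State} {Q : State → Prop}, p.Wp W s Q →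
    ∃ s', ∃ t ≤ p.maxCost, Exec W p s s' t ∧ Q s'
  | skip, s, _, h => ⟨s, 1, le_rfl, Exec.skip s, h⟩
  | assign x e, s, _, h => ⟨_, _, le_rfl, Exec.assign s x e h.1, h.2⟩
  | store x i e, s, _, h => ⟨_, _, le_rfl, Exec.store s x i e h.1 h.2.1, h.2.2⟩
  | seq p q, s, _, h => by
    obtain ⟨s', t, ht, hp, h'⟩ := Wp.exec (p := p) h
    obtain ⟨s'', t', ht', hq, h''⟩ := Wp.exec (p := q) h'
    exact ⟨s'', t + t', add_le_add ht ht', Exec.seq hp hq, h''⟩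
  | cond e p q, s, _, h => by
    by_cases h0 : e.eval s = 0
    · obtain ⟨s', t, ht, hq, h'⟩ := Wp.exec (h.2.2 h0)
      refine ⟨s', e.cost + 1 + t, ?_, Exec.cond_false h.1 h0 hq, h'⟩
      simp only [maxCost]; omega
    · obtain ⟨s', t, ht, hp, h'⟩ := Wp.exec (h.2.1 h0)
      refine ⟨s', e.cost + 1 + t, ?_, Exec.cond_true h.1 h0 hp, h'⟩
      simp only [maxCost]; omega
  | loop e p, s, _, h => h.elim

theorem Wp.mono {W : ℕ} : ∀ {p : Prog} {s : State} {Q R : State → Prop}, p.Wp W s Q →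
    (∀ s', Q s' → R s') → p.Wp W s R
  | skip, _, _, _, h, hQ => hQ _ h
  | assign _ _, _, _, _, h, hQ => ⟨h.1, hQ _ h.2⟩
  | store _ _ _, _, _, _, h, hQ => ⟨h.1, h.2.1, hQ _ h.2.2⟩
  | seq p q, _, _, _, h, hQ => Wp.mono (p := p) h fun _ h' => Wp.mono (p := q) h' hQ
  | cond _ _ _, _, _, _, h, hQ => ⟨h.1, fun h0 => (h.2.1 h0).mono hQ, fun h0 => (h.2.2 h0).mono hQ⟩
  | loop _ _, _, _, _, h, _ => h.elim

end Prog

theorem Exec.reg_eq {W : ℕ} {p : Prog} {s s' : State} {t : ℕ} (h : Exec W p s s' t) {x : ℕ}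
    (hx : p.writesReg x = false) : s'.reg x = s.reg x := by
  induction h with
  | skip => rfl
  | assign s y e he =>
    have : x ≠ y := by rintro rfl; simp [Prog.writesReg] at hx
    simp [State.setReg, this]
  | store => rfl
  | seq _ _ ihp ihq =>
    simp only [Prog.writesReg, Bool.or_eq_false_iff] at hx
    rw [ihq hx.2, ihp hx.1]
  | cond_true _ _ _ ih =>
    simp only [Prog.writesReg, Bool.or_eq_false_iff] at hx
    exact ih hx.1
  | cond_false _ _ _ ih =>
    simp only [Prog.writesReg, Bool.or_eq_false_iff] at hx
    exact ih hx.2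
  | loop_true _ _ _ _ ihp ihl => rw [ihl hx, ihp hx]
  | loop_false => rfl

theorem Exec.arr_eq {W : ℕ} {p : Prog} {s s' : State} {t : ℕ} (h : Exec W p s s' t) {x : ℕ}
    (hx : p.writesArr x = false) : s'.arr x = s.arr x := by
  induction h with
  | skip => rfl
  | store s y i e hi he =>
    have : x ≠ y := by rintro rfl; simp [Prog.writesArr] at hx
    simp [State.setArr, this]
  | assign => rfl
  | seq _ _ ihp ihq =>
    simp only [Prog.writesArr, Bool.or_eq_false_iff] at hx
    rw [ihq hx.2, ihp hx.1]
  | cond_true _ _ _ ih =>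
    simp only [Prog.writesArr, Bool.or_eq_false_iff] at hx
    exact ih hx.1
  | cond_false _ _ _ ih =>
    simp only [Prog.writesArr, Bool.or_eq_false_iff] at hx
    exact ih hx.2
  | loop_true _ _ _ _ ihp ihl => rw [ihl hx, ihp hx]
  | loop_false => rfl

/-- The states `s` and `s'` agree on everything that `p` does not write to. -/
def Prog.Frame (p : Prog) (s s' : State) : Prop :=
  (∀ x, p.writesReg x = false → s'.reg x = s.reg x) ∧
    ∀ x, p.writesArr x = false → s'.arr x = s.arr x

namespace Runs

variable {W : ℕ} {p q : Prog} {e : Expr} {s : State} {Q R : State → ℕ → Prop}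

theorem imp (h : Runs W p s Q) (hQ : ∀ s' t, Q s' t → R s' t) : Runs W p s R :=
  let ⟨s', t, hp, hs⟩ := h
  ⟨s', t, hp, hQ _ _ hs⟩

theorem frame (h : Runs W p s Q) : Runs W p s fun s' t => Q s' t ∧ p.Frame s s' :=
  let ⟨s', t, hp, hs⟩ := h
  ⟨s', t, hp, hs, fun _ => hp.reg_eq, fun _ => hp.arr_eq⟩

/-- The postcondition may assume the frame, so that symbolic execution has to follow only what the
program writes. -/
theorem of_wp {Q : State → Prop} (h : p.Wp W s fun s' => p.Frame s s' → Q s') :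
    Runs W p s fun s' t => Q s' ∧ t ≤ p.maxCost :=
  let ⟨_, _, ht, hp, h⟩ := h.exec
  ⟨_, _, hp, h ⟨fun _ => hp.reg_eq, fun _ => hp.arr_eq⟩, ht⟩

theorem seq (hp : Runs W p s fun s' t => Runs W q s' fun s'' t' => Q s'' (t + t')) :
    Runs W (p.seq q) s Q :=
  let ⟨_, _, hp, _, _, hq, h⟩ := hp
  ⟨_, _, hp.seq hq, h⟩

theorem assign_seq {x : ℕ} (he : e.Fits W s)
    (h : Runs W q (s.setReg x (e.eval s)) fun s' t => Q s' (e.cost + 1 + t)) :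
    Runs W ((Prog.assign x e).seq q) s Q :=
  let ⟨_, _, hq, h⟩ := h
  ⟨_, _, (Exec.assign s x e he).seq hq, h⟩

theorem store_seq {x : ℕ} {i : Expr} (hi : i.Fits W s) (he : e.Fits W s)
    (h : Runs W q (s.setArr x (i.eval s) (e.eval s)) fun s' t => Q s' (i.cost + e.cost + 1 + t)) :
    Runs W ((Prog.store x i e).seq q) s Q :=
  let ⟨_, _, hq, h⟩ := h
  ⟨_, _, (Exec.store s x i e hi he).seq hq, h⟩

theorem cond (he : e.Fits W s)
    (hp : e.eval s ≠ 0 → Runs W p s fun s' t => Q s' (e.cost + 1 + t))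
    (hq : e.eval s = 0 → Runs W q s fun s' t => Q s' (e.cost + 1 + t)) :
    Runs W (Prog.cond e p q) s Q := by
  by_cases h : e.eval s = 0
  · obtain ⟨s', t, hx, hs⟩ := hq h
    exact ⟨_, _, Exec.cond_false he h hx, hs⟩
  · obtain ⟨s', t, hx, hs⟩ := hp h
    exact ⟨_, _, Exec.cond_true he h hx, hs⟩

/-- A loop with the invariant `I`, whose running time is paid for by the potential `Φ`. -/
theorem loop (I : State → Prop) (Φ : State → ℕ) (hf : ∀ s, I s → e.Fits W s)
    (h : ∀ s, I s → e.eval s ≠ 0 →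
      Runs W p s fun s' t => I s' ∧ t + (e.cost + 1) + Φ s' ≤ Φ s) (hs : I s) :
    Runs W (Prog.loop e p) s fun s' t => I s' ∧ e.eval s' = 0 ∧ t ≤ Φ s + (e.cost + 1) := by
  induction hk : Φ s using Nat.strong_induction_on generalizing s with
  | _ k ih =>
    by_cases h0 : e.eval s = 0
    · exact ⟨s, _, Exec.loop_false (hf s hs) h0, hs, h0, by omega⟩
    · obtain ⟨s₁, t, hp, hI, hΦ⟩ := h s hs h0
      obtain ⟨s₂, t', hl, hI', h0', ht'⟩ := ih (Φ s₁) (by omega) hI rfl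
      exact ⟨s₂, _, Exec.loop_true (hf s hs) h0 hp hl, hI', h0', by omega⟩

/-- A loop with a loop-free body and the invariant `I`, in which `Φ` decreases. -/
theorem loop_of_wp (I : State → Prop) (Φ : State → ℕ) (hf : ∀ s, I s → e.Fits W s)
    (h : ∀ s, I s → e.eval s ≠ 0 →
      p.Wp W s fun s' => p.Frame s s' → I s' ∧ Φ s' + 1 ≤ Φ s) (hs : I s) :
    Runs W (Prog.loop e p) s fun s' t =>
      I s' ∧ e.eval s' = 0 ∧ t ≤ (p.maxCost + (e.cost + 1)) * Φ s + (e.cost + 1) := by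
  refine loop I (fun s => (p.maxCost + (e.cost + 1)) * Φ s) hf (fun s hs h0 => ?_) hs
  refine (of_wp (h s hs h0)).imp fun s' t ht => ⟨ht.1.1, ?_⟩
  have := Nat.mul_le_mul_left (p.maxCost + (e.cost + 1)) ht.1.2
  rw [Nat.mul_add] at this
  omega

/-- A loop with a loop-free body and an invariant with an index that decreases. -/
theorem loop_of_wp_index (I : ℕ → State → Prop) (hf : ∀ k s, I k s → e.Fits W s)
    (h : ∀ k s, I k s → e.eval s ≠ 0 →
      p.Wp W s fun s' => p.Frame s s' → ∃ j < k, I j s') {k : ℕ} (hs : I k s) :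
    Runs W (Prog.loop e p) s fun s' t =>
      (∃ j, I j s') ∧ e.eval s' = 0 ∧ t ≤ (p.maxCost + (e.cost + 1)) * k + (e.cost + 1) := by
  classical
  -- The least index that fits a state serves as its potential; the value `0` for states without an
  -- index plays no role.
  let Φ : State → ℕ := fun s => if h : ∃ k, I k s then Nat.find h else 0
  have hΦ : ∀ {k s}, I k s → Φ s ≤ k := fun {k s} hk => by
    simp only [Φ, dif_pos (⟨k, hk⟩ : ∃ k, I k s)]
    exact Nat.find_min' _ hk
  refine (loop_of_wp (p := p) (fun s => ∃ k, I k s) Φ (fun s ⟨k, hk⟩ => hf k s hk) ?_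
    ⟨k, hs⟩).imp fun s' t ⟨h1, h2, h3⟩ => ⟨h1, h2, h3.trans ?_⟩
  · intro s hk h0
    have h1 : Φ s = Nat.find hk := dif_pos hk
    rw [h1]
    refine (h _ s (Nat.find_spec hk) h0).mono fun s' hs' hf' => ?_
    obtain ⟨j, hj, hI⟩ := hs' hf'
    exact ⟨⟨j, hI⟩, by have := hΦ hI; omega⟩
  · exact Nat.add_le_add_right (Nat.mul_le_mul_left _ (hΦ hs)) _

end Runs

open Classical in
/-- The truth value of a proposition as a number. -/
noncomputable def bit (p : Prop) : ℕ := if p then 1 else 0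

theorem bit_eq_zero {p : Prop} : bit p = 0 ↔ ¬ p := by by_cases h : p <;> simp [bit, h]

theorem bit_eq_one {p : Prop} : bit p = 1 ↔ p := by by_cases h : p <;> simp [bit, h]

theorem bit_le_one (p : Prop) : bit p ≤ 1 := by by_cases h : p <;> simp [bit, h]

theorem bit_mul_bit (p q : Prop) : bit p * bit q = bit (p ∧ q) := by
  by_cases h : p <;> by_cases h' : q <;> simp [bit, h, h']

theorem bit_lt {W : ℕ} (hW : 1 < W) (p : Prop) : bit p < W := (bit_le_one p).trans_lt hW

namespace Expr

variable (s : State) (e f : Expr)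

theorem eval_const (k : ℕ) : (const k).eval s = k := rfl

theorem eval_var (x : ℕ) : (var x).eval s = s.reg x := rfl

theorem eval_get (x : ℕ) : (get x e).eval s = s.arr x (e.eval s) := rfl

theorem eval_add : (add e f).eval s = e.eval s + f.eval s := rfl

theorem eval_sub : (sub e f).eval s = e.eval s - f.eval s := rfl

theorem eval_mul : (mul e f).eval s = e.eval s * f.eval s := rfl

theorem eval_lt : (lt e f).eval s = bit (e.eval s < f.eval s) := by
  by_cases h : e.eval s < f.eval s <;> simp [eval, bit, h]

end Expr

section Simp

variable (s : State) (x y i j v : ℕ)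

@[simp] theorem State.setReg_reg : (s.setReg x v).reg y = if y = x then v else s.reg y := by
  simp [State.setReg, Function.update_apply]

@[simp] theorem State.setReg_arr : (s.setReg x v).arr = s.arr := rfl

@[simp] theorem State.setArr_reg : (s.setArr x i v).reg = s.reg := rfl

@[simp] theorem State.setArr_arr : (s.setArr x i v).arr y =
    if y = x then Function.update (s.arr x) i v else s.arr y := by
  by_cases h : y = x <;> simp [State.setArr, h]

end Simp

end PopAlloc

/-! ### Potentials -/

namespace PopAlloc

section Potential

variable {A : Type*}

/-- `SimplePath G c x y S k`: there is a path in `G` from `x` to `y` that visits every node of `S`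
exactly once, no other node, and whose arcs have the total weight `k`. -/
inductive SimplePath [DecidableEq A] (G : A → A → Prop) (c : A → A → ℤ) :
    A → A → Finset A → ℤ → Prop
  | nil (x : A) : SimplePath G c x x {x} 0
  | cons {x x' y : A} {S : Finset A} {k : ℤ} (h : G x x') (hx : x ∉ S)
      (hp : SimplePath G c x' y S k) : SimplePath G c x y (insert x S) (c x x' + k)

namespace SimplePath

variable [DecidableEq A] {G : A → A → Prop} {c : A → A → ℤ} {x y z : A} {S : Finset A} {k : ℤ}

theorem target_mem (h : SimplePath G c x y S k) : y ∈ S := by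
  induction h with
  | nil => simp
  | cons _ _ _ ih => simp [ih]

/-- A simple path has one arc fewer than nodes, and each arc weighs at most one. -/
theorem weight_lt_card (hc : ∀ x y, c x y ≤ 1) (h : SimplePath G c x y S k) : k < S.card := by
  induction h with
  | nil => simp
  | @cons x x' y S k _ hx _ ih =>
    rw [Finset.card_insert_of_notMem hx]
    have := hc x x'
    push_cast
    omega

theorem split (h : SimplePath G c x y S k) (hz : z ∈ S) :
    ∃ S₁ k₁ S₂ k₂, SimplePath G c x z S₁ k₁ ∧ SimplePath G c z y S₂ k₂ ∧ k = k₁ + k₂ ∧ S₁ ⊆ S := by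
  induction h with
  | nil x =>
    obtain rfl := Finset.mem_singleton.1 hz
    exact ⟨_, _, _, _, nil z, nil z, by simp, subset_rfl⟩
  | @cons x x' y S k h hx hp ih =>
    by_cases hxz : z = x
    · subst hxz
      exact ⟨_, _, _, _, nil z, cons h hx hp, by simp, by simp⟩
    · obtain ⟨S₁, k₁, S₂, k₂, h₁, h₂, rfl, hS⟩ := ih ((Finset.mem_insert.1 hz).resolve_left hxz)
      exact ⟨_, _, _, _, cons h (fun hx' => hx (hS hx')) h₁, h₂, by ring,
        Finset.insert_subset_insert _ hS⟩

/-- Closing the path by a step from `y` back to `x` gives a cyclic permutation. Whether the closing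
step is an arc of `G` is left to the user. -/
theorem exists_perm [Fintype A] (hc : ∀ x, c x x = 0) (hG : ∀ x, G x x)
    (h : SimplePath G c x y S k) :
    ∃ π : Equiv.Perm A, (∀ z ∉ S, π z = z) ∧ π y = x ∧ (∀ z ≠ y, G z (π z)) ∧
      ∑ z, c z (π z) = k + c y x := by
  induction h with
  | nil x => exact ⟨1, by simp, rfl, fun z _ => hG z, by simp [hc]⟩
  | @cons x x' y S k h hx hp ih =>
    obtain ⟨π, h1, h2, h3, h4⟩ := ih
    have hy := hp.target_mem
    have hxy : x ≠ y := fun he => hx (he ▸ hy)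
    have hπ : ∀ z, z ≠ x → z ≠ y → (π * Equiv.swap x y) z = π z := fun z hzx hzy => by
      simp [Equiv.swap_apply_of_ne_of_ne hzx hzy]
    -- `π` closes the shorter path, so it sends `y` to `x'` and fixes `x`; after the swap, `x` goes
    -- to `x'` and `y` to `x`.
    refine ⟨π * Equiv.swap x y, ?_, ?_, ?_, ?_⟩
    · intro z hz
      simp only [Finset.mem_insert, not_or] at hz
      rw [hπ z hz.1 (fun he => hz.2 (he ▸ hy)), h1 z hz.2]
    · simp [h1 x hx]
    · intro z hz
      by_cases hzx : z = x
      · subst hzx; simpa [h2] using h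
      · rw [hπ z hzx hz]; exact h3 z hz
    · have key : ∀ f : A → ℤ, ∑ z, f z = f x + f y + ∑ z ∈ (Finset.univ.erase x).erase y, f z := by
        intro f
        rw [← Finset.add_sum_erase _ _ (Finset.mem_univ x),
          ← Finset.add_sum_erase (Finset.univ.erase x) _ (Finset.mem_erase.2 ⟨hxy.symm,
            Finset.mem_univ y⟩), add_assoc]
      have hs : ∑ z ∈ (Finset.univ.erase x).erase y, c z ((π * Equiv.swap x y) z) =
          ∑ z ∈ (Finset.univ.erase x).erase y, c z (π z) := by
        refine Finset.sum_congr rfl fun z hz => ?_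
        simp only [Finset.mem_erase] at hz
        rw [hπ z hz.2.1 hz.1]
      rw [key] at h4 ⊢
      rw [hs]
      simp only [Equiv.Perm.coe_mul, Function.comp_apply, Equiv.swap_apply_left,
        Equiv.swap_apply_right, h2, h1 x hx, hc] at h4 ⊢
      linarith

end SimplePath

/-- If no permutation along the arcs of `G` has positive weight, then there is a potential. -/
theorem exists_potential [Fintype A] {G : A → A → Prop} {c : A → A → ℤ}
    (hG : ∀ x, G x x) (hc : ∀ x, c x x = 0) (hc1 : ∀ x y, c x y ≤ 1)
    (h : ∀ π : Equiv.Perm A, (∀ x, G x (π x)) → ∑ x, c x (π x) ≤ 0) :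
    ∃ l : A → ℕ, (∀ x, l x < Fintype.card A) ∧ ∀ x y, G x y → (l y : ℤ) + c x y ≤ l x := by
  classical
  -- The potential of `x` is the largest weight of a simple path that starts in `x`; the trivial
  -- path makes it nonnegative.
  have hmax : ∀ x, ∃ k : ℕ, k < Fintype.card A ∧ (∃ y S, SimplePath G c x y S k) ∧
      ∀ y S j, SimplePath G c x y S j → j ≤ k := by
    intro x
    have hlt : ∀ {y S} {j : ℤ}, SimplePath G c x y S j → j < Fintype.card A := fun hp =>
      (hp.weight_lt_card hc1).trans_le (by exact_mod_cast Finset.card_le_univ _)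
    obtain ⟨k, ⟨⟨y, S, hk⟩, hkn⟩, hmax⟩ := Int.exists_greatest_of_bdd
      (P := fun k => (∃ y S, SimplePath G c x y S k) ∧ 0 ≤ k)
      ⟨Fintype.card A, fun z ⟨⟨y, S, hz⟩, _⟩ => (hlt hz).le⟩ ⟨0, ⟨x, {x}, .nil x⟩, le_rfl⟩
    lift k to ℕ using hkn
    refine ⟨k, by exact_mod_cast hlt hk, ⟨y, S, hk⟩, fun y S j hj => ?_⟩
    by_cases hj0 : 0 ≤ j
    · exact hmax j ⟨⟨y, S, hj⟩, hj0⟩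
    · omega
  choose l hl hpath hle using hmax
  refine ⟨l, hl, fun x y hxy => ?_⟩
  obtain ⟨z, S, hp⟩ := hpath y
  -- If the best path from `y` meets `x`, its piece from `y` to `x` and the arc back to `y` form a
  -- cycle of weight at most zero, so the remaining piece, which starts in `x`, is heavy enough.
  -- Otherwise `x` can be put in front of the path.
  by_cases hx : x ∈ S
  · obtain ⟨S₁, k₁, S₂, k₂, h₁, h₂, hk, -⟩ := hp.split hx
    obtain ⟨π, -, h2, h3, h4⟩ := h₁.exists_perm hc hG
    have := h π fun u => by
      by_cases hu : u = x
      · subst hu; rwa [h2]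
      · exact h3 u hu
    have := hle _ _ _ _ h₂
    linarith
  · have := hle _ _ _ _ (hp.cons hxy hx)
    linarith

end Potential

/-! ### Stable arcs -/

section Stable

variable {A : Type*} {E : A → A → Prop} {w : A → A → A → ℤ}

/-- The house `b` is acceptable for the agent `a` and, at the prices `l`, no acceptable house beats
it; here `w a b b'` says how much `a` gains by exchanging `b` for `b'`. -/
def IsStable (E : A → A → Prop) (w : A → A → A → ℤ) (l : A → ℕ) (a b : A) : Prop :=
  E a b ∧ ∀ b', E a b' → (l b' : ℤ) + w a b b' ≤ l b

/-- Summed over all agents, the prices cancel, because both permutations use every house exactly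
once. -/
theorem sum_gain_nonpos [Fintype A] {l : A → ℕ} {σ τ : Equiv.Perm A}
    (hσ : ∀ a, IsStable E w l a (σ a)) (hτ : ∀ a, E a (τ a)) : ∑ a, w a (σ a) (τ a) ≤ 0 := by
  have h : ∑ a, ((l (τ a) : ℤ) + w a (σ a) (τ a)) ≤ ∑ a, (l (σ a) : ℤ) :=
    Finset.sum_le_sum fun a _ => (hσ a).2 _ (hτ a)
  rw [Finset.sum_add_distrib, Equiv.sum_comp τ fun b => (l b : ℤ),
    Equiv.sum_comp σ fun b => (l b : ℤ)] at h
  linarith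

/-- Take the houses as nodes, where `b` stands for the agent `σ.symm b` who obtains it and has arcs
to all houses she accepts. A permutation `π` along these arcs replaces `σ` by `π ∘ σ`, so no such
`π` has positive weight, and the potential gives the prices. -/
theorem exists_isStable [Fintype A] (hw0 : ∀ a b, w a b b = 0) (hw1 : ∀ a b b', w a b b' ≤ 1)
    {σ : Equiv.Perm A} (hσ : ∀ a, E a (σ a))
    (h : ∀ τ : Equiv.Perm A, (∀ a, E a (τ a)) → ∑ a, w a (σ a) (τ a) ≤ 0) :
    ∃ l : A → ℕ, (∀ b, l b < Fintype.card A) ∧ ∀ a, IsStable E w l a (σ a) := by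
  obtain ⟨l, hl, hl'⟩ := exists_potential (G := fun b b' => E (σ.symm b) b')
    (c := fun b b' => w (σ.symm b) b b') (fun b => by simpa using hσ (σ.symm b))
    (fun b => hw0 _ _) (fun b b' => hw1 _ _ _) fun π hπ => by
      have := h (σ.trans π) fun a => by simpa using hπ (σ a)
      rw [← Equiv.sum_comp σ]
      simpa using this
  exact ⟨l, hl, fun a => ⟨hσ a, fun b' hb' => by simpa using hl' (σ a) b' (by simpa using hb')⟩⟩

/-- If the set `R` of houses is closed under alternating paths with respect to a matching of stable
arcs, then the unmatched houses in `R` need higher prices. -/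
theorem lt_of_unmatched [Finite A] (hw : ∀ a b b', w a b b' = -w a b' b) {l l' : A → ℕ}
    (hle : ∀ b, l b ≤ l' b) {σ : Equiv.Perm A} (hσ : ∀ a, IsStable E w l' a (σ a))
    {own : A → Option A} (hinj : ∀ a a' b, own a = some b → own a' = some b → a = a')
    (hown : ∀ a b, own a = some b → IsStable E w l a b)
    {R : Set A} (hR : ∀ b ∈ R, ∀ a, IsStable E w l a b → ∃ b' ∈ R, own a = some b')
    {b₀ : A} (hb₀ : b₀ ∈ R) (hfree : ∀ a, own a ≠ some b₀) : l b₀ < l' b₀ := by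
  by_contra hcon
  have h₀ : l b₀ = l' b₀ := le_antisymm (hle _) (not_lt.1 hcon)
  -- Call a house of `R` tight if `l` and `l'` agree on it. The agent who gets a tight house `b` in
  -- the solution `σ` finds it stable for `l` too, since the other prices are no higher there. As
  -- `R` is closed, she is matched to some `b'` in `R`. The two stability inequalities, for `b` at
  -- `l'` and for `b'` at `l`, make `b'` tight as well.
  have step : ∀ b : {b // b ∈ R ∧ l b = l' b}, ∃ b' : {b // b ∈ R ∧ l b = l' b},
      own (σ.symm b) = some b'.1 := by
    rintro ⟨b, hb, hlb⟩
    have hst := hσ (σ.symm b)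
    rw [Equiv.apply_symm_apply] at hst
    have hst' : IsStable E w l (σ.symm b) b := by
      refine ⟨hst.1, fun b' hb' => ?_⟩
      have h1 := hst.2 b' hb'
      have h2 := hle b'
      omega
    obtain ⟨b', hb', hb'o⟩ := hR b hb _ hst'
    refine ⟨⟨b', hb', le_antisymm (hle _) ?_⟩, hb'o⟩
    have h1 := hst.2 b' (hown _ _ hb'o).1
    have h2 := (hown _ _ hb'o).2 b hst.1
    have h3 := hw (σ.symm b) b b'
    omega
  choose f hf using step
  have hfi : Function.Injective f := fun b b' hbb => by
    have h1 := hinj _ _ _ (hf b) (hbb ▸ hf b')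
    exact Subtype.ext (σ.symm.injective h1)
  -- An injective map of the finite set of tight houses into itself is onto, so `b₀` would be
  -- matched.
  obtain ⟨b, hb⟩ := (Finite.injective_iff_surjective.1 hfi) ⟨b₀, hb₀, h₀⟩
  exact hfree _ (by rw [hf b, hb])

end Stable

end PopAlloc

/-! ### Allocations as permutations -/

namespace PopAlloc

section Cycles

variable {A : Type*}

/-- The set of arcs of a permutation, without the loops. -/
def permArcs (σ : Equiv.Perm A) : Set (A × A) :=
  {e | e.1 ≠ e.2 ∧ σ e.1 = e.2}

theorem mem_permArcs {σ : Equiv.Perm A} {a b : A} : (a, b) ∈ permArcs σ ↔ a ≠ b ∧ σ a = b :=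
  Iff.rfl

theorem mem_covered_permArcs {σ : Equiv.Perm A} {a : A} :
    a ∈ covered (permArcs σ) ↔ σ a ≠ a := by
  constructor
  · rintro ⟨b, ⟨h, h'⟩ | ⟨h, h'⟩⟩ he
    · exact h (he.symm.trans h')
    · exact h (σ.injective (h'.trans he.symm))
  · exact fun h => ⟨σ a, Or.inl ⟨h.symm, rfl⟩⟩

/-- The length of the cycle is the minimal period of `a`, which is not one because `a` is moved;
indices are read modulo this period. -/
theorem isDirectedCycle_sameCycle [Finite A] (σ : Equiv.Perm A) {a : A} (ha : σ a ≠ a) :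
    IsDirectedCycle {e : A × A | σ.SameCycle a e.1 ∧ σ e.1 = e.2} := by
  set k := Function.minimalPeriod σ a with hk
  have hpos : 0 < k := Function.minimalPeriod_pos_of_mem_periodicPts
    (by
      have : Function.Injective σ := σ.injective
      exact Function.Injective.mem_periodicPts this a)
  have hk1 : k ≠ 1 := fun h => ha (Function.minimalPeriod_eq_one_iff_isFixedPt.1 h)
  have : NeZero k := ⟨hpos.ne'⟩
  have hmod : ∀ j, σ^[j % k] a = σ^[j] a := fun j => Function.iterate_mod_minimalPeriod_eq
  refine ⟨k, by omega, fun i => σ^[i.val] a, ?_, ?_⟩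
  · intro i j hij
    have h := (Function.iterate_eq_iterate_iff_of_lt_minimalPeriod (ZMod.val_lt i)
      (ZMod.val_lt j)).1 hij
    exact ZMod.val_injective k h
  · have hstep : ∀ i : ZMod k, σ^[(i + 1).val] a = σ (σ^[i.val] a) := by
      intro i
      have : i + 1 = ((i.val + 1 : ℕ) : ZMod k) := by push_cast; rw [ZMod.natCast_zmod_val]
      rw [this, ZMod.val_natCast, hmod, Function.iterate_succ_apply']
    ext ⟨x, y⟩
    simp only [Set.mem_ofPred_eq, Set.mem_range, Prod.mk.injEq, hstep]
    constructor
    · rintro ⟨hs, rfl⟩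
      obtain ⟨j, hj⟩ := hs.exists_nat_pow_eq
      refine ⟨(j : ZMod k), ?_⟩
      have : σ^[((j : ZMod k)).val] a = x := by
        rw [ZMod.val_natCast, hmod, ← hj, Equiv.Perm.iterate_eq_pow]
      exact ⟨this, congrArg σ this⟩
    · rintro ⟨i, rfl, rfl⟩
      refine ⟨⟨i.val, ?_⟩, rfl⟩
      rw [Equiv.Perm.iterate_eq_pow, zpow_natCast]

theorem IsDirectedCycle.arcs_unique {C : Set (A × A)} (hC : IsDirectedCycle C) :
    (∀ a b b', (a, b) ∈ C → (a, b') ∈ C → b = b') ∧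
      (∀ a a' b, (a, b) ∈ C → (a', b) ∈ C → a = a') ∧
      ∀ a ∈ covered C, (∃ b, (a, b) ∈ C) ∧ ∃ b, (b, a) ∈ C := by
  obtain ⟨k, -, v, hv, rfl⟩ := hC
  simp only [Set.mem_range, Prod.mk.injEq]
  refine ⟨?_, ?_, ?_⟩
  · rintro a b b' ⟨i, rfl, rfl⟩ ⟨j, hj, rfl⟩
    rw [hv hj]
  · rintro a a' b ⟨i, rfl, rfl⟩ ⟨j, rfl, hj⟩
    rw [add_right_cancel (hv hj)]
  · rintro a ⟨b, ⟨i, hi⟩ | ⟨i, hi⟩⟩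
    · simp only [Prod.mk.injEq] at hi
      exact ⟨⟨_, i, hi.1, rfl⟩, ⟨_, i - 1, rfl, by simpa using hi.1⟩⟩
    · simp only [Prod.mk.injEq] at hi
      exact ⟨⟨_, i + 1, hi.2, rfl⟩, ⟨_, i, rfl, hi.2⟩⟩

end Cycles

/-! ### Popularity as a statement about permutations and prices. -/

namespace HousingMarket

variable {A : Type*} (D : HousingMarket A)

/-- The agent `a` accepts the house of `b`, or `b` is `a` herself. -/
def Accepts (a b : A) : Prop := (a, b) ∈ D.arcs ∨ a = b

/-- The agent `a` prefers the house of `b` to that of `b'`, where her own house comes last. -/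
def Better (a b b' : A) : Prop := (b ≠ a ∧ b' = a) ∨ D.pref a b b'

open Classical in
/-- What `a` gains by exchanging `b` for `b'`. -/
noncomputable def gain (a b b' : A) : ℤ :=
  (if D.Better a b' b then 1 else 0) - if D.Better a b b' then 1 else 0

theorem gain_self (a b : A) : D.gain a b b = 0 := by simp [gain]

theorem gain_neg (a b b' : A) : D.gain a b b' = -D.gain a b' b := by simp [gain]

theorem gain_le_one (a b b' : A) : D.gain a b b' ≤ 1 := by
  unfold gain; split_ifs <;> norm_num

variable {D}

theorem isAllocation_permArcs [Finite A] {σ : Equiv.Perm A} (hσ : ∀ a, D.Accepts a (σ a)) :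
    D.IsAllocation (permArcs σ) := by
  refine ⟨?_, {C | ∃ a, σ a ≠ a ∧ C = {e : A × A | σ.SameCycle a e.1 ∧ σ e.1 = e.2}}, ?_, ?_, ?_⟩
  · rintro ⟨a, b⟩ he
    obtain ⟨h, rfl⟩ := mem_permArcs.1 he
    exact (hσ a).resolve_right h
  · rintro C ⟨a, ha, rfl⟩
    exact isDirectedCycle_sameCycle σ ha
  · rintro C ⟨a, ha, rfl⟩ C' ⟨a', ha', rfl⟩ hne
    have key : ∀ c x, x ∈ covered {e : A × A | σ.SameCycle c e.1 ∧ σ e.1 = e.2} →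
        σ.SameCycle c x := by
      rintro c x ⟨y, ⟨h, -⟩ | ⟨h, h'⟩⟩
      · exact h
      · simp only at h'; rw [← h']; exact Equiv.Perm.sameCycle_apply_right.2 h
    refine Set.disjoint_left.2 fun x hx hx' => hne ?_
    have hs : σ.SameCycle a a' := (key _ _ hx).trans (key _ _ hx').symm
    ext e
    exact and_congr_left fun _ => ⟨fun h => hs.symm.trans h, fun h => hs.trans h⟩
  · ext ⟨a, b⟩
    simp only [mem_permArcs, Set.mem_sUnion, Set.mem_ofPred_eq]
    constructor
    · rintro ⟨h, rfl⟩
      exact ⟨_, ⟨a, h.symm, rfl⟩, Equiv.Perm.SameCycle.refl _ _, rfl⟩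
    · rintro ⟨_, ⟨c, hc, rfl⟩, hs, h'⟩
      refine ⟨fun h => hc ?_, h'⟩
      subst h
      exact (hs.apply_eq_self_iff).2 h'

/-- Disjointness of the cycles makes the arcs the graph of an injective partial map, and a node that
is entered is also left. Extending this map by the identity therefore stays injective. -/
theorem IsAllocation.exists_perm [Finite A] {S : Set (A × A)} (hS : D.IsAllocation S) :
    ∃ σ : Equiv.Perm A, (∀ a, D.Accepts a (σ a)) ∧ S = permArcs σ := by
  classical
  obtain ⟨hSD, 𝒞, hcyc, hdis, rfl⟩ := hS
  have same : ∀ C ∈ 𝒞, ∀ C' ∈ 𝒞, ∀ a, a ∈ covered C → a ∈ covered C' → C = C' :=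
    fun C hC C' hC' a ha ha' => by
      by_contra hne
      exact Set.disjoint_left.1 (hdis hC hC' hne) ha ha'
  have hout : ∀ a b b', (a, b) ∈ ⋃₀ 𝒞 → (a, b') ∈ ⋃₀ 𝒞 → b = b' := by
    rintro a b b' ⟨C, hC, h⟩ ⟨C', hC', h'⟩
    obtain rfl := same C hC C' hC' a ⟨b, .inl h⟩ ⟨b', .inl h'⟩
    exact (hcyc C hC).arcs_unique.1 _ _ _ h h'
  have hin : ∀ a a' b, (a, b) ∈ ⋃₀ 𝒞 → (a', b) ∈ ⋃₀ 𝒞 → a = a' := by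
    rintro a a' b ⟨C, hC, h⟩ ⟨C', hC', h'⟩
    obtain rfl := same C hC C' hC' b ⟨a, .inr h⟩ ⟨a', .inr h'⟩
    exact (hcyc C hC).arcs_unique.2.1 _ _ _ h h'
  have hcov : ∀ a b, (b, a) ∈ ⋃₀ 𝒞 → ∃ b, (a, b) ∈ ⋃₀ 𝒞 := by
    rintro a b ⟨C, hC, h⟩
    obtain ⟨b', hb'⟩ := ((hcyc C hC).arcs_unique.2.2 a ⟨b, .inr h⟩).1
    exact ⟨b', C, hC, hb'⟩
  let f : A → A := fun a => if h : ∃ b, (a, b) ∈ ⋃₀ 𝒞 then h.choose else a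
  have hf : ∀ a b, (a, b) ∈ ⋃₀ 𝒞 → f a = b := fun a b h => by
    have h' : ∃ b, (a, b) ∈ ⋃₀ 𝒞 := ⟨b, h⟩
    simp only [f, dif_pos h']
    exact hout _ _ _ h'.choose_spec h
  have hf' : ∀ a, (¬ ∃ b, (a, b) ∈ ⋃₀ 𝒞) → f a = a := fun a h => by simp only [f, dif_neg h]
  have hfi : Function.Injective f := by
    intro a a' haa
    by_cases h : ∃ b, (a, b) ∈ ⋃₀ 𝒞 <;> by_cases h' : ∃ b, (a', b) ∈ ⋃₀ 𝒞
    · obtain ⟨b, hb⟩ := h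
      obtain ⟨b', hb'⟩ := h'
      rw [hf _ _ hb, hf _ _ hb'] at haa
      subst haa
      exact hin _ _ _ hb hb'
    · obtain ⟨b, hb⟩ := h
      rw [hf _ _ hb, hf' _ h'] at haa
      subst haa
      exact absurd (hcov _ _ hb) h'
    · obtain ⟨b, hb⟩ := h'
      rw [hf _ _ hb, hf' _ h] at haa
      subst haa
      exact absurd (hcov _ _ hb) h
    · rwa [hf' _ h, hf' _ h'] at haa
  refine ⟨Equiv.ofBijective f (Finite.injective_iff_bijective.1 hfi), fun a => ?_, ?_⟩
  · by_cases h : ∃ b, (a, b) ∈ ⋃₀ 𝒞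
    · obtain ⟨b, hb⟩ := h
      exact .inl (hSD (by simpa [hf _ _ hb] using hb))
    · exact .inr (hf' _ h).symm
  · ext ⟨a, b⟩
    rw [mem_permArcs]
    simp only [Equiv.ofBijective_apply]
    constructor
    · intro h
      exact ⟨fun he => D.loopless a (by simpa [← he] using hSD h), hf _ _ h⟩
    · rintro ⟨hne, rfl⟩
      by_cases h : ∃ b, (a, b) ∈ ⋃₀ 𝒞
      · obtain ⟨b, hb⟩ := h
        rwa [hf _ _ hb]
      · exact absurd (hf' _ h).symm hne

/-- Being covered means being moved, and `pref` compares genuine arcs only, so discarding the loops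
loses nothing. -/
theorem prefers_permArcs_iff {σ τ : Equiv.Perm A} {a : A} :
    D.Prefers a (permArcs σ) (permArcs τ) ↔ D.Better a (σ a) (τ a) := by
  unfold Prefers Better
  rw [mem_covered_permArcs, mem_covered_permArcs, not_not]
  refine or_congr_right ⟨?_, fun h => ⟨_, _, ⟨?_, rfl⟩, ⟨?_, rfl⟩, h⟩⟩
  · rintro ⟨b, b', hb, hb', h⟩
    rwa [(mem_permArcs.1 hb).2, (mem_permArcs.1 hb').2]
  · intro he
    have := (D.pref_arcs _ _ _ h).1
    rw [← show a = σ a from he] at this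
    exact D.loopless _ this
  · intro he
    have := (D.pref_arcs _ _ _ h).2
    rw [← show a = τ a from he] at this
    exact D.loopless _ this

theorem morePopular_permArcs_iff [Fintype A] {σ τ : Equiv.Perm A} :
    D.MorePopular (permArcs τ) (permArcs σ) ↔ 0 < ∑ a, D.gain a (σ a) (τ a) := by
  classical
  unfold MorePopular
  simp only [prefers_permArcs_iff, gain, Finset.sum_sub_distrib, Finset.sum_boole, sub_pos]
  rw [Set.ncard_eq_toFinset_card', Set.ncard_eq_toFinset_card']
  simp

theorem isPopular_permArcs_iff [Fintype A] {σ : Equiv.Perm A} (hσ : ∀ a, D.Accepts a (σ a)) :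
    D.IsPopular (permArcs σ) ↔
      ∀ τ : Equiv.Perm A, (∀ a, D.Accepts a (τ a)) → ∑ a, D.gain a (σ a) (τ a) ≤ 0 := by
  constructor
  · intro h τ hτ
    have := h.2 _ (isAllocation_permArcs hτ)
    rwa [morePopular_permArcs_iff, not_lt] at this
  · refine fun h => ⟨isAllocation_permArcs hσ, fun S hS => ?_⟩
    obtain ⟨τ, hτ, rfl⟩ := hS.exists_perm
    rw [morePopular_permArcs_iff, not_lt]
    exact h τ hτ

theorem isPopular_of_isStable [Fintype A] {l : A → ℕ} {σ : Equiv.Perm A}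
    (hσ : ∀ a, IsStable D.Accepts D.gain l a (σ a)) : D.IsPopular (permArcs σ) :=
  (isPopular_permArcs_iff fun a => (hσ a).1).2 fun _ hτ => sum_gain_nonpos hσ hτ

/-- The bound on the prices is what allows the algorithm to give up as soon as a level reaches `n`.
-/
theorem IsPopular.exists_isStable [Fintype A] {S : Set (A × A)} (hS : D.IsPopular S) :
    ∃ (σ : Equiv.Perm A) (l : A → ℕ), (∀ b, l b < Fintype.card A) ∧
      ∀ a, IsStable D.Accepts D.gain l a (σ a) := by
  obtain ⟨σ, hσ, rfl⟩ := hS.1.exists_perm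
  exact ⟨σ, PopAlloc.exists_isStable D.gain_self D.gain_le_one hσ
    ((isPopular_permArcs_iff hσ).1 hS)⟩

end HousingMarket

end PopAlloc

/-! ### The program -/

namespace PopAlloc

namespace Prog

open PopAlloc.Expr

/-- Add one to a register. -/
def incr (x : ℕ) : Prog := assign x (add (var x) (const 1))

/-- Execute `p` for all values of the register `i` that are smaller than that of `b`. -/
def upTo (i b : ℕ) (p : Prog) : Prog :=
  seq (assign i (const 0)) (loop (lt (var i) (var b)) (seq p (incr i)))

end Prog

open PopAlloc.Expr PopAlloc.Prog

/-- Does the agent prefer her arc `e` to her arc `f`? The arcs from `m` on are the loops. -/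
def prefExpr (e f : Expr) : Expr :=
  mul (lt e (var 1))
    (add (mul (lt f (var 1)) (get 2 (add (mul e (var 1)) f))) (sub (const 1) (lt f (var 1))))

/-- Does the arc `f` beat the arc `e` at the current levels? -/
def beatExpr (e f : Expr) : Expr :=
  lt (add (get 7 (get 1 e)) (prefExpr e f)) (add (get 7 (get 1 f)) (prefExpr f e))

/-- Append the loops to the list of arcs. -/
def loopsProg : Prog :=
  seq (assign 3 (add (var 0) (var 1)))
    (upTo 6 0 (seq (store 0 (add (var 1) (var 6)) (var 6)) (store 1 (add (var 1) (var 6)) (var 6))))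

/-- Compute the lists of the arcs into each house and the adjacency matrix. -/
def adjBody : Prog :=
  seq (store 4 (add (mul (get 1 (var 6)) (var 3)) (get 5 (get 1 (var 6)))) (var 6))
    (seq (store 5 (get 1 (var 6)) (add (get 5 (get 1 (var 6))) (const 1)))
      (store 6 (add (mul (get 0 (var 6)) (var 0)) (get 1 (var 6))) (add (var 6) (const 1))))

/-- Compute the least `L` with `n ≤ L ^ 2`. -/
def sqrtProg : Prog :=
  loop (lt (mul (var 4) (var 4)) (var 0)) (incr 4)

/-- Array 7 holds the levels and array 8 the marks of the beaten arcs. The sum of the two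
comparisons is nonzero exactly if the two numbers differ, so only the marks of the arcs into the
house in register 7 are erased. -/
def clearBody : Prog :=
  cond (add (lt (get 1 (var 6)) (var 7)) (lt (var 7) (get 1 (var 6)))) skip
    (store 8 (var 6) (const 0))

/-- Array 6 holds arc numbers plus one, and zero for no arc. It gives at once the only arc that
leaves the tail of the current arc and enters the house in register 7; the two arcs are compared in
both directions. -/
def markBody : Prog :=
  seq (assign 9 (get 6 (add (mul (get 0 (var 6)) (var 0)) (var 7))))
    (cond (var 9)
      (seq (assign 9 (sub (var 9) (const 1)))
        (seq (cond (beatExpr (var 9) (var 6)) (store 8 (var 9) (const 1)) skip)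
          (cond (beatExpr (var 6) (var 9)) (store 8 (var 6) (const 1)) skip)))
      skip)

/-- Update the marks of the arcs that are beaten, after the level of the house in register `7` has
changed. -/
def refreshProg : Prog :=
  seq (upTo 6 3 clearBody) (upTo 6 3 markBody)

/-- Arrays 9 and 10 are the matching, from agents to houses and back, with values shifted by one so
that zero means unmatched. Arrays 11, 12 and 13 hold the bid and the scan position of each house and
the price of each agent. -/
def resetBody : Prog :=
  seq (store 9 (var 6) (const 0)) (seq (store 10 (var 6) (const 0))
    (seq (store 11 (var 6) (const 0)) (seq (store 12 (var 6) (const 0))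
      (store 13 (var 6) (const 0)))))

/-- The house in register `8` (plus one) looks at its next arc. -/
def bidProg : Prog :=
  seq (assign 17 (sub (var 8) (const 1)))
    (cond (lt (get 12 (var 17)) (get 5 (var 17)))
      (seq (assign 9 (get 4 (add (mul (var 17) (var 3)) (get 12 (var 17)))))
        (seq (assign 10 (get 0 (var 9)))
          (cond (mul (lt (get 8 (var 9)) (const 1))
              (lt (get 13 (var 10)) (add (get 11 (var 17)) (const 1))))
            (seq (assign 11 (get 9 (var 10)))
              (seq (store 9 (var 10) (var 8))
                (seq (store 13 (var 10) (add (get 13 (var 10)) (const 1)))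
                  (assign 8 (var 11)))))
            (store 12 (var 17) (add (get 12 (var 17)) (const 1))))))
      (seq (store 11 (var 17) (add (get 11 (var 17)) (const 1)))
        (seq (store 12 (var 17) (const 0))
          (cond (lt (get 11 (var 17)) (var 4)) skip (assign 8 (const 0))))))

/-- A new house enters only if none is waiting to bid; a house that has been displaced bids again at
once. -/
def auctionBody : Prog :=
  cond (var 8) bidProg (seq (assign 8 (add (var 7) (const 1))) (incr 7))

/-- Match the houses to agents until every unmatched house has been rejected at all prices smaller
than `L`. -/
def auctionProg : Prog :=
  seq (assign 7 (const 0)) (seq (assign 8 (const 0))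
    (loop (add (lt (var 7) (var 0)) (var 8)) auctionBody))

def mateBody : Prog :=
  cond (get 9 (var 6)) (store 10 (sub (get 9 (var 6)) (const 1)) (add (var 6) (const 1))) skip

/-- Breadth-first search from houses to agents. Array 15 is the queue, between the positions in
registers 12 and 13; array 14 records from which house (plus one) an agent was reached; register 14
receives the first unmatched agent (plus one). -/
def searchBody : Prog :=
  seq (assign 17 (get 15 (var 12)))
    (cond (lt (get 12 (var 17)) (get 5 (var 17)))
      (seq (assign 9 (get 4 (add (mul (var 17) (var 3)) (get 12 (var 17)))))
        (seq (assign 10 (get 0 (var 9)))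
          (seq (store 12 (var 17) (add (get 12 (var 17)) (const 1)))
            (cond (mul (lt (get 8 (var 9)) (const 1)) (lt (get 14 (var 10)) (const 1)))
              (seq (store 14 (var 10) (add (var 17) (const 1)))
                (cond (get 9 (var 10))
                  (seq (store 15 (var 13) (sub (get 9 (var 10)) (const 1))) (incr 13))
                  (assign 14 (add (var 10) (const 1)))))
              skip))))
      (incr 12))

/-- Search for an augmenting path from the house in register `7`. -/
def searchProg : Prog :=
  seq (upTo 6 0 (seq (store 14 (var 6) (const 0)) (store 12 (var 6) (const 0))))
    (seq (store 15 (const 0) (var 7))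
      (seq (assign 12 (const 0)) (seq (assign 13 (const 1)) (seq (assign 14 (const 0))
        (loop (mul (lt (var 12) (var 13)) (lt (var 14) (const 1))) searchBody)))))

/-- The agent takes the house from which she was reached. The former mate of this house, read before
it is overwritten, is the next agent to be served; at the root of the search there is none, and the
value zero ends the loop. -/
def augmentBody : Prog :=
  seq (assign 10 (sub (var 14) (const 1)))
    (seq (assign 17 (sub (get 14 (var 10)) (const 1)))
      (seq (assign 14 (get 10 (var 17)))
        (seq (store 9 (var 10) (add (var 17) (const 1)))
          (store 10 (var 17) (add (var 10) (const 1))))))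

/-- Augment the matching along the path that ends in the agent in register `14` (plus one). -/
def augmentProg : Prog := loop (var 14) augmentBody

/-- All houses before register 7 are matched, and they stay so under augmentation; hence register 7
never moves back. Register 15 becomes zero when a search fails. -/
def matchBody : Prog :=
  cond (get 10 (var 7)) (incr 7)
    (seq searchProg (cond (var 14) augmentProg (assign 15 (const 0))))

/-- Augment the matching until it covers all houses, or there is no augmenting path from the house in
register `7`. -/
def matchProg : Prog :=
  seq (assign 7 (const 0)) (seq (assign 15 (const 1))
    (loop (mul (lt (var 7) (var 0)) (var 15)) matchBody))

/-- Find a perfect matching of the arcs that are not beaten, or raise the level of a house. -/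
def roundProg : Prog :=
  seq (upTo 6 0 resetBody) (seq auctionProg (seq (upTo 6 0 mateBody) (seq matchProg
    -- If register 15 is zero, register 7 names the blocked house. When its level reaches `n`, the
    -- main loop is stopped by register 5 while register 2, the answer, is still zero.
    (cond (var 15) (seq (assign 5 (const 0)) (assign 2 (const 1)))
      (seq (store 7 (var 7) (add (get 7 (var 7)) (const 1)))
        (cond (lt (get 7 (var 7)) (var 0)) refreshProg (assign 5 (const 0))))))))

def outputProg : Prog :=
  cond (var 2) (upTo 6 0 (store 3 (var 6) (sub (get 9 (var 6)) (const 1)))) skip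

/-- The algorithm. -/
def popularProg : Prog :=
  seq loopsProg (seq (upTo 6 3 adjBody) (seq sqrtProg (seq (upTo 7 0 refreshProg)
    (seq (assign 5 (const 1)) (seq (loop (var 5) roundProg) outputProg)))))

namespace Runs

variable {W : ℕ} {s : State}

/-- The rule for `upTo`; the invariant must not mention the loop variable. -/
theorem upTo {i b : ℕ} {p : Prog} (hib : i ≠ b) (hi : p.writesReg i = false)
    (hb : p.writesReg b = false) (I : ℕ → State → Prop) (N C : ℕ)
    (hset : ∀ k s v, I k s → I k (s.setReg i v)) (hN : N + 1 < W) (hW : 1 < W)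
    (hbody : ∀ k s, k < N → I k s → s.reg i = k → s.reg b = N →
      Runs W p s fun s' t => I (k + 1) s' ∧ t ≤ C)
    (hs : I 0 s) (hsb : s.reg b = N) :
    Runs W (Prog.upTo i b p) s fun s' t => I N s' ∧ t ≤ (C + 8) * N + 6 := by
  refine Runs.assign_seq (show 0 < W by omega) ?_
  simp only [eval]
  refine (loop (fun s => I (s.reg i) s ∧ s.reg b = N ∧ s.reg i ≤ N)
    (fun s => (C + 8) * (N - s.reg i)) (fun s _ => by exact ⟨trivial, trivial, hW⟩) ?_ ?_).imp ?_
  · rintro s ⟨hI, hsb, hle⟩ h0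
    have hlt : s.reg i < N := by
      by_contra h
      exact h0 (by simp [eval, hsb, h])
    refine Runs.seq ((hbody _ s hlt hI rfl hsb).frame.imp ?_)
    rintro s' t ⟨⟨hI', ht⟩, hf⟩
    have hi' := hf.1 _ hi
    have hb' := hf.1 _ hb
    refine Runs.imp (of_wp (Q := fun s'' => s'' = s'.setReg i (s'.reg i + 1)) ⟨?_, fun _ => rfl⟩) ?_
    · refine ⟨trivial, hW, ?_⟩
      simp only [eval]; omega
    rintro _ t' ⟨rfl, ht'⟩
    have ht'' : t' ≤ 4 := ht'
    rw [hi']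
    refine ⟨⟨?_, ?_, ?_⟩, ?_⟩
    · simpa using hset _ _ _ hI'
    · simp [hib.symm, hb', hsb]
    · simp; omega
    · simp only [State.setReg_reg, if_true, cost]
      obtain ⟨j, hj⟩ : ∃ j, N - s.reg i = j + 1 := ⟨N - s.reg i - 1, by omega⟩
      have hj' : N - (s.reg i + 1) = j := by omega
      rw [hj, hj', Nat.mul_add]
      omega
  · refine ⟨?_, ?_, ?_⟩
    · simpa using hset _ _ _ hs
    · simp [hib.symm, hsb]
    · simp
  · rintro s' t' ⟨⟨hI, hsb, hle⟩, h0, ht⟩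
    have hN' : s'.reg i = N := by
      by_contra h
      have : s'.reg i < N := by omega
      simp [eval, hsb, this] at h0
    rw [hN'] at hI
    refine ⟨hI, ?_⟩
    simp only [State.setReg_reg, if_true, cost, Nat.sub_zero] at ht ⊢
    omega

end Runs

end PopAlloc

/-! ### Markets as lists of arcs -/

namespace PopAlloc

open PopAlloc.Expr PopAlloc.Prog

/-- The data that the program computes first: the arcs `e` from `T e` to `H e`, the last `n` of which
are loops, their preferences `P`, the lists `adj` of the arcs into each house, the adjacency matrix
`E`, and the rounded square root `L` of `n`. -/
structure Net where
  n : ℕ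
  m : ℕ
  L : ℕ
  T : ℕ → ℕ
  H : ℕ → ℕ
  P : ℕ → ℕ
  adj : ℕ → ℕ
  deg : ℕ → ℕ
  E : ℕ → ℕ

namespace Net

/-- The number of arcs, including the loops. -/
def N (G : Net) : ℕ := G.n + G.m

/-- Arc number `k` into the house `h`. -/
def arcInto (G : Net) (h k : ℕ) : ℕ := G.adj (h * G.N + k)

/-- Each house owns a block of `N` cells of `adj`, of which the first `deg` are used. A cell of `E`
holds the number of an arc plus one, or zero. The last two conditions say that `L` is the square
root of `n`, rounded up. -/
structure Valid (G : Net) : Prop where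
  T_lt : ∀ e < G.N, G.T e < G.n
  H_lt : ∀ e < G.N, G.H e < G.n
  T_loop : ∀ i < G.n, G.T (G.m + i) = i
  H_loop : ∀ i < G.n, G.H (G.m + i) = i
  P_le : ∀ k, G.P k ≤ 1
  inj : ∀ e < G.N, ∀ f < G.N, G.T e = G.T f → G.H e = G.H f → e = f
  adj_lt : ∀ h < G.n, ∀ k < G.deg h, G.arcInto h k < G.N ∧ G.H (G.arcInto h k) = h
  adj_surj : ∀ e < G.N, ∃ k < G.deg (G.H e), G.arcInto (G.H e) k = e
  sum_deg : ∑ h ∈ Finset.range G.n, G.deg h = G.N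
  E_eq : ∀ e < G.N, G.E (G.T e * G.n + G.H e) = e + 1
  E_inv : ∀ a < G.n, ∀ b < G.n, G.E (a * G.n + b) ≠ 0 →
    ∃ e < G.N, G.T e = a ∧ G.H e = b ∧ G.E (a * G.n + b) = e + 1
  le_sq : G.n ≤ G.L * G.L
  sq_lt : G.L = 0 ∨ (G.L - 1) * (G.L - 1) < G.n

/-- The data are in the memory. -/
structure Loaded (G : Net) (s : State) : Prop where
  n_eq : s.reg 0 = G.n
  m_eq : s.reg 1 = G.m
  N_eq : s.reg 3 = G.N
  L_eq : s.reg 4 = G.L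
  T_eq : s.arr 0 = G.T
  H_eq : s.arr 1 = G.H
  P_eq : s.arr 2 = G.P
  adj_eq : s.arr 4 = G.adj
  deg_eq : s.arr 5 = G.deg
  E_eq : s.arr 6 = G.E

/-- The registers and arrays that hold the data are never overwritten by `p`. -/
def _root_.PopAlloc.Prog.KeepsData (p : Prog) : Prop :=
  (∀ x ∈ [0, 1, 3, 4], p.writesReg x = false) ∧ ∀ x ∈ [0, 1, 2, 4, 5, 6], p.writesArr x = false

instance (p : Prog) : Decidable p.KeepsData := by
  unfold Prog.KeepsData; infer_instance

variable {G : Net} {W : ℕ} {s s' : State}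

theorem Loaded.of_frame {p : Prog} (h : G.Loaded s) (hp : p.KeepsData) (hf : p.Frame s s') :
    G.Loaded s' := by
  have hr : ∀ x ∈ [0, 1, 3, 4], s'.reg x = s.reg x := fun x hx => hf.1 x (hp.1 x hx)
  have ha : ∀ x ∈ [0, 1, 2, 4, 5, 6], s'.arr x = s.arr x := fun x hx => hf.2 x (hp.2 x hx)
  simp only [List.mem_cons, List.not_mem_nil, or_false, forall_eq_or_imp, forall_eq] at hr ha
  obtain ⟨r0, r1, r3, r4⟩ := hr
  obtain ⟨a0, a1, a2, a4, a5, a6⟩ := ha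
  exact ⟨r0 ▸ h.n_eq, r1 ▸ h.m_eq, r3 ▸ h.N_eq, r4 ▸ h.L_eq, a0 ▸ h.T_eq, a1 ▸ h.H_eq, a2 ▸ h.P_eq,
    a4 ▸ h.adj_eq, a5 ▸ h.deg_eq, a6 ▸ h.E_eq⟩

theorem Valid.deg_le (hG : G.Valid) {h : ℕ} (hh : h < G.n) : G.deg h ≤ G.N := by
  rw [← hG.sum_deg]
  exact Finset.single_le_sum (f := G.deg) (fun _ _ => Nat.zero_le _) (Finset.mem_range.2 hh)

theorem Valid.L_le (hG : G.Valid) : G.L ≤ G.n := by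
  rcases hG.sq_lt with h | h
  · omega
  · by_contra hlt
    have : G.n ≤ G.L - 1 := by omega
    rcases Nat.eq_zero_or_pos G.n with h0 | h0
    · omega
    · nlinarith

theorem n_le_N : G.n ≤ G.N := Nat.le_add_right _ _

/-- The words are long enough for all numbers that occur. -/
def Words (G : Net) (W : ℕ) : Prop := 4 * ((G.N + 2) * (G.N + 2)) ≤ W

theorem Words.lt (hW : G.Words W) {x : ℕ} (hx : x ≤ G.N + 4) : x < W := by
  unfold Words at hW
  nlinarith

theorem Words.mul_add_lt (hW : G.Words W) {x y z : ℕ} (hx : x ≤ G.N + 1) (hy : y ≤ G.N + 1)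
    (hz : z ≤ G.N + 1) : x * y + z < W := by
  unfold Words at hW
  have := Nat.mul_le_mul hx hy
  nlinarith

theorem Words.mul_lt (hW : G.Words W) {x y : ℕ} (hx : x ≤ G.N + 1) (hy : y ≤ G.N + 1) :
    x * y < W := by
  simpa using hW.mul_add_lt hx hy (Nat.zero_le _)

end Net

/-- Sums over functions that differ in one place only. -/
theorem sum_range_add_eq {f g : ℕ → ℕ} {n x : ℕ} (hx : x < n) (h : ∀ i, i ≠ x → g i = f i) :
    ∑ i ∈ Finset.range n, g i + f x = ∑ i ∈ Finset.range n, f i + g x := by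
  rw [← Finset.add_sum_erase _ _ (Finset.mem_range.2 hx),
    ← Finset.add_sum_erase (Finset.range n) f (Finset.mem_range.2 hx),
    Finset.sum_congr rfl fun i hi => h i (Finset.ne_of_mem_erase hi)]
  ring

/-! ### The auction -/

namespace Net

variable (G : Net)

/-- The state of the auction: `own a` is the house that the agent `a` accepts at present (plus one),
the house `h` has been rejected at all prices smaller than `d h`, and is looking at its arc number
`cur h`; the house `x` (plus one) is about to be matched, and so are the houses from `b` on. -/
structure Auction (dead own d cur price : ℕ → ℕ) (x b : ℕ) : Prop where
  alive : ∀ a < G.n, own a ≠ 0 → ∃ e < G.N, dead e = 0 ∧ G.T e = a ∧ G.H e + 1 = own a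
  inj : ∀ a < G.n, ∀ a' < G.n, own a = own a' → own a ≠ 0 → a = a'
  x_le : x ≤ G.n
  x_free : x ≠ 0 → ∀ a < G.n, own a ≠ x
  d_le : ∀ h < G.n, d h ≤ G.L
  cur_le : ∀ h < G.n, cur h ≤ G.deg h
  d_lt : x ≠ 0 → d (x - 1) < G.L
  le_price : ∀ e < G.N, dead e = 0 → d (G.H e) ≤ price (G.T e)
  lt_price : ∀ h < G.n, ∀ k < cur h, dead (G.arcInto h k) = 0 → d h < price (G.T (G.arcInto h k))
  price_own : ∀ a < G.n, own a ≠ 0 → price a ≤ d (own a - 1) + 1 ∧ d (own a - 1) < G.L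
  price_free : ∀ a < G.n, own a = 0 → price a = 0
  b_le : b ≤ G.n
  x_le_b : x ≤ b
  rejected : ∀ h < b, (∀ a < G.n, own a ≠ h + 1) → h + 1 ≠ x → d h = G.L
  fresh : ∀ h < G.n, b ≤ h → d h = 0 ∧ ∀ a < G.n, own a ≠ h + 1

/-- The progress of the auction. -/
def progress (d cur price : ℕ → ℕ) (b : ℕ) : ℕ :=
  ∑ h ∈ Finset.range G.n, (d h * (G.deg h + 1) + cur h) + ∑ a ∈ Finset.range G.n, price a + b

variable {G} {dead own d cur price : ℕ → ℕ} {x b : ℕ}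

theorem Auction.own_le (hI : G.Auction dead own d cur price x b) (hG : G.Valid) {a : ℕ}
    (ha : a < G.n) : own a ≤ G.n := by
  by_cases h : own a = 0
  · omega
  · obtain ⟨e, he, -, -, h'⟩ := hI.alive a ha h
    have := hG.H_lt e he
    omega

theorem Auction.price_le (hI : G.Auction dead own d cur price x b) {a : ℕ}
    (ha : a < G.n) : price a ≤ G.L := by
  by_cases h : own a = 0
  · rw [hI.price_free a ha h]; omega
  · have := hI.price_own a ha h
    omega

/-- The weights `deg h + 1` of the bids sum to `N + n`, so the auction takes `O(L * (m + n))` steps.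
-/
theorem Auction.progress_le (hI : G.Auction dead own d cur price x b) (hG : G.Valid) :
    G.progress d cur price b ≤ G.L * (G.N + G.n) + G.N + G.n * G.L + G.n := by
  have h1 : ∑ h ∈ Finset.range G.n, (d h * (G.deg h + 1) + cur h) ≤
      ∑ h ∈ Finset.range G.n, (G.L * (G.deg h + 1) + G.deg h) :=
    Finset.sum_le_sum fun h hh => add_le_add
      (Nat.mul_le_mul_right _ (hI.d_le h (Finset.mem_range.1 hh)))
      (hI.cur_le h (Finset.mem_range.1 hh))
  have h2 : ∑ a ∈ Finset.range G.n, price a ≤ G.n * G.L := by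
    simpa using Finset.sum_le_card_nsmul (Finset.range G.n) price G.L
      fun a ha => hI.price_le (Finset.mem_range.1 ha)
  rw [Finset.sum_add_distrib (g := G.deg), ← Finset.mul_sum, Finset.sum_add_distrib (f := G.deg),
    hG.sum_deg] at h1
  simp only [Finset.sum_const, Finset.card_range, smul_eq_mul, mul_one] at h1
  have := hI.b_le
  unfold progress
  omega

theorem Auction.next (hI : G.Auction dead own d cur price 0 b) (hG : G.Valid) (hb : b < G.n) :
    G.Auction dead own d cur price (b + 1) (b + 1) ∧
      G.progress d cur price b + 1 ≤ G.progress d cur price (b + 1) := by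
  have hfr := hI.fresh b hb le_rfl
  have hL : 0 < G.L := by
    have := hG.le_sq
    by_contra h
    have : G.L = 0 := by omega
    simp_all
  refine ⟨{ hI with
    x_le := hb
    x_free := fun _ => hfr.2
    d_lt := fun _ => by simpa [hfr.1] using hL
    b_le := hb
    x_le_b := le_rfl
    rejected := fun h hh hfree hne => hI.rejected h (by omega) hfree (by omega)
    fresh := fun h hh hbh => hI.fresh h hh (by omega) }, ?_⟩
  unfold progress; omega

/-- A price is never below the bid of a house with a live arc to the agent, so an accepted bid
equals the price. The new price is the bid plus one, and the house that the agent drops, if any,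
bids next. -/
theorem Auction.take (hI : G.Auction dead own d cur price x b) (hG : G.Valid) (hx : x ≠ 0)
    (hc : cur (x - 1) < G.deg (x - 1)) {e : ℕ} (he : e = G.arcInto (x - 1) (cur (x - 1)))
    (ha : dead e = 0) (hp : price (G.T e) ≤ d (x - 1)) :
    G.Auction dead (Function.update own (G.T e) x) d cur
        (Function.update price (G.T e) (price (G.T e) + 1)) (own (G.T e)) b ∧
      G.progress d cur price b + 1 ≤
        G.progress d cur (Function.update price (G.T e) (price (G.T e) + 1)) b := by
  have hxn := hI.x_le
  obtain ⟨heN, heH⟩ := hG.adj_lt (x - 1) (by omega) _ hc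
  rw [← he] at heN heH
  have hTn := hG.T_lt e heN
  have hpe : price (G.T e) = d (x - 1) := le_antisymm hp (heH ▸ hI.le_price e heN ha)
  have hpr : ∀ a, price a ≤ Function.update price (G.T e) (price (G.T e) + 1) a := by
    intro a
    by_cases h : a = G.T e
    · subst h; simp
    · simp [h]
  refine ⟨{ hI with alive := ?_, inj := ?_, x_le := ?_, x_free := ?_, d_lt := ?_, le_price := ?_, lt_price := ?_, price_own := ?_, price_free := ?_, x_le_b := ?_, rejected := ?_, fresh := ?_ }, ?_⟩
  · intro a han
    by_cases h : a = G.T e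
    · subst h
      simp only [Function.update_self]
      exact fun _ => ⟨e, heN, ha, rfl, by omega⟩
    · simpa [h] using hI.alive a han
  · intro a han a' han'
    by_cases h : a = G.T e <;> by_cases h' : a' = G.T e
    · intro _ _; rw [h, h']
    · subst h
      simp only [Function.update_self, Function.update_of_ne h']
      exact fun hh _ => absurd hh.symm (hI.x_free hx a' han')
    · subst h'
      simp only [Function.update_self, Function.update_of_ne h]
      exact fun hh _ => absurd hh (hI.x_free hx a han)
    · simpa [h, h'] using hI.inj a han a' han'
  · exact hI.own_le hG hTn
  · intro h0 a han
    by_cases h : a = G.T e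
    · subst h
      simp only [Function.update_self]
      exact fun hh => hI.x_free hx _ hTn hh.symm
    · simp only [Function.update_of_ne h]
      exact fun hh => h (hI.inj a han _ hTn hh (hh ▸ h0))
  · exact fun h0 => (hI.price_own _ hTn h0).2
  · exact fun f hf hf0 => (hI.le_price f hf hf0).trans (hpr _)
  · exact fun h hh k hk hk0 => (hI.lt_price h hh k hk hk0).trans_le (hpr _)
  · intro a han
    by_cases h : a = G.T e
    · subst h
      simp only [Function.update_self]
      exact fun _ => ⟨by omega, hI.d_lt hx⟩
    · simpa [h] using hI.price_own a han
  · intro a han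
    by_cases h : a = G.T e
    · subst h
      simp [hx]
    · simpa [h] using hI.price_free a han
  · by_cases h : own (G.T e) = 0
    · omega
    · by_contra hlt
      have := (hI.fresh (own (G.T e) - 1) (by have := hI.own_le hG hTn; omega) (by omega)).2 _ hTn
      omega
  · intro h hh hfree hne
    refine hI.rejected h hh (fun a han => ?_) ?_
    · by_cases haT : a = G.T e
      · subst haT; omega
      · simpa [haT] using hfree a han
    · have := hfree _ hTn
      simp only [Function.update_self] at this
      omega
  · intro h hh hbh
    refine ⟨(hI.fresh h hh hbh).1, fun a han => ?_⟩
    by_cases haT : a = G.T e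
    · subst haT
      have := hI.x_le_b
      simp only [Function.update_self]
      omega
    · simpa [haT] using (hI.fresh h hh hbh).2 a han
  · have := sum_range_add_eq (f := price)
      (g := Function.update price (G.T e) (price (G.T e) + 1)) hTn
      fun i hi => Function.update_of_ne hi _ _
    simp only [Function.update_self] at this
    unfold progress
    omega

theorem Auction.skip (hI : G.Auction dead own d cur price x b) (hx : x ≠ 0)
    (hc : cur (x - 1) < G.deg (x - 1))
    (h : dead (G.arcInto (x - 1) (cur (x - 1))) = 0 →
      d (x - 1) < price (G.T (G.arcInto (x - 1) (cur (x - 1))))) :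
    G.Auction dead own d (Function.update cur (x - 1) (cur (x - 1) + 1)) price x b ∧
      G.progress d cur price b + 1 ≤
        G.progress d (Function.update cur (x - 1) (cur (x - 1) + 1)) price b := by
  have hxn := hI.x_le
  refine ⟨{ hI with cur_le := ?_, lt_price := ?_ }, ?_⟩
  · intro h hh
    by_cases hx : h = x - 1
    · subst hx; simp; omega
    · simpa [hx] using hI.cur_le h hh
  · intro h' hh k hk
    by_cases hx' : h' = x - 1
    · subst hx'
      simp only [Function.update_self] at hk
      rcases Nat.lt_succ_iff_lt_or_eq.1 hk with hk | rfl
      · exact hI.lt_price _ hh k hk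
      · exact h
    · simp only [Function.update_of_ne hx'] at hk
      exact hI.lt_price _ hh k hk
  · have := sum_range_add_eq (f := fun h => d h * (G.deg h + 1) + cur h)
      (g := fun h => d h * (G.deg h + 1) + Function.update cur (x - 1) (cur (x - 1) + 1) h)
      (show x - 1 < G.n by omega) fun i hi => by simp [hi]
    simp only [Function.update_self] at this
    unfold progress
    omega

/-- The whole list of the house has been scanned, so the agents of its live arcs all have prices
above the old bid, which restores `le_price` for the new one. Progress gains `deg + 1` from the bid
and loses at most `deg` from the reset position. At the bid `L` the house gives up. -/
theorem Auction.raise (hI : G.Auction dead own d cur price x b) (hG : G.Valid) (hx : x ≠ 0)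
    (hc : G.deg (x - 1) ≤ cur (x - 1)) :
    G.Auction dead own (Function.update d (x - 1) (d (x - 1) + 1)) (Function.update cur (x - 1) 0)
        price (if d (x - 1) + 1 < G.L then x else 0) b ∧
      G.progress d cur price b + 1 ≤
        G.progress (Function.update d (x - 1) (d (x - 1) + 1)) (Function.update cur (x - 1) 0)
          price b := by
  have hxn := hI.x_le
  have hxb := hI.x_le_b
  have hdL := hI.d_lt hx
  have hfr := hI.x_free hx
  have hcur := hI.cur_le (x - 1) (by omega)
  have hd : ∀ a < G.n, own a ≠ 0 →
      Function.update d (x - 1) (d (x - 1) + 1) (own a - 1) = d (own a - 1) := fun a han h0 => by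
    have := hfr a han
    exact Function.update_of_ne (by omega) _ _
  refine ⟨{ hI with x_le := ?_, x_free := ?_, d_le := ?_, cur_le := ?_, d_lt := ?_, le_price := ?_, lt_price := ?_, price_own := ?_, x_le_b := ?_, rejected := ?_, fresh := ?_ }, ?_⟩
  · split_ifs <;> omega
  · split_ifs
    · exact fun _ => hfr
    · exact fun h => absurd rfl h
  · intro h hh
    by_cases hx : h = x - 1
    · subst hx; simp; omega
    · simpa [hx] using hI.d_le h hh
  · intro h hh
    by_cases hx : h = x - 1
    · subst hx; simp
    · simpa [hx] using hI.cur_le h hh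
  · split_ifs with h
    · simpa using fun _ => h
    · exact fun h => absurd rfl h
  · intro e he hde
    by_cases hx : G.H e = x - 1
    · obtain ⟨k, hk, hke⟩ := hG.adj_surj e he
      rw [hx] at hk hke
      have := hI.lt_price (x - 1) (by omega) k (by omega) (by rwa [hke])
      rw [hke] at this
      simpa [hx] using this
    · simpa [hx] using hI.le_price e he hde
  · intro h hh k hk
    by_cases hx : h = x - 1
    · subst hx; simp at hk
    · simp only [Function.update_of_ne hx] at hk ⊢
      exact hI.lt_price h hh k hk
  · intro a han h0
    rw [hd a han h0]
    exact hI.price_own a han h0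
  · split_ifs <;> omega
  · intro h hh hfree hne
    by_cases hx : h = x - 1
    · subst hx
      simp only [Function.update_self]
      split_ifs at hne <;> omega
    · simpa [hx] using hI.rejected h hh hfree (by omega)
  · intro h hh hbh
    have hx : h ≠ x - 1 := by omega
    simpa [hx] using hI.fresh h hh hbh
  · have := sum_range_add_eq (f := fun h => d h * (G.deg h + 1) + cur h)
      (g := fun h => Function.update d (x - 1) (d (x - 1) + 1) h * (G.deg h + 1) +
        Function.update cur (x - 1) 0 h)
      (show x - 1 < G.n by omega) fun i hi => by simp [hi]
    simp only [Function.update_self, add_mul, one_mul] at this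
    unfold progress
    omega

end Net

end PopAlloc

/-! ### The auction on the machine. -/

namespace PopAlloc

open PopAlloc.Expr PopAlloc.Prog

namespace Net

variable {G : Net} {W : ℕ} {s s' : State} {dead : ℕ → ℕ}

/-- The auction is running. -/
structure AuctionState (G : Net) (dead : ℕ → ℕ) (s : State) : Prop where
  loaded : G.Loaded s
  dead_eq : s.arr 8 = dead
  auction : G.Auction dead (s.arr 9) (s.arr 11) (s.arr 12) (s.arr 13) (s.reg 8) (s.reg 7)

/-- Symbolic execution reduces the branches of the program to the moves `Auction.take`,
`Auction.skip` and `Auction.raise`. -/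
theorem AuctionState.bid (hG : G.Valid) (hW : G.Words W) (h : G.AuctionState dead s)
    (hx : s.reg 8 ≠ 0) :
    bidProg.Wp W s fun s' =>
      G.Auction dead (s'.arr 9) (s'.arr 11) (s'.arr 12) (s'.arr 13) (s'.reg 8) (s'.reg 7) ∧
      G.progress (s.arr 11) (s.arr 12) (s.arr 13) (s.reg 7) + 1 ≤
        G.progress (s'.arr 11) (s'.arr 12) (s'.arr 13) (s'.reg 7) := by
  have hI := h.auction
  have hxn := hI.x_le
  have hdL := hI.d_lt hx
  have hLn := hG.L_le
  have hnN : G.n ≤ G.N := n_le_N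
  have hcur := hI.cur_le (s.reg 8 - 1) (by omega)
  have hdeg := hG.deg_le (h := s.reg 8 - 1) (by omega)
  have w1 : 1 < W := hW.lt (by omega)
  have w0 : 0 < W := by omega
  have htake := hI.take hG hx (e := G.arcInto (s.reg 8 - 1) (s.arr 12 (s.reg 8 - 1)))
  simp only [bidProg, Prog.Wp, Fits, eval_const, eval_var, eval_get, eval_add, eval_sub,
    eval_mul, eval_lt, h.loaded.deg_eq, h.loaded.N_eq, h.loaded.adj_eq,
    h.loaded.T_eq, h.dead_eq, h.loaded.L_eq, w1, w0, State.setReg_reg, State.setReg_arr,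
    State.setArr_reg, State.setArr_arr, Nat.reduceEqDiff, if_true, if_false, true_and, and_true,
    Function.update_self, bit_mul_bit, bit_eq_zero, ne_eq, not_not, bit_lt w1]
  rw [← arcInto]
  refine ⟨fun hc => ⟨⟨hW.mul_lt (by omega) (by omega),
    hW.mul_add_lt (by omega) (by omega) (by omega)⟩, hW.lt (by omega), ?_, ?_⟩,
    fun hc => ⟨hW.lt (by omega), ?_, ?_⟩⟩
  · rintro ⟨ha, hp⟩
    have hp' := htake hc rfl (by omega) (by omega)
    have := hp'.1.price_own _ (hG.T_lt _ (hG.adj_lt _ (by omega) _ hc).1)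
    exact ⟨hW.lt (by omega), hp'⟩
  · intro hn
    exact ⟨hW.lt (by omega), hI.skip hx hc (by omega)⟩
  · intro hL
    have := hI.raise hG hx (not_lt.1 hc)
    rwa [if_pos hL] at this
  · intro hL
    have := hI.raise hG hx (not_lt.1 hc)
    rwa [if_neg hL] at this

theorem AuctionState.body (hG : G.Valid) (hW : G.Words W) (h : G.AuctionState dead s)
    (h0 : (add (lt (var 7) (var 0)) (var 8)).eval s ≠ 0) :
    auctionBody.Wp W s fun s' => auctionBody.Frame s s' → G.AuctionState dead s' ∧
      G.progress (s.arr 11) (s.arr 12) (s.arr 13) (s.reg 7) + 1 ≤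
        G.progress (s'.arr 11) (s'.arr 12) (s'.arr 13) (s'.reg 7) := by
  have hn := n_le_N (G := G)
  have hb := h.auction.b_le
  refine ⟨trivial, fun hx => ?_, fun hx => ?_⟩
  · refine (AuctionState.bid hG hW h hx).mono fun s' hs' hf => ?_
    exact ⟨⟨h.loaded.of_frame (by decide) hf, (hf.2 8 (by decide)).trans h.dead_eq, hs'.1⟩, hs'.2⟩
  · simp only [Expr.eval] at hx
    have hlt : s.reg 7 < G.n := by
      simpa [Expr.eval, hx, h.loaded.n_eq] using h0
    have hI := h.auction
    rw [hx] at hI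
    obtain ⟨h1, h2⟩ := hI.next hG hlt
    refine ⟨⟨trivial, hW.lt (by omega), ?_⟩, ⟨trivial, hW.lt (by omega), ?_⟩, fun hf => ⟨⟨?_, ?_, ?_⟩, ?_⟩⟩
    · exact hW.lt (by simp only [Expr.eval]; omega)
    · exact hW.lt (by simp [Expr.eval]; omega)
    · exact h.loaded.of_frame (by decide) hf
    · exact (hf.2 8 (by decide)).trans h.dead_eq
    · simpa [Expr.eval] using h1
    · simpa [Expr.eval] using h2

theorem runs_auction (hG : G.Valid) (hW : G.Words W) (hl : G.Loaded s) (hd : s.arr 8 = dead)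
    (hz : ∀ x ∈ [9, 11, 12, 13], ∀ i < G.n, s.arr x i = 0) :
    Runs W auctionProg s fun s' t => G.AuctionState dead s' ∧ s'.reg 7 = G.n ∧ s'.reg 8 = 0 ∧
      t ≤ 100 * (G.L * (G.N + G.n) + G.N + G.n * G.L + G.n + 1) := by
  simp only [List.mem_cons, List.not_mem_nil, or_false, forall_eq_or_imp, forall_eq] at hz
  obtain ⟨z9, z11, z12, z13⟩ := hz
  have w1 : 0 < W := hW.lt (by omega)
  refine Runs.assign_seq w1 (Runs.assign_seq w1 ?_)
  simp only [Expr.eval]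
  refine (Runs.loop_of_wp (G.AuctionState dead) (fun s =>
    G.L * (G.N + G.n) + G.N + G.n * G.L + G.n -
      G.progress (s.arr 11) (s.arr 12) (s.arr 13) (s.reg 7)) ?_ ?_ ?_).imp ?_
  · intro s h
    have := h.auction.b_le
    have := h.auction.x_le
    have := n_le_N (G := G)
    refine ⟨⟨trivial, trivial, hW.lt (by omega)⟩, trivial, hW.lt ?_⟩
    have := bit_le_one (s.reg 7 < G.n)
    simp only [eval_lt, eval_var, h.loaded.n_eq]
    omega
  · intro s h h0
    refine (AuctionState.body hG hW h h0).mono fun s' hs' hf => ?_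
    have := (hs' hf).1.auction.progress_le hG
    have := (hs' hf).2
    exact ⟨(hs' hf).1, by omega⟩
  · have hz : ∀ h < G.n, ∀ k < s.arr 12 h, False := fun h hh k hk => by simp [z12 h hh] at hk
    refine ⟨⟨?_, ?_, ?_, ?_, ?_, ?_, ?_, ?_, ?_, ?_⟩, hd, ?_⟩
    iterate 4 simp [hl.n_eq, hl.m_eq, hl.N_eq, hl.L_eq]
    iterate 6 simp [hl.T_eq, hl.H_eq, hl.P_eq, hl.adj_eq, hl.deg_eq, hl.E_eq]
    simp only [State.setReg_arr, State.setReg_reg, Nat.reduceEqDiff, if_true, if_false]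
    constructor
    · exact fun a ha h => absurd (z9 a ha) h
    · exact fun a ha a' ha' _ h => absurd (z9 a ha) h
    · omega
    · exact fun h => absurd rfl h
    · intro h hh; rw [z11 h hh]; omega
    · intro h hh; rw [z12 h hh]; omega
    · exact fun h => absurd rfl h
    · intro e he _; rw [z11 _ (hG.H_lt e he)]; omega
    · exact fun h hh k hk => (hz h hh k hk).elim
    · exact fun a ha h => absurd (z9 a ha) h
    · exact fun a ha _ => z13 a ha
    · omega
    · omega
    · intro h hh; omega
    · exact fun h hh _ => ⟨z11 h hh, fun a ha => by rw [z9 a ha]; omega⟩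
  · rintro s' t ⟨h, h0, ht⟩
    simp only [eval_add, eval_lt, eval_var, h.loaded.n_eq, Nat.add_eq_zero_iff, bit_eq_zero,
      not_lt] at h0
    have hc : auctionBody.maxCost + (Expr.cost (add (lt (var 7) (var 0)) (var 8)) + 1) ≤ 90 := by
      decide
    have hc' : Expr.cost (add (lt (var 7) (var 0)) (var 8)) = 5 := rfl
    have hc'' : Expr.cost (const 0) = 1 := rfl
    refine ⟨h, le_antisymm h.auction.b_le h0.1, h0.2, ?_⟩
    have := Nat.mul_le_mul hc (Nat.sub_le (G.L * (G.N + G.n) + G.N + G.n * G.L + G.n)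
      (G.progress (((s.setReg 7 0).setReg 8 0).arr 11) (((s.setReg 7 0).setReg 8 0).arr 12)
        (((s.setReg 7 0).setReg 8 0).arr 13) (((s.setReg 7 0).setReg 8 0).reg 7)))
    omega

end Net

end PopAlloc

/-! ### Matchings and augmenting paths -/

namespace PopAlloc

open PopAlloc.Expr PopAlloc.Prog

namespace Net

variable (G : Net)

/-- A matching of agents and houses that consists of arcs that are not marked. -/
structure Matching (dead own mate : ℕ → ℕ) : Prop where
  alive : ∀ a < G.n, own a ≠ 0 → ∃ e < G.N, dead e = 0 ∧ G.T e = a ∧ G.H e + 1 = own a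
  mate_le : ∀ b < G.n, mate b ≤ G.n
  mate_iff : ∀ a < G.n, ∀ b < G.n, mate b = a + 1 ↔ own a = b + 1

/-- The number of matched houses. -/
def size (mate : ℕ → ℕ) : ℕ := ((Finset.range G.n).filter fun b => mate b ≠ 0).card

variable {G} {dead own mate : ℕ → ℕ}

theorem size_le : G.size mate ≤ G.n :=
  (Finset.card_filter_le _ _).trans_eq (Finset.card_range _)

theorem Matching.own_le (h : G.Matching dead own mate) (hG : G.Valid) {a : ℕ} (ha : a < G.n) :
    own a ≤ G.n := by
  by_cases h0 : own a = 0
  · omega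
  · obtain ⟨e, he, -, -, h'⟩ := h.alive a ha h0
    have := hG.H_lt e he
    omega

/-- Both sides add up the prices over the pairs of the matching, once by houses and once by agents.
-/
theorem Matching.sum_price (h : G.Matching dead own mate) (hG : G.Valid) (price : ℕ → ℕ) :
    ∑ b ∈ Finset.range G.n, (if mate b = 0 then 0 else price (mate b - 1)) =
      ∑ a ∈ Finset.range G.n, if own a = 0 then 0 else price a := by
  have h1 : ∀ b ∈ Finset.range G.n, (if mate b = 0 then 0 else price (mate b - 1)) =
      ∑ a ∈ Finset.range G.n, if mate b = a + 1 then price a else 0 := by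
    intro b hb
    have hle := h.mate_le b (Finset.mem_range.1 hb)
    split_ifs with h0
    · exact (Finset.sum_eq_zero fun a _ => if_neg (by omega)).symm
    · rw [Finset.sum_eq_single (mate b - 1), if_pos (by omega)]
      · exact fun a _ ha => if_neg (by omega)
      · exact fun hn => absurd (Finset.mem_range.2 (by omega)) hn
  have h2 : ∀ a ∈ Finset.range G.n, (if own a = 0 then 0 else price a) =
      ∑ b ∈ Finset.range G.n, if own a = b + 1 then price a else 0 := by
    intro a ha
    have hle := h.own_le hG (Finset.mem_range.1 ha)
    split_ifs with h0
    · exact (Finset.sum_eq_zero fun a _ => if_neg (by omega)).symm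
    · rw [Finset.sum_eq_single (own a - 1), if_pos (by omega)]
      · exact fun a _ ha => if_neg (by omega)
      · exact fun hn => absurd (Finset.mem_range.2 (by omega)) hn
  rw [Finset.sum_congr rfl h1, Finset.sum_congr rfl h2, Finset.sum_comm]
  refine Finset.sum_congr rfl fun a ha => Finset.sum_congr rfl fun b hb => ?_
  simp only [h.mate_iff a (Finset.mem_range.1 ha) b (Finset.mem_range.1 hb)]

/-- The matching that the auction finds is almost maximum. -/
theorem Auction.size_le_size {d cur price : ℕ → ℕ}
    (hA : G.Auction dead own d cur price 0 G.n) (hG : G.Valid) (hM : G.Matching dead own mate)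
    {own' mate' : ℕ → ℕ} (hM' : G.Matching dead own' mate') :
    G.size mate' ≤ G.size mate + G.L := by
  -- A house that the auction leaves unmatched has bid up to `L`, so its partner in the other
  -- matching costs at least `L`. A house that it matches has a partner who costs at most its bid
  -- plus one and at most `L`, while a partner in the other matching costs at least the bid.
  have key : ∀ b ∈ Finset.range G.n,
      (if mate b = 0 then 0 else price (mate b - 1)) + G.L * (if mate' b ≠ 0 then 1 else 0) ≤
        (if mate' b = 0 then 0 else price (mate' b - 1)) +
          (G.L + 1) * (if mate b ≠ 0 then 1 else 0) := by
    intro b hb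
    have hb := Finset.mem_range.1 hb
    have hle := hM.mate_le b hb
    have hle' := hM'.mate_le b hb
    have hp' : mate' b ≠ 0 → d b ≤ price (mate' b - 1) := by
      intro h'
      have hown' := (hM'.mate_iff (mate' b - 1) (by omega) b hb).1 (by omega)
      obtain ⟨e, he, hde, hT, hH⟩ := hM'.alive (mate' b - 1) (by omega) (by omega)
      have := hA.le_price e he hde
      rwa [hT, show G.H e = b by omega] at this
    have hp : mate b ≠ 0 → price (mate b - 1) ≤ d b + 1 ∧ d b < G.L := by
      intro h
      have hown := (hM.mate_iff (mate b - 1) (by omega) b hb).1 (by omega)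
      have := hA.price_own (mate b - 1) (by omega) (by omega)
      rwa [hown, Nat.add_sub_cancel] at this
    have hd : mate b = 0 → d b = G.L := by
      intro h
      refine hA.rejected b hb (fun a ha hab => ?_) (by omega)
      have := (hM.mate_iff a ha b hb).2 hab
      omega
    by_cases h : mate b = 0 <;> by_cases h' : mate' b = 0
    · simp [h, h']
    · have := hd h
      have := hp' h'
      simp [h, h']
      omega
    · have := hp h
      simp [h, h']
      omega
    · have := hp h
      have := hp' h'
      simp [h, h']
      omega
  have hsum := Finset.sum_le_sum key
  rw [Finset.sum_add_distrib, Finset.sum_add_distrib, ← Finset.mul_sum, ← Finset.mul_sum,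
    hM.sum_price hG, hM'.sum_price hG, Finset.sum_boole, Finset.sum_boole] at hsum
  -- Agents whom the auction leaves unmatched have price zero, so its matching collects the total of
  -- all prices.
  have h1 : ∑ a ∈ Finset.range G.n, (if own' a = 0 then 0 else price a) ≤
      ∑ a ∈ Finset.range G.n, if own a = 0 then 0 else price a := by
    refine Finset.sum_le_sum fun a ha => ?_
    have := hA.price_free a (Finset.mem_range.1 ha)
    split_ifs <;> simp_all
  have h2 : G.L * G.size mate' ≤ (G.L + 1) * G.size mate := by
    simp only [Nat.cast_id] at hsum
    unfold size
    omega
  have h3 := size_le (G := G) (mate := mate)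
  have h4 := size_le (G := G) (mate := mate')
  have h5 := hG.le_sq
  -- From `L * |M'| ≤ (L + 1) * |M|` and `|M| ≤ n ≤ L * L` follows `|M'| ≤ |M| + L`.
  by_contra hlt
  have h6 : G.L * (G.size mate + G.L + 1) ≤ G.L * G.size mate' := Nat.mul_le_mul_left _ (by omega)
  have h7 : 0 < G.L := by
    by_contra h
    have : G.L = 0 := by omega
    rw [this] at h5
    omega
  nlinarith

variable (G)

/-- The state of the search for an augmenting path: the houses that can be reached from the house
`r` by an alternating path are put into a queue. -/
structure Search (dead own mate par cur queue : ℕ → ℕ) (r qh qt found : ℕ) : Prop where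
  root_lt : r < G.n
  root_free : mate r = 0
  queue_zero : queue 0 = r
  qt_pos : 0 < qt
  qh_le : qh ≤ qt
  qt_le : qt ≤ 1 + ((Finset.range G.n).filter fun a => par a ≠ 0).card
  queue_lt : ∀ i < qt, queue i < G.n
  queue_inj : ∀ i < qt, ∀ j < qt, queue i = queue j → i = j
  chain : ∀ i < qt, 0 < i → ∃ a < G.n, mate (queue i) = a + 1 ∧ ∃ j < i, par a = queue j + 1
  alive : ∀ a < G.n, par a ≠ 0 → ∃ e < G.N, dead e = 0 ∧ G.T e = a ∧ G.H e + 1 = par a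
  par_mem : ∀ a < G.n, par a ≠ 0 → ∃ j < qt, par a = queue j + 1
  own_mem : ∀ a < G.n, par a ≠ 0 → a + 1 ≠ found → ∃ j < qt, own a = queue j + 1
  found_le : found ≤ G.n
  found_spec : found ≠ 0 → par (found - 1) ≠ 0 ∧ own (found - 1) = 0
  cur_le : ∀ h < G.n, cur h ≤ G.deg h
  scanned : ∀ h < G.n, ∀ k < cur h, dead (G.arcInto h k) = 0 → par (G.T (G.arcInto h k)) ≠ 0
  finished : ∀ i < qh, cur (queue i) = G.deg (queue i)

/-- The progress of the search. -/
def searched (cur : ℕ → ℕ) (qh : ℕ) : ℕ := ∑ h ∈ Finset.range G.n, cur h + qh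

variable {G} {par cur queue : ℕ → ℕ} {r qh qt found : ℕ}

theorem Search.qt_le' (h : G.Search dead own mate par cur queue r qh qt found) :
    qt ≤ G.n + 1 := by
  have h1 := h.qt_le
  have h2 := (Finset.card_filter_le (Finset.range G.n) fun a => par a ≠ 0).trans_eq
    (Finset.card_range _)
  omega

theorem Search.searched_le (h : G.Search dead own mate par cur queue r qh qt found)
    (hG : G.Valid) : G.searched cur qh ≤ G.N + G.n + 1 := by
  have h1 : ∑ h ∈ Finset.range G.n, cur h ≤ ∑ h ∈ Finset.range G.n, G.deg h :=
    Finset.sum_le_sum fun i hi => h.cur_le i (Finset.mem_range.1 hi)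
  have h2 := h.qt_le'
  have h3 := h.qh_le
  rw [hG.sum_deg] at h1
  unfold searched
  omega

theorem searched_update {h : ℕ} (hh : h < G.n) :
    G.searched cur qh + 1 ≤ G.searched (Function.update cur h (cur h + 1)) qh := by
  have := sum_range_add_eq (f := cur) (g := Function.update cur h (cur h + 1)) hh
    fun i hi => Function.update_of_ne hi _ _
  simp only [Function.update_self] at this
  unfold searched
  omega

theorem Search.next (h : G.Search dead own mate par cur queue r qh qt found) (hq : qh < qt)
    (hc : G.deg (queue qh) ≤ cur (queue qh)) :
    G.Search dead own mate par cur queue r (qh + 1) qt found := by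
  refine { h with qh_le := hq, finished := fun i hi => ?_ }
  rcases Nat.lt_succ_iff_lt_or_eq.1 hi with hi | rfl
  · exact h.finished i hi
  · exact le_antisymm (h.cur_le _ (h.queue_lt _ hq)) hc

theorem Search.skip (h : G.Search dead own mate par cur queue r qh qt found) (hq : qh < qt)
    (hc : cur (queue qh) < G.deg (queue qh))
    (hs : dead (G.arcInto (queue qh) (cur (queue qh))) = 0 →
      par (G.T (G.arcInto (queue qh) (cur (queue qh)))) ≠ 0) :
    G.Search dead own mate par (Function.update cur (queue qh) (cur (queue qh) + 1)) queue r qh qt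
      found := by
  refine { h with cur_le := fun b hb => ?_, scanned := fun b hb k hk => ?_, finished := fun i hi => ?_ }
  · by_cases hbq : b = queue qh
    · subst hbq; simp; omega
    · simpa [hbq] using h.cur_le b hb
  · by_cases hbq : b = queue qh
    · subst hbq
      simp only [Function.update_self] at hk
      rcases Nat.lt_succ_iff_lt_or_eq.1 hk with hk | rfl
      · exact h.scanned _ hb k hk
      · exact hs
    · simp only [Function.update_of_ne hbq] at hk
      exact h.scanned b hb k hk
  · have hne : queue i ≠ queue qh := fun he => by
      have := h.queue_inj i (by omega) qh hq he
      omega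
    simpa [hne] using h.finished i hi

/-- Visiting a new agent; she is recorded in `found` if she is unmatched. -/
theorem Search.visit (h : G.Search dead own mate par cur queue r qh qt 0) (hG : G.Valid)
    (hM : G.Matching dead own mate) (hq : qh < qt) (hc : cur (queue qh) < G.deg (queue qh)) {e : ℕ}
    (he : e = G.arcInto (queue qh) (cur (queue qh))) (ha : dead e = 0) (hp : par (G.T e) = 0) :
    (own (G.T e) = 0 → G.Search dead own mate (Function.update par (G.T e) (queue qh + 1))
      (Function.update cur (queue qh) (cur (queue qh) + 1)) queue r qh qt (G.T e + 1)) ∧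
    (own (G.T e) ≠ 0 → G.Search dead own mate (Function.update par (G.T e) (queue qh + 1))
      (Function.update cur (queue qh) (cur (queue qh) + 1))
      (Function.update queue qt (own (G.T e) - 1)) r qh (qt + 1) 0) := by
  have hqn := h.queue_lt qh hq
  obtain ⟨heN, heH⟩ := hG.adj_lt _ hqn _ hc
  rw [← he] at heN heH
  have hTn := hG.T_lt e heN
  have hpne : ∀ a, par a ≠ 0 → a ≠ G.T e := fun a h' h'' => h' (h'' ▸ hp)
  have hcard : ((Finset.range G.n).filter fun a =>
      Function.update par (G.T e) (queue qh + 1) a ≠ 0).card =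
      ((Finset.range G.n).filter fun a => par a ≠ 0).card + 1 := by
    have : (Finset.range G.n).filter (fun a => Function.update par (G.T e) (queue qh + 1) a ≠ 0) =
        insert (G.T e) ((Finset.range G.n).filter fun a => par a ≠ 0) := by
      ext a
      by_cases haT : a = G.T e
      · subst haT; simp [hTn]
      · simp [haT]
    rw [this, Finset.card_insert_of_notMem (by simp [hp])]
  have hchain : ∀ i < qt, 0 < i → ∃ a < G.n, mate (queue i) = a + 1 ∧
      ∃ j < i, Function.update par (G.T e) (queue qh + 1) a = queue j + 1 := by
    intro i hi h0
    obtain ⟨a, han, hma, j, hj, hpa⟩ := h.chain i hi h0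
    exact ⟨a, han, hma, j, hj, by rwa [Function.update_of_ne (hpne a (by omega))]⟩
  have halive : ∀ a < G.n, Function.update par (G.T e) (queue qh + 1) a ≠ 0 → ∃ f < G.N,
      dead f = 0 ∧ G.T f = a ∧ G.H f + 1 = Function.update par (G.T e) (queue qh + 1) a := by
    intro a han hpa
    by_cases haT : a = G.T e
    · subst haT
      exact ⟨e, heN, ha, rfl, by simp [heH]⟩
    · simp only [Function.update_of_ne haT] at hpa ⊢
      exact h.alive a han hpa
  have hpmem : ∀ a < G.n, Function.update par (G.T e) (queue qh + 1) a ≠ 0 →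
      ∃ j < qt, Function.update par (G.T e) (queue qh + 1) a = queue j + 1 := by
    intro a han hpa
    by_cases haT : a = G.T e
    · subst haT
      exact ⟨qh, hq, by simp⟩
    · simp only [Function.update_of_ne haT] at hpa ⊢
      exact h.par_mem a han hpa
  have hcle : ∀ b < G.n, Function.update cur (queue qh) (cur (queue qh) + 1) b ≤ G.deg b := by
    intro b hb
    by_cases hbq : b = queue qh
    · subst hbq; simp; omega
    · simpa [hbq] using h.cur_le b hb
  have hscan : ∀ b < G.n, ∀ k < Function.update cur (queue qh) (cur (queue qh) + 1) b,
      dead (G.arcInto b k) = 0 →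
        Function.update par (G.T e) (queue qh + 1) (G.T (G.arcInto b k)) ≠ 0 := by
    intro b hb k hk hdk
    by_cases haT : G.T (G.arcInto b k) = G.T e
    · simp [haT]
    rw [Function.update_of_ne haT]
    by_cases hbq : b = queue qh
    · subst hbq
      simp only [Function.update_self] at hk
      rcases Nat.lt_succ_iff_lt_or_eq.1 hk with hk | rfl
      · exact h.scanned _ hb k hk hdk
      · exact absurd (by rw [he]) haT
    · simp only [Function.update_of_ne hbq] at hk
      exact h.scanned b hb k hk hdk
  have hdone : ∀ i < qh, Function.update cur (queue qh) (cur (queue qh) + 1) (queue i) =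
      G.deg (queue i) := by
    intro i hi
    have hne : queue i ≠ queue qh := fun he => by
      have := h.queue_inj i (by omega) qh hq he
      omega
    simpa [hne] using h.finished i hi
  constructor
  · intro hfree
    refine { h with
      chain := hchain, alive := halive, par_mem := hpmem, cur_le := hcle, scanned := hscan,
      finished := hdone, qt_le := ?_, own_mem := ?_, found_le := ?_, found_spec := ?_ }
    · have := h.qt_le
      omega
    · intro a han hpa hne
      have haT : a ≠ G.T e := by omega
      rw [Function.update_of_ne haT] at hpa
      exact h.own_mem a han hpa (by omega)
    · omega
    · intro _
      simp [hfree]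
  · intro hown
    have hle := hM.own_le hG hTn
    have hqne : ∀ i < qt, Function.update queue qt (own (G.T e) - 1) i = queue i :=
      fun i hi => Function.update_of_ne (by omega) _ _
    have hm : mate (own (G.T e) - 1) = G.T e + 1 :=
      (hM.mate_iff _ hTn _ (by omega)).2 (by omega)
    -- The house of the new agent is not yet in the queue: the root is unmatched, and every other
    -- queued house belongs to an agent who was visited before.
    have hnew : ∀ i < qt, queue i ≠ own (G.T e) - 1 := by
      intro i hi hqi
      rcases Nat.eq_zero_or_pos i with rfl | h0
      · rw [h.queue_zero] at hqi
        have := h.root_free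
        rw [hqi] at this
        omega
      · obtain ⟨a, han, hma, j, hj, hpa⟩ := h.chain i hi h0
        rw [hqi, hm] at hma
        exact hpne a (by omega) (by omega)
    refine { h with
      alive := halive, cur_le := hcle, scanned := hscan, found_spec := fun h => absurd rfl h, queue_zero := ?_, qt_pos := ?_,
      qh_le := ?_, qt_le := ?_, queue_lt := ?_, queue_inj := ?_, chain := ?_, par_mem := ?_,
      own_mem := ?_, finished := ?_ }
    · rw [hqne 0 h.qt_pos, h.queue_zero]
    · omega
    · omega
    · have := h.qt_le
      omega
    · intro i hi
      rcases Nat.lt_succ_iff_lt_or_eq.1 hi with hi | rfl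
      · rw [hqne i hi]; exact h.queue_lt i hi
      · simp; omega
    · intro i hi j hj hij
      rcases Nat.lt_succ_iff_lt_or_eq.1 hi with hi | rfl <;>
        rcases Nat.lt_succ_iff_lt_or_eq.1 hj with hj | rfl
      · rw [hqne i hi, hqne j hj] at hij
        exact h.queue_inj i hi j hj hij
      · rw [hqne i hi, Function.update_self] at hij
        exact absurd hij (hnew i hi)
      · rw [hqne j hj, Function.update_self] at hij
        exact absurd hij.symm (hnew j hj)
      · rfl
    · intro i hi h0
      rcases Nat.lt_succ_iff_lt_or_eq.1 hi with hi | rfl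
      · obtain ⟨a, han, hma, j, hj, hpa⟩ := hchain i hi h0
        exact ⟨a, han, by rwa [hqne i hi], j, hj, by rwa [hqne j (by omega)]⟩
      · exact ⟨G.T e, hTn, by simpa using hm, qh, hq, by simp [hqne qh hq]⟩
    · intro a han hpa
      obtain ⟨j, hj, h'⟩ := hpmem a han hpa
      exact ⟨j, by omega, by rwa [hqne j hj]⟩
    · intro a han hpa _
      by_cases haT : a = G.T e
      · subst haT
        exact ⟨qt, by omega, by simp; omega⟩
      · rw [Function.update_of_ne haT] at hpa
        obtain ⟨j, hj, h'⟩ := h.own_mem a han hpa (by omega)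
        exact ⟨j, by omega, by rwa [hqne j hj]⟩
    · intro i hi
      rw [hqne i (by omega)]
      exact hdone i hi

variable (G)

/-- There is no augmenting path from the house `b`. -/
def Blocked (dead own : ℕ → ℕ) (b : ℕ) : Prop :=
  ∃ R : Set ℕ, b ∈ R ∧ (∀ e < G.N, dead e = 0 → G.H e ∈ R → ∃ h ∈ R, own (G.T e) = h + 1) ∧
    ∀ a < G.n, own a ≠ b + 1

variable {G}

/-- The closed set consists of the queued houses. All live arcs into them have been scanned, so
their tails were visited; as no unmatched agent was found, each of these agents owns a queued house.
-/
theorem Search.blocked (h : G.Search dead own mate par cur queue r qh qt 0) (hG : G.Valid)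
    (hM : G.Matching dead own mate) (hq : qt ≤ qh) : G.Blocked dead own r := by
  refine ⟨{b | ∃ i < qt, queue i = b}, ⟨0, h.qt_pos, h.queue_zero⟩, ?_, ?_⟩
  · rintro e he hde ⟨i, hi, hqi⟩
    obtain ⟨k, hk, hke⟩ := hG.adj_surj e he
    have hdone := h.finished i (by omega)
    rw [hqi] at hdone
    have hp := h.scanned (G.H e) (hG.H_lt e he) k (by omega) (by rwa [hke])
    rw [hke] at hp
    obtain ⟨j, hj, hj'⟩ := h.own_mem _ (hG.T_lt e he) hp (by omega)
    exact ⟨queue j, ⟨j, hj, rfl⟩, hj'⟩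
  · intro a ha hab
    have := (hM.mate_iff a ha r h.root_lt).2 hab
    have := h.root_free
    omega

/-- The rest of the augmenting path starts with the house number `p` in the queue. -/
structure PathRest (par queue : ℕ → ℕ) (mate : ℕ → ℕ) (qt f p : ℕ) : Prop where
  p_lt : p < qt
  par_eq : par (f - 1) = queue p + 1
  zero : mate (queue 0) = 0
  chain : ∀ i ≤ p, 0 < i → ∃ a < G.n, mate (queue i) = a + 1 ∧ ∃ j < i, par a = queue j + 1

variable (G)

/-- The state of the augmentation: the agent `f` (plus one) still has to be matched with the house
number `p` in the queue. -/
structure Augmenting (dead mate₀ par queue : ℕ → ℕ) (r : ℕ) (own mate : ℕ → ℕ) (f : ℕ) : Prop where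
  alive : ∀ a < G.n, a + 1 ≠ f → own a ≠ 0 →
    ∃ e < G.N, dead e = 0 ∧ G.T e = a ∧ G.H e + 1 = own a
  mate_le : ∀ b < G.n, mate b ≤ G.n
  mate_iff : ∀ a < G.n, ∀ b < G.n, mate b = a + 1 ↔ a + 1 ≠ f ∧ own a = b + 1
  mate_mono : ∀ b < G.n, mate₀ b ≠ 0 → mate b ≠ 0
  f_le : f ≤ G.n
  root_matched : f = 0 → mate r ≠ 0

variable {G}

/-- The agent who loses the house number `p` was reached from a house earlier in the queue, so the
position decreases. The entry of `own` for the agent still to be served is outdated, and the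
invariant excludes her. -/
theorem Augmenting.step {own₀ mate₀ : ℕ → ℕ} {f p : ℕ}
    (h : G.Augmenting dead mate₀ par queue r own mate f) (hf : f ≠ 0)
    (hs : G.Search dead own₀ mate₀ par cur queue r qh qt found)
    (hp : G.PathRest par queue mate qt f p) :
    G.Augmenting dead mate₀ par queue r (Function.update own (f - 1) (queue p + 1))
        (Function.update mate (queue p) f) (mate (queue p)) ∧
      (mate (queue p) ≠ 0 → ∃ p' < p,
        G.PathRest par queue (Function.update mate (queue p) f) qt (mate (queue p)) p') := by
  have hfn := h.f_le
  have hqn := hs.queue_lt p hp.p_lt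
  have hmle := h.mate_le _ hqn
  constructor
  · constructor
    · intro a han hne hown
      by_cases haf : a = f - 1
      · subst haf
        simp only [Function.update_self]
        rw [← hp.par_eq]
        exact hs.alive _ han (by rw [hp.par_eq]; omega)
      · simp only [Function.update_of_ne haf] at hown ⊢
        exact h.alive a han (by omega) hown
    · intro b hb
      by_cases hbq : b = queue p
      · subst hbq; simpa using hfn
      · simpa [hbq] using h.mate_le b hb
    · intro a han b hb
      have h1 := h.mate_iff a han b hb
      have h2 := h.mate_iff a han _ hqn
      by_cases haf : a = f - 1
      · have haf' : a + 1 = f := by omega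
        by_cases hbq : b = queue p
        · subst hbq
          have h3 : mate (queue p) ≠ a + 1 := fun h3 => (h2.1 h3).1 haf'
          rw [haf, Function.update_self, Function.update_self, ← haf]
          exact ⟨fun _ => ⟨h3.symm, rfl⟩, fun _ => haf'.symm⟩
        · rw [Function.update_of_ne hbq, haf, Function.update_self, ← haf]
          have h3 : mate b ≠ a + 1 := fun h3 => (h1.1 h3).1 haf'
          omega
      · rw [Function.update_of_ne haf]
        by_cases hbq : b = queue p
        · subst hbq
          simp only [Function.update_self]
          omega
        · rw [Function.update_of_ne hbq]
          constructor
          · intro h3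
            refine ⟨fun h4 => ?_, (h1.1 h3).2⟩
            have := h2.1 h4.symm
            have := (h1.1 h3).2
            omega
          · intro h3
            exact h1.2 ⟨by omega, h3.2⟩
    · intro b hb hb0
      by_cases hbq : b = queue p
      · subst hbq; simpa using hf
      · simpa [hbq] using h.mate_mono b hb hb0
    · exact hmle
    · intro h0
      have hp0 : p = 0 := by
        by_contra hne
        obtain ⟨a, -, ha, -⟩ := hp.chain p le_rfl (by omega)
        omega
      subst hp0
      rw [← hs.queue_zero]
      simpa using hf
  · intro h0
    have hp0 : 0 < p := by
      by_contra hne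
      have : p = 0 := by omega
      subst this
      exact h0 hp.zero
    obtain ⟨a, -, ha, j, hj, hpj⟩ := hp.chain p le_rfl hp0
    have hne : ∀ i ≤ j, queue i ≠ queue p := fun i hi he => by
      have := hs.queue_inj i (by have := hp.p_lt; omega) p hp.p_lt he
      omega
    refine ⟨j, hj, hj.trans hp.p_lt, by simpa [ha] using hpj, ?_, ?_⟩
    · rw [Function.update_of_ne (hne 0 (Nat.zero_le _))]
      exact hp.zero
    · intro i hi hi0
      rw [Function.update_of_ne (hne i hi)]
      exact hp.chain i (by omega) hi0

theorem Search.augmenting (h : G.Search dead own mate par cur queue r qh qt found)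
    (hM : G.Matching dead own mate) (hf : found ≠ 0) :
    G.Augmenting dead mate par queue r own mate found ∧
      ∃ p, G.PathRest par queue mate qt found p := by
  have hfn := h.found_le
  obtain ⟨hpf, hof⟩ := h.found_spec hf
  refine ⟨⟨fun a ha _ => hM.alive a ha, hM.mate_le, fun a ha b hb => ?_, fun _ _ => id, hfn,
    fun h => absurd h hf⟩, ?_⟩
  · rw [hM.mate_iff a ha b hb]
    refine ⟨fun hab => ⟨fun haf => ?_, hab⟩, And.right⟩
    subst haf
    simp only [Nat.add_sub_cancel] at hof
    omega
  · obtain ⟨p, hp, hpq⟩ := h.par_mem (found - 1) (by omega) hpf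
    exact ⟨p, hp, hpq, by rw [h.queue_zero]; exact h.root_free,
      fun i hi => h.chain i (by omega)⟩

theorem Augmenting.matching {mate₀ : ℕ → ℕ}
    (h : G.Augmenting dead mate₀ par queue r own mate 0) : G.Matching dead own mate :=
  ⟨fun a ha => h.alive a ha (by omega), h.mate_le, fun a ha b hb => by
    rw [h.mate_iff a ha b hb]; simp⟩

theorem Augmenting.size_lt {mate₀ : ℕ → ℕ} (h : G.Augmenting dead mate₀ par queue r own mate 0)
    (hr : r < G.n) (h0 : mate₀ r = 0) : G.size mate₀ < G.size mate := by
  refine Finset.card_lt_card ⟨fun b hb => ?_, fun hsub => ?_⟩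
  · simp only [Finset.mem_filter, Finset.mem_range] at hb ⊢
    exact ⟨hb.1, h.mate_mono b hb.1 hb.2⟩
  · have : r ∈ (Finset.range G.n).filter fun b => mate₀ b ≠ 0 :=
      hsub (by simp [hr, h.root_matched rfl])
    simp [h0] at this

end Net

end PopAlloc

/-! ### Matching, search and augmentation on the machine. -/

namespace PopAlloc

open PopAlloc.Expr PopAlloc.Prog

namespace Net

variable {G : Net} {W : ℕ} {s s' : State} {dead own mate : ℕ → ℕ}

theorem Loaded.setReg (h : G.Loaded s) {x : ℕ} (hx : x ∉ [0, 1, 3, 4]) (v : ℕ) :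
    G.Loaded (s.setReg x v) := by
  simp only [List.mem_cons, List.not_mem_nil, or_false, not_or] at hx
  obtain ⟨h0, h1, h3, h4⟩ := hx
  constructor
  · simpa [Ne.symm h0] using h.n_eq
  · simpa [Ne.symm h1] using h.m_eq
  · simpa [Ne.symm h3] using h.N_eq
  · simpa [Ne.symm h4] using h.L_eq
  exacts [h.T_eq, h.H_eq, h.P_eq, h.adj_eq, h.deg_eq, h.E_eq]

theorem Loaded.setArr (h : G.Loaded s) {x : ℕ} (hx : x ∉ [0, 1, 2, 4, 5, 6]) (i v : ℕ) :
    G.Loaded (s.setArr x i v) := by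
  simp only [List.mem_cons, List.not_mem_nil, or_false, not_or] at hx
  obtain ⟨h0, h1, h2, h4, h5, h6⟩ := hx
  refine ⟨h.n_eq, h.m_eq, h.N_eq, h.L_eq, ?_, ?_, ?_, ?_, ?_, ?_⟩
  · simpa [Ne.symm h0] using h.T_eq
  · simpa [Ne.symm h1] using h.H_eq
  · simpa [Ne.symm h2] using h.P_eq
  · simpa [Ne.symm h4] using h.adj_eq
  · simpa [Ne.symm h5] using h.deg_eq
  · simpa [Ne.symm h6] using h.E_eq

theorem runs_mates (hW : G.Words W) {d cur price : ℕ → ℕ} (hG : G.Valid)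
    (hA : G.Auction dead own d cur price 0 G.n) (hl : G.Loaded s) (ho : s.arr 9 = own)
    (hz : ∀ i < G.n, s.arr 10 i = 0) :
    Runs W (upTo 6 0 mateBody) s fun s' t =>
      G.Matching dead (s'.arr 9) (s'.arr 10) ∧ t ≤ 50 * (G.n + 1) := by
  have hnN : G.n ≤ G.N := n_le_N
  refine (Runs.upTo (by decide) (by decide) (by decide)
    (fun k s => G.Loaded s ∧ s.arr 9 = own ∧
      ∀ b < G.n, ∀ a, s.arr 10 b = a + 1 ↔ a < k ∧ own a = b + 1) G.n mateBody.maxCost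
    (fun k s v h => ⟨h.1.setReg (by decide) v, h.2⟩) (hW.lt (by omega)) (hW.lt (by omega)) ?_
    ⟨hl, ho, fun b hb a => by rw [hz b hb]; omega⟩ hl.n_eq).imp ?_
  · rintro k s hk ⟨hl, ho, hm⟩ hi -
    refine Runs.of_wp (Q := fun s => G.Loaded s ∧ s.arr 9 = own ∧
      ∀ b < G.n, ∀ a, s.arr 10 b = a + 1 ↔ a < k + 1 ∧ own a = b + 1) ?_
    have hle := hA.own_le hG hk
    simp only [mateBody, Prog.Wp, Fits, Expr.eval, hi, ho, State.setArr_arr, Nat.reduceEqDiff,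
      if_true, if_false, true_and]
    refine ⟨fun h0 => ⟨hW.lt (by omega), ⟨hW.lt (by omega), hW.lt (by omega)⟩, fun _ =>
      ⟨hl.setArr (by decide) _ _, fun b hb a => ?_⟩⟩, fun h0 _ =>
      ⟨hl, fun b hb a => ?_⟩⟩
    · by_cases hbk : b = own k - 1
      · subst hbk
        rw [Function.update_self]
        constructor
        · intro h
          have : k = a := by omega
          subst this
          omega
        · rintro ⟨h1, h2⟩
          rcases Nat.lt_succ_iff_lt_or_eq.1 h1 with h1 | rfl
          · exact absurd (hA.inj a (by omega) k hk (by omega) (by omega)) (by omega)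
          · rfl
      · rw [Function.update_of_ne hbk, hm b hb]
        constructor
        · exact fun h => ⟨by omega, h.2⟩
        · rintro ⟨h1, h2⟩
          refine ⟨?_, h2⟩
          rcases Nat.lt_succ_iff_lt_or_eq.1 h1 with h1 | rfl
          · exact h1
          · omega
    · rw [hm b hb]
      constructor
      · exact fun h => ⟨by omega, h.2⟩
      · rintro ⟨h1, h2⟩
        refine ⟨?_, h2⟩
        rcases Nat.lt_succ_iff_lt_or_eq.1 h1 with h1 | rfl
        · exact h1
        · omega
  · rintro s' t ⟨⟨hl, ho, hm⟩, ht⟩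
    have hc : mateBody.maxCost + 8 ≤ 30 := by decide
    have := Nat.mul_le_mul_right G.n hc
    refine ⟨⟨?_, ?_, ?_⟩, by omega⟩
    · rw [ho]; exact hA.alive
    · intro b hb
      by_contra h
      have := (hm b hb (s'.arr 10 b - 1)).1 (by omega)
      omega
    · intro a ha b hb
      rw [ho, hm b hb a]
      exact ⟨And.right, fun h => ⟨ha, h⟩⟩

/-- The search for an augmenting path from `r` is running. -/
structure SearchState (G : Net) (dead own mate : ℕ → ℕ) (r : ℕ) (s : State) : Prop where
  loaded : G.Loaded s
  dead_eq : s.arr 8 = dead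
  own_eq : s.arr 9 = own
  search : G.Search dead own mate (s.arr 14) (s.arr 12) (s.arr 15) r (s.reg 12) (s.reg 13)
    (s.reg 14)

theorem SearchState.body {r : ℕ} (hG : G.Valid) (hW : G.Words W) (hM : G.Matching dead own mate)
    (h : G.SearchState dead own mate r s)
    (h0 : (mul (lt (var 12) (var 13)) (lt (var 14) (const 1))).eval s ≠ 0) :
    searchBody.Wp W s fun s' => searchBody.Frame s s' → G.SearchState dead own mate r s' ∧
      G.searched (s.arr 12) (s.reg 12) + 1 ≤ G.searched (s'.arr 12) (s'.reg 12) := by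
  simp only [eval_mul, eval_lt, eval_var, eval_const, ne_eq, bit_mul_bit, bit_eq_zero, not_not] at h0
  obtain ⟨hq, hf0⟩ := h0
  have hS := h.search
  rw [Nat.lt_one_iff.1 hf0] at hS
  have hqn := hS.queue_lt _ hq
  have hqt := hS.qt_le'
  have hnN : G.n ≤ G.N := n_le_N
  have hcur := hS.cur_le _ hqn
  have hdeg := hG.deg_le hqn
  have w1 : 1 < W := hW.lt (by omega)
  have w0 : 0 < W := by omega
  suffices searchBody.Wp W s fun s' =>
      G.Search dead own mate (s'.arr 14) (s'.arr 12) (s'.arr 15) r (s'.reg 12) (s'.reg 13)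
        (s'.reg 14) ∧
      G.searched (s.arr 12) (s.reg 12) + 1 ≤ G.searched (s'.arr 12) (s'.reg 12) from
    this.mono fun s' hs' hf => ⟨⟨h.loaded.of_frame (by decide) hf,
      (hf.2 8 (by decide)).trans h.dead_eq, (hf.2 9 (by decide)).trans h.own_eq, hs'.1⟩, hs'.2⟩
  have hvisit := hS.visit hG hM hq (e := G.arcInto (s.arr 15 (s.reg 12))
    (s.arr 12 (s.arr 15 (s.reg 12))))
  have hup := searched_update (G := G) (cur := s.arr 12) (qh := s.reg 12) hqn
  simp only [searchBody, incr, Prog.Wp, Fits, eval_const, eval_var, eval_get, eval_add, eval_sub,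
    eval_mul, eval_lt, h.loaded.deg_eq, h.loaded.N_eq,
    h.loaded.adj_eq, h.loaded.T_eq, h.dead_eq, h.own_eq, w1, State.setReg_reg,
    State.setReg_arr, State.setArr_reg, State.setArr_arr, Nat.reduceEqDiff, if_true, if_false,
    true_and, and_true, bit_mul_bit, bit_eq_zero, ne_eq, not_not, bit_lt w1]
  rw [← arcInto]
  refine ⟨fun hc => ?_, fun hc => ⟨hW.lt (by omega), ?_⟩⟩
  · have hTn := hG.T_lt _ (hG.adj_lt _ hqn _ hc).1
    refine ⟨⟨hW.mul_lt (by omega) (by omega), hW.mul_add_lt (by omega) (by omega) (by omega)⟩,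
      hW.lt (by omega), ?_, ?_⟩
    · rintro ⟨ha, hp⟩
      have hv := hvisit hc rfl (by omega) (by omega)
      exact ⟨hW.lt (by omega), fun ho => ⟨hW.lt (by omega), by
        rw [Nat.lt_one_iff.1 hf0]; exact hv.2 ho, hup⟩,
        fun ho => ⟨hW.lt (by omega), hv.1 ho, hup⟩⟩
    · intro hn
      rw [Nat.lt_one_iff.1 hf0]
      exact ⟨hS.skip hq hc (by omega), hup⟩
  · rw [Nat.lt_one_iff.1 hf0]
    exact ⟨hS.next hq (not_lt.1 hc), by unfold searched; omega⟩

theorem runs_search {r : ℕ} (hG : G.Valid) (hW : G.Words W) (hM : G.Matching dead own mate)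
    (hl : G.Loaded s) (hd : s.arr 8 = dead) (ho : s.arr 9 = own) (hs : s.reg 7 = r) (hr : r < G.n)
    (hr0 : mate r = 0) :
    Runs W searchProg s fun s' t => G.SearchState dead own mate r s' ∧
      (s'.reg 14 = 0 → s'.reg 13 ≤ s'.reg 12) ∧ t ≤ 200 * (G.N + G.n + 1) := by
  have hnN : G.n ≤ G.N := n_le_N
  have w1 : 1 < W := hW.lt (by omega)
  have w0 : 0 < W := by omega
  refine Runs.seq ((Runs.upTo (by decide) (by decide) (by decide)
    (fun k s => G.Loaded s ∧ s.arr 8 = dead ∧ s.arr 9 = own ∧ s.reg 7 = r ∧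
      ∀ i < k, s.arr 14 i = 0 ∧ s.arr 12 i = 0) G.n 6
    (fun k s v h => ⟨h.1.setReg (by decide) v, by simpa using h.2⟩) (hW.lt (by omega)) w1 ?_
    ⟨hl, hd, ho, hs, fun i hi => by omega⟩ hl.n_eq).imp ?_)
  · rintro k s hk ⟨hl, hd, ho, hs, hz⟩ hi -
    refine Runs.of_wp (Q := fun s => G.Loaded s ∧ s.arr 8 = dead ∧ s.arr 9 = own ∧ s.reg 7 = r ∧
      ∀ i < k + 1, s.arr 14 i = 0 ∧ s.arr 12 i = 0) ?_
    refine ⟨trivial, w0, trivial, w0, fun _ => ⟨(hl.setArr (by decide) _ _).setArr (by decide) _ _,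
      hd, ho, hs, fun i hik => ?_⟩⟩
    rcases Nat.lt_succ_iff_lt_or_eq.1 hik with hik | rfl
    · have : i ≠ k := by omega
      simpa [Expr.eval, hi, this] using hz i hik
    · simp [Expr.eval, hi]
  rintro s t₁ ⟨⟨hl, hd, ho, hs, hz⟩, ht₁⟩
  refine Runs.store_seq w0 trivial (Runs.assign_seq w0 (Runs.assign_seq w1 (Runs.assign_seq w0 ?_)))
  refine (Runs.loop_of_wp (G.SearchState dead own mate r)
    (fun s => G.N + G.n + 1 - G.searched (s.arr 12) (s.reg 12)) ?_ ?_ ?_).imp ?_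
  · intro s h
    refine ⟨⟨trivial, trivial, w1⟩, ⟨trivial, w1, w1⟩, ?_⟩
    simp only [eval_lt, bit_mul_bit, bit_lt w1]
  · intro s h h0
    refine (SearchState.body hG hW hM h h0).mono fun s' hs' hf => ?_
    have := (hs' hf).1.search.searched_le hG
    have := (hs' hf).2
    exact ⟨(hs' hf).1, by omega⟩
  · refine ⟨(((((hl.setArr (by decide) _ _).setReg (by decide) _).setReg (by decide) _).setReg
      (by decide) _)), hd, ho, ?_⟩
    have hp : ∀ a < G.n, s.arr 14 a ≠ 0 → False := fun a ha h => h (hz a ha).1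
    simp only [Expr.eval, State.setReg_reg, State.setReg_arr, State.setArr_reg, State.setArr_arr,
      Nat.reduceEqDiff, if_true, if_false]
    constructor
    · exact hr
    · exact hr0
    · simpa using hs
    · omega
    · omega
    · omega
    · intro i hi
      obtain rfl : i = 0 := by omega
      simpa [hs] using hr
    · intro i hi j hj _; omega
    · intro i hi h0; omega
    · exact fun a ha h => (hp a ha h).elim
    · exact fun a ha h => (hp a ha h).elim
    · exact fun a ha h => (hp a ha h).elim
    · omega
    · exact fun h => absurd rfl h
    · intro h hh; rw [(hz h hh).2]; omega
    · intro h hh k hk; rw [(hz h hh).2] at hk; omega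
    · intro i hi; omega
  · rintro s' t ⟨h, h0, ht⟩
    refine ⟨h, fun h14 => ?_, ?_⟩
    · simp only [eval_mul, eval_lt, eval_var, eval_const, h14, bit_mul_bit, bit_eq_zero] at h0
      omega
    · have hc : searchBody.maxCost +
          (Expr.cost (mul (lt (var 12) (var 13)) (lt (var 14) (const 1))) + 1) ≤ 100 := by decide
      have hc₁ : Expr.cost (mul (lt (var 12) (var 13)) (lt (var 14) (const 1))) = 7 := rfl
      have hc₂ : ∀ k, Expr.cost (const k) = 1 := fun _ => rfl
      have hc₃ : Expr.cost (var 7) = 1 := rfl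
      have := ht.trans (Nat.add_le_add_right (Nat.mul_le_mul hc (Nat.sub_le _ _)) _)
      simp only [hc₂, hc₃]
      omega

/-- The queue position of the house to be reassigned decreases, so there are at most as many steps
as queue entries. This position is not kept in memory, which is why the loop is measured by an
index. -/
theorem runs_augment {mate₀ own₀ par cur queue : ℕ → ℕ} {r qh qt found : ℕ} (hW : G.Words W)
    (hS : G.Search dead own₀ mate₀ par cur queue r qh qt found)
    (hM : G.Matching dead own₀ mate₀) (hf : found ≠ 0)
    (ho : s.arr 9 = own₀) (hm : s.arr 10 = mate₀) (hp : s.arr 14 = par) (h14 : s.reg 14 = found) :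
    Runs W augmentProg s fun s' t => G.Matching dead (s'.arr 9) (s'.arr 10) ∧
      G.size mate₀ < G.size (s'.arr 10) ∧ (∀ b < G.n, mate₀ b ≠ 0 → s'.arr 10 b ≠ 0) ∧
        t ≤ 50 * (G.n + 2) := by
  have hnN : G.n ≤ G.N := n_le_N
  have hqt := hS.qt_le'
  obtain ⟨hA, p, hP⟩ := hS.augmenting hM hf
  refine (Runs.loop_of_wp_index (k := p + 1) (fun k s => s.arr 14 = par ∧
    G.Augmenting dead mate₀ par queue r (s.arr 9) (s.arr 10) (s.reg 14) ∧
    (s.reg 14 ≠ 0 → ∃ p < k, G.PathRest par queue (s.arr 10) qt (s.reg 14) p))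
    (fun k s _ => by exact trivial) ?_ ⟨hp, ?_, fun _ => ⟨p, by omega, ?_⟩⟩).imp ?_
  · rintro k s ⟨hp, hA, hP⟩ h0
    obtain ⟨p, hpk, hP⟩ := hP h0
    have hfn := hA.f_le
    obtain ⟨h1, h2⟩ := hA.step h0 hS hP
    have hqn := hS.queue_lt p hP.p_lt
    have hf' : s.reg 14 - 1 + 1 = s.reg 14 := Nat.succ_pred_eq_of_ne_zero h0
    simp only [augmentBody, Prog.Wp, Fits, Expr.eval, State.setReg_reg,
      State.setReg_arr, State.setArr_reg, State.setArr_arr, Nat.reduceEqDiff, if_true, if_false,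
      true_and, hp, hP.par_eq, hf', add_tsub_cancel_right]
    exact ⟨hW.lt (by omega), hW.lt (by omega), ⟨hW.lt (by omega), hW.lt (by omega)⟩,
      ⟨hW.lt (by omega), hW.lt (by omega)⟩, fun _ => ⟨k - 1, by omega, h1, fun hne => by
        obtain ⟨p', hp', h⟩ := h2 hne
        exact ⟨p', by omega, h⟩⟩⟩
  · rwa [ho, hm, h14]
  · rwa [hm, h14]
  · rintro s' t ⟨⟨k, hp, hA, -⟩, h0, ht⟩
    rw [show s'.reg 14 = 0 from h0] at hA
    refine ⟨hA.matching, hA.size_lt hS.root_lt hS.root_free, hA.mate_mono, ?_⟩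
    have hc : augmentBody.maxCost + (Expr.cost (var 14) + 1) ≤ 30 := by decide
    have hc' : Expr.cost (var 14) = 1 := rfl
    have := Nat.mul_le_mul hc (show p + 1 ≤ G.n + 1 by have := hP.p_lt; omega)
    omega

/-- The matching is being augmented. -/
structure MatchState (G : Net) (dead : ℕ → ℕ) (s : State) : Prop where
  loaded : G.Loaded s
  dead_eq : s.arr 8 = dead
  matching : G.Matching dead (s.arr 9) (s.arr 10)
  b_le : s.reg 7 ≤ G.n
  matched : ∀ b < s.reg 7, s.arr 10 b ≠ 0
  blocked : s.reg 15 = 1 ∨ s.reg 15 = 0 ∧ s.reg 7 < G.n ∧ G.Blocked dead (s.arr 9) (s.reg 7)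

/-- The alternatives are paid for differently: advancing is cheap, a successful search enlarges the
matching, and a failed one occurs only once because it clears register 15. -/
theorem MatchState.body (hG : G.Valid) (hW : G.Words W) (h : G.MatchState dead s)
    (h0 : (mul (lt (var 7) (var 0)) (var 15)).eval s ≠ 0) :
    Runs W matchBody s fun s' t => G.MatchState dead s' ∧
      ((t ≤ 20 ∧ s'.reg 7 = s.reg 7 + 1 ∧ s'.arr 10 = s.arr 10 ∧ s'.reg 15 = s.reg 15) ∨
        (t ≤ 300 * (G.N + G.n + 1) ∧ s'.reg 7 = s.reg 7 ∧
          ((G.size (s.arr 10) < G.size (s'.arr 10) ∧ s'.reg 15 = s.reg 15) ∨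
            (s'.arr 10 = s.arr 10 ∧ s.reg 15 = 1 ∧ s'.reg 15 = 0)))) := by
  have hnN : G.n ≤ G.N := n_le_N
  have h15 : s.reg 15 = 1 := by
    refine h.blocked.resolve_right fun h' => h0 ?_
    simp [Expr.eval, h'.1]
  have hlt : s.reg 7 < G.n := by
    by_contra hn
    refine h0 ?_
    simp [Expr.eval, h.loaded.n_eq, hn]
  have hc₁ : Expr.cost (get 10 (var 7)) = 2 := rfl
  refine Runs.cond trivial (fun hm => ?_) (fun hm => ?_)
  · refine (Runs.of_wp (Q := fun s' => G.MatchState dead s' ∧ s'.reg 7 = s.reg 7 + 1 ∧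
      s'.arr 10 = s.arr 10 ∧ s'.reg 15 = s.reg 15) ?_).imp ?_
    · simp only [Expr.eval] at hm
      refine ⟨⟨trivial, hW.lt (by omega), hW.lt (by simp only [Expr.eval]; omega)⟩, fun hf =>
        ⟨⟨h.loaded.of_frame (p := incr 7) (by decide) hf, h.dead_eq, h.matching, ?_, ?_, ?_⟩, ?_,
          rfl, rfl⟩⟩
      · simp only [Expr.eval, State.setReg_reg, if_true]; omega
      · intro b hb
        simp only [Expr.eval, State.setReg_reg, if_true] at hb
        rcases Nat.lt_succ_iff_lt_or_eq.1 hb with hb | rfl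
        · exact h.matched b hb
        · exact hm
      · exact Or.inl (by simpa using h15)
      · simp [Expr.eval]
    · rintro s' t ⟨⟨h1, h2, h3, h4⟩, ht⟩
      have : (incr 7).maxCost = 4 := rfl
      exact ⟨h1, Or.inl ⟨by omega, h2, h3, h4⟩⟩
  · simp only [Expr.eval] at hm
    refine Runs.seq ((runs_search hG hW h.matching h.loaded h.dead_eq rfl rfl hlt hm).frame.imp ?_)
    rintro s₁ t₁ ⟨⟨hS, hqt, ht₁⟩, hf₁⟩
    have r7 : s₁.reg 7 = s.reg 7 := hf₁.1 7 (by decide)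
    have r15 : s₁.reg 15 = s.reg 15 := hf₁.1 15 (by decide)
    have a9 : s₁.arr 9 = s.arr 9 := hf₁.2 9 (by decide)
    have a10 : s₁.arr 10 = s.arr 10 := hf₁.2 10 (by decide)
    have hc₂ : Expr.cost (var 14) = 1 := rfl
    refine Runs.cond trivial (fun h14 => ?_) (fun h14 => ?_)
    · refine (runs_augment hW hS.search h.matching h14 a9 a10 rfl rfl).frame.imp ?_
      rintro s₂ t₂ ⟨⟨hM, hsize, hmono, ht₂⟩, hf₂⟩
      have r7' : s₂.reg 7 = s₁.reg 7 := hf₂.1 7 (by decide)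
      have r15' : s₂.reg 15 = s₁.reg 15 := hf₂.1 15 (by decide)
      have a8' : s₂.arr 8 = s₁.arr 8 := hf₂.2 8 (by decide)
      have a8 : s₁.arr 8 = s.arr 8 := hf₁.2 8 (by decide)
      refine ⟨⟨hS.loaded.of_frame (p := augmentProg) (by decide) hf₂, by rw [a8', a8, h.dead_eq], hM,
        by rw [r7', r7]; exact h.b_le, fun b hb => ?_, Or.inl (by rw [r15', r15, h15])⟩,
        Or.inr ⟨by omega, by rw [r7', r7], Or.inl ⟨hsize, by rw [r15', r15]⟩⟩⟩
      rw [r7', r7] at hb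
      exact hmono b (by omega) (h.matched b hb)
    · refine (Runs.of_wp (Q := fun s' => s' = s₁.setReg 15 0) ?_).imp ?_
      · exact ⟨hW.lt (by omega), fun _ => rfl⟩
      rintro _ t₂ ⟨rfl, ht₂⟩
      simp only [Expr.eval] at h14
      have hb := hS.search
      rw [h14] at hb
      have ht₂' : t₂ ≤ 2 := ht₂
      refine ⟨⟨hS.loaded.setReg (by decide) _, hS.dead_eq, ?_, ?_, ?_, Or.inr ⟨by simp, ?_, ?_⟩⟩,
        Or.inr ⟨by omega, by simpa using r7, Or.inr ⟨a10, h15, by simp⟩⟩⟩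
      · simpa [a9, a10] using h.matching
      · simpa [r7] using h.b_le
      · simpa [r7, a10] using h.matched
      · simpa [r7] using hlt
      · simpa [a9, r7] using hb.blocked hG h.matching (hqt h14)

end Net

end PopAlloc

/-! ### Marking the arcs that are beaten -/

namespace PopAlloc

open PopAlloc.Expr PopAlloc.Prog

namespace Net

variable (G : Net)

/-- `1` if the arc `e` is preferred to the arc `f`, which leaves the same agent. -/
noncomputable def prefBit (e f : ℕ) : ℕ :=
  bit (e < G.m) * (bit (f < G.m) * G.P (e * G.m + f) + (1 - bit (f < G.m)))

/-- The arc `f` beats the arc `e` at the levels `lev`. -/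
def Beats (lev : ℕ → ℕ) (e f : ℕ) : Prop :=
  lev (G.H e) + G.prefBit e f < lev (G.H f) + G.prefBit f e

/-- The arc `e` is not beaten. -/
def Unbeaten (lev : ℕ → ℕ) (e : ℕ) : Prop :=
  ∀ f < G.N, G.T f = G.T e → ¬ G.Beats lev e f

/-- The marks are correct. -/
def Marked (lev dead : ℕ → ℕ) : Prop := ∀ e < G.N, dead e = 0 ↔ G.Unbeaten lev e

variable {G} {W : ℕ} {s : State} {lev dead : ℕ → ℕ}

theorem Valid.prefBit_le (hG : G.Valid) (e f : ℕ) : G.prefBit e f ≤ 1 := by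
  have h := hG.P_le (e * G.m + f)
  unfold prefBit bit
  split_ifs <;> simp [h]

theorem eval_beatExpr (hG : G.Valid) (hW : G.Words W) (hl : G.Loaded s)
    (hlev : ∀ b < G.n, s.arr 7 b ≤ G.n) {e f : Expr} (he : e.Fits W s) (hf : f.Fits W s)
    (heN : e.eval s < G.N) (hfN : f.eval s < G.N) :
    (beatExpr e f).Fits W s ∧
      (beatExpr e f).eval s = bit (G.Beats (s.arr 7) (e.eval s) (f.eval s)) := by
  have hpref : ∀ {e f : Expr}, (prefExpr e f).eval s = G.prefBit (e.eval s) (f.eval s) := by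
    intro e f
    simp only [prefExpr, eval_const, eval_var, eval_get, eval_add, eval_sub, eval_mul, eval_lt,
      hl.m_eq, hl.P_eq, prefBit]
  have w1 : 1 < W := hW.lt (by omega)
  have hmN : G.m ≤ G.N := Nat.le_add_left _ _
  have hnN : G.n ≤ G.N := n_le_N
  have hfits : ∀ {e f : Expr}, e.Fits W s → f.Fits W s → e.eval s < G.N → f.eval s < G.N →
      (prefExpr e f).Fits W s := by
    intro e f he hf heN hfN
    have hP := hG.P_le (e.eval s * G.m + f.eval s)
    have h1 := bit_le_one (f.eval s < G.m)
    have h2 := Nat.mul_le_mul h1 hP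
    have h3 := Nat.mul_le_mul (bit_le_one (e.eval s < G.m)) (Nat.add_le_add h2
      (Nat.sub_le 1 (bit (f.eval s < G.m))))
    simp only [prefExpr, Fits, eval_const, eval_var, eval_get, eval_add, eval_sub, eval_mul,
      eval_lt, hl.m_eq, hl.P_eq, he, hf, w1, true_and, and_true]
    exact ⟨⟨⟨⟨hW.mul_lt (by omega) (by omega), hW.mul_add_lt (by omega) (by omega) (by omega)⟩,
      hW.lt (by omega)⟩, hW.lt (by omega)⟩, hW.lt (by omega)⟩
  have h1 := hG.prefBit_le (e.eval s) (f.eval s)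
  have h2 := hG.prefBit_le (f.eval s) (e.eval s)
  have h3 := hlev _ (hG.H_lt _ heN)
  have h4 := hlev _ (hG.H_lt _ hfN)
  constructor
  · simp only [beatExpr, Fits, eval_get, hpref, hl.H_eq, he, hf, w1, true_and, and_true]
    exact ⟨⟨hfits he hf heN hfN, hW.lt (by omega)⟩, hfits hf he hfN heN, hW.lt (by omega)⟩
  · simp only [beatExpr, eval_get, eval_add, eval_lt, hpref, hl.H_eq, Beats]

theorem runs_clear (hW : G.Words W) (hl : G.Loaded s) :
    Runs W (upTo 6 3 clearBody) s fun s' t =>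
      (∀ e < G.N, s'.arr 8 e = 0 ↔ G.H e = s.reg 7 ∨ s.arr 8 e = 0) ∧ t ≤ 50 * (G.N + 1) := by
  have w1 : 1 < W := hW.lt (by omega)
  refine (Runs.upTo (by decide) (by decide) (by decide)
    (fun k s' => G.Loaded s' ∧ s'.reg 7 = s.reg 7 ∧ (∀ e < k, s'.arr 8 e = 0 ↔ G.H e = s.reg 7 ∨
      s.arr 8 e = 0) ∧ ∀ e, k ≤ e → s'.arr 8 e = s.arr 8 e) G.N clearBody.maxCost
    (fun k s v h => ⟨h.1.setReg (by decide) v, by simpa using h.2⟩) (hW.lt (by omega)) w1 ?_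
    ⟨hl, rfl, fun e he => by omega, fun _ _ => rfl⟩ hl.N_eq).imp ?_
  · rintro k s' hk ⟨hl', h7, hlt, hge⟩ hi -
    refine Runs.of_wp (Q := fun s' => G.Loaded s' ∧ s'.reg 7 = s.reg 7 ∧
      (∀ e < k + 1, s'.arr 8 e = 0 ↔ G.H e = s.reg 7 ∨ s.arr 8 e = 0) ∧
        ∀ e, k + 1 ≤ e → s'.arr 8 e = s.arr 8 e) ?_
    have hb₁ := bit_le_one (G.H k < s.reg 7)
    have hb₂ := bit_le_one (s.reg 7 < G.H k)
    simp only [clearBody, Prog.Wp, Fits, eval_const, eval_var, eval_get, eval_add, eval_lt,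
      hi, h7, hl'.H_eq, w1, true_and, State.setArr_arr, State.setArr_reg, if_true, ne_eq,
      Nat.add_eq_zero_iff, bit_eq_zero]
    refine ⟨hW.lt (by omega), fun hne _ => ⟨hl', fun e he => ?_, fun e he => hge e (by omega)⟩,
      fun heq => ⟨hW.lt (by omega), fun _ => ⟨hl'.setArr (by decide) _ _, fun e he => ?_,
        fun e he => ?_⟩⟩⟩
    · rcases Nat.lt_succ_iff_lt_or_eq.1 he with he | rfl
      · exact hlt e he
      · rw [hge e le_rfl]
        omega
    · rcases Nat.lt_succ_iff_lt_or_eq.1 he with he | rfl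
      · rw [Function.update_of_ne (by omega)]
        exact hlt e he
      · simp only [Function.update_self, true_iff]
        omega
    · rw [Function.update_of_ne (by omega)]
      exact hge e (by omega)
  · rintro s' t ⟨⟨-, -, hlt, -⟩, ht⟩
    have hc : clearBody.maxCost + 8 ≤ 40 := by decide
    have := Nat.mul_le_mul_right G.N hc
    exact ⟨hlt, by omega⟩

/-- What `markBody` does to the mark of the arc `e` when it looks at the arc `i`. -/
def Spared (G : Net) (lev : ℕ → ℕ) (b e i : ℕ) : Prop :=
  ∀ g < G.N, G.T g = G.T i → G.H g = b →
    (e = g → ¬ G.Beats lev g i) ∧ (e = i → ¬ G.Beats lev i g)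

theorem runs_mark (hG : G.Valid) (hW : G.Words W) (hl : G.Loaded s) (hb : s.reg 7 < G.n)
    (hlev : ∀ b < G.n, s.arr 7 b ≤ G.n) :
    Runs W (upTo 6 3 markBody) s fun s' t =>
      (∀ e < G.N, s'.arr 8 e = 0 ↔
        s.arr 8 e = 0 ∧ ∀ i < G.N, G.Spared (s.arr 7) (s.reg 7) e i) ∧ t ≤ 150 * (G.N + 1) := by
  have w1 : 1 < W := hW.lt (by omega)
  have w0 : 0 < W := by omega
  have hnN : G.n ≤ G.N := n_le_N
  refine (Runs.upTo (by decide) (by decide) (by decide)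
    (fun k s' => G.Loaded s' ∧ s'.reg 7 = s.reg 7 ∧ s'.arr 7 = s.arr 7 ∧
      ∀ e < G.N, s'.arr 8 e = 0 ↔
        s.arr 8 e = 0 ∧ ∀ i < k, G.Spared (s.arr 7) (s.reg 7) e i) G.N markBody.maxCost
    (fun k s v h => ⟨h.1.setReg (by decide) v, by simpa using h.2⟩) (hW.lt (by omega)) w1 ?_
    ⟨hl, rfl, rfl, fun e he => by simp⟩ hl.N_eq).imp ?_
  · rintro k s' hk ⟨hl', h7, hlev', hinv⟩ hi -
    have hTk := hG.T_lt k hk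
    refine Runs.of_wp (Q := fun s' => G.Loaded s' ∧ s'.reg 7 = s.reg 7 ∧ s'.arr 7 = s.arr 7 ∧
      ∀ e < G.N, s'.arr 8 e = 0 ↔
        s.arr 8 e = 0 ∧ ∀ i < k + 1, G.Spared (s.arr 7) (s.reg 7) e i) ?_
    have hsucc : ∀ e, (∀ i < k + 1, G.Spared (s.arr 7) (s.reg 7) e i) ↔
        (∀ i < k, G.Spared (s.arr 7) (s.reg 7) e i) ∧ G.Spared (s.arr 7) (s.reg 7) e k := by
      intro e
      constructor
      · exact fun h => ⟨fun i hi => h i (by omega), h k (by omega)⟩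
      · rintro ⟨h1, h2⟩ i hi
        rcases Nat.lt_succ_iff_lt_or_eq.1 hi with hi | rfl
        · exact h1 i hi
        · exact h2
    suffices markBody.Wp W s' fun s'' => ∀ e < G.N, s''.arr 8 e = 0 ↔
        s'.arr 8 e = 0 ∧ G.Spared (s.arr 7) (s.reg 7) e k from
      this.mono fun s'' h hf => ⟨hl'.of_frame (by decide) hf, (hf.1 7 (by decide)).trans h7,
        (hf.2 7 (by decide)).trans hlev', fun e he => by
          rw [h e he, hinv e he, hsucc e, and_assoc]⟩
    have hidx : G.T k * G.n < W ∧ G.T k * G.n + s.reg 7 < W :=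
      ⟨hW.mul_lt (by omega) (by omega), hW.mul_add_lt (by omega) (by omega) (by omega)⟩
    by_cases hE : G.E (G.T k * G.n + s.reg 7) = 0
    · simp only [markBody, Prog.Wp, Fits, eval_var, eval_get, eval_add, eval_mul, hi, h7, hl'.E_eq,
        hl'.T_eq, hl'.n_eq, true_and, hidx, State.setReg_reg, State.setReg_arr, if_true, hE,
        ne_eq, not_true_eq_false, false_imp_iff]
      intro _ e he
      refine ⟨fun h => ⟨h, fun g hg hT hH => ?_⟩, And.left⟩
      have := hG.E_eq g hg
      rw [hT, hH] at this
      omega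
    · obtain ⟨g, hg, hT, hH, hEg⟩ := hG.E_inv _ hTk _ hb hE
      have hsp : ∀ e, G.Spared (s.arr 7) (s.reg 7) e k ↔
          (e = g → ¬ G.Beats (s.arr 7) g k) ∧ (e = k → ¬ G.Beats (s.arr 7) k g) := by
        intro e
        constructor
        · exact fun h => h g hg hT hH
        · intro h g' hg' hT' hH'
          obtain rfl := hG.inj g' hg' g hg (hT'.trans hT.symm) (hH'.trans hH.symm)
          exact h
      have hr₁ : ((s'.setReg 9 (g + 1)).setReg 9 g).reg 9 = g := by simp
      refine ⟨by simpa [Fits, Expr.eval, hi, h7, hl'.T_eq, hl'.n_eq] using hidx, ?_⟩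
      have hev : (get 6 (add (mul (get 0 (var 6)) (var 0)) (var 7))).eval s' = g + 1 := by
        simp [Expr.eval, hi, h7, hl'.T_eq, hl'.n_eq, hl'.E_eq, hEg]
      rw [hev]
      refine ⟨trivial, fun _ => ⟨⟨trivial, w1⟩, ?_⟩, fun h => absurd h (by simp [Expr.eval])⟩
      have hev' : (sub (var 9) (const 1)).eval (s'.setReg 9 (g + 1)) = g := by simp [Expr.eval]
      rw [hev']
      set s₁ := (s'.setReg 9 (g + 1)).setReg 9 g with hs₁
      have hl₁ : G.Loaded s₁ := (hl'.setReg (by decide) _).setReg (by decide) _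
      have r9 : s₁.reg 9 = g := by simp [hs₁]
      have r6 : s₁.reg 6 = k := by simp [hs₁, hi]
      have a7 : s₁.arr 7 = s.arr 7 := by simp [hs₁, hlev']
      have a8 : s₁.arr 8 = s'.arr 8 := by simp [hs₁]
      obtain ⟨hf₁, he₁⟩ := eval_beatExpr hG hW hl₁ (by rwa [a7]) (e := var 9) (f := var 6) trivial
        trivial (by simpa [Expr.eval, r9] using hg) (by simpa [Expr.eval, r6] using hk)
      simp only [eval_var, r9, r6, a7] at he₁
      -- The second comparison, stated for any state that the first one may leave behind, so that it
      -- serves both branches.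
      have second : ∀ s₂ : State, G.Loaded s₂ → s₂.reg 9 = g → s₂.reg 6 = k →
          s₂.arr 7 = s.arr 7 → (∀ e < G.N, s₂.arr 8 e = 0 ↔
            s'.arr 8 e = 0 ∧ (e = g → ¬ G.Beats (s.arr 7) g k)) →
          (cond (beatExpr (var 6) (var 9)) (store 8 (var 6) (const 1)) skip).Wp W s₂ fun s'' =>
            ∀ e < G.N, s''.arr 8 e = 0 ↔ s'.arr 8 e = 0 ∧ G.Spared (s.arr 7) (s.reg 7) e k := by
        intro s₂ hl₂ r9 r6 a7 h
        obtain ⟨hf₂, he₂⟩ := eval_beatExpr hG hW hl₂ (by rwa [a7]) (e := var 6) (f := var 9) trivial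
          trivial (by simpa [Expr.eval, r6] using hk) (by simpa [Expr.eval, r9] using hg)
        simp only [eval_var, r9, r6, a7] at he₂
        refine ⟨hf₂, fun hne => ⟨trivial, w1, fun e he => ?_⟩, fun h0 e he => ?_⟩
        · rw [he₂, ne_eq, bit_eq_zero, not_not] at hne
          simp only [State.setArr_arr, if_true, eval_var, eval_const, r6, hsp]
          by_cases hek : e = k
          · subst hek; simp [hne]
          · simp only [Function.update_of_ne hek, h e he, hek, false_imp_iff, and_true]
        · rw [he₂, bit_eq_zero] at h0
          simp only [hsp, h e he, h0, not_false_eq_true, implies_true, and_true]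
      refine ⟨hf₁, fun hne => ⟨trivial, w1, ?_⟩, fun h0 => ?_⟩
      · rw [he₁, ne_eq, bit_eq_zero, not_not] at hne
        refine second _ (hl₁.setArr (by decide) _ _) r9 r6 (by simpa using a7) fun e he => ?_
        simp only [State.setArr_arr, if_true, eval_var, eval_const, r9, a8]
        by_cases heg : e = g
        · subst heg; simp [hne]
        · simp only [Function.update_of_ne heg, heg, false_imp_iff, and_true]
      · rw [he₁, bit_eq_zero] at h0
        refine second _ hl₁ r9 r6 a7 fun e he => ?_
        simp only [a8, h0, not_false_eq_true, implies_true, and_true]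
  · rintro s' t ⟨⟨-, -, -, h⟩, ht⟩
    have hc : markBody.maxCost + 8 ≤ 140 := by decide
    have := Nat.mul_le_mul_right G.N hc
    exact ⟨h, by omega⟩

/-- Arcs into the house in register 7 lose their marks and are then compared with all arcs of the
same agent. Any other arc keeps its mark and is compared only with the arc of its agent into that
house. -/
theorem runs_refresh (hG : G.Valid) (hW : G.Words W) (hl : G.Loaded s) (hb : s.reg 7 < G.n)
    (hlev : ∀ b < G.n, s.arr 7 b ≤ G.n) :
    Runs W refreshProg s fun s' t =>
      (∀ e < G.N, s'.arr 8 e = 0 ↔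
        if G.H e = s.reg 7 then G.Unbeaten (s.arr 7) e
        else s.arr 8 e = 0 ∧ ∀ f < G.N, G.T f = G.T e → G.H f = s.reg 7 →
          ¬ G.Beats (s.arr 7) e f) ∧ t ≤ 200 * (G.N + 1) := by
  refine Runs.seq ((runs_clear hW hl).frame.imp ?_)
  rintro s₁ t₁ ⟨⟨h₁, ht₁⟩, hf⟩
  have r7 : s₁.reg 7 = s.reg 7 := hf.1 7 (by decide)
  have a7 : s₁.arr 7 = s.arr 7 := hf.2 7 (by decide)
  refine (runs_mark hG hW (hl.of_frame (by decide) hf) (by rwa [r7]) (by rwa [a7])).imp ?_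
  rintro s₂ t₂ ⟨h₂, ht₂⟩
  rw [r7, a7] at h₂
  refine ⟨fun e he => ?_, by omega⟩
  rw [h₂ e he, h₁ e he]
  have hirr : ∀ e, ¬ G.Beats (s.arr 7) e e := fun e h => by
    unfold Beats at h; omega
  split_ifs with hH
  · constructor
    · rintro ⟨-, h⟩ f hf hT
      exact (h f hf e he hT.symm hH).1 rfl
    · refine fun h => ⟨Or.inl hH, fun i hi g hg hT hHg => ⟨?_, ?_⟩⟩
      · rintro rfl
        exact h i hi hT.symm
      · rintro rfl
        exact h g hg hT
  · constructor
    · rintro ⟨h, h'⟩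
      exact ⟨h.resolve_left hH, fun f hf hT hHf => (h' e he f hf hT hHf).2 rfl⟩
    · rintro ⟨h, h'⟩
      refine ⟨Or.inr h, fun i hi g hg hT hHg => ⟨?_, ?_⟩⟩
      · rintro rfl
        exact absurd hHg hH
      · rintro rfl
        exact h' g hg hT hHg

/-- When the level of `b` rises, an arc into another house can become beaten only by an arc into
`b`, and it cannot cease to be beaten. So old marks remain valid there, and only arcs into `b` need
a fresh comparison. -/
theorem Marked.raise {lev dead dead' : ℕ → ℕ} (h : G.Marked lev dead) {b : ℕ}
    (h' : ∀ e < G.N, dead' e = 0 ↔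
      if G.H e = b then G.Unbeaten (Function.update lev b (lev b + 1)) e
      else dead e = 0 ∧ ∀ f < G.N, G.T f = G.T e → G.H f = b →
        ¬ G.Beats (Function.update lev b (lev b + 1)) e f) :
    G.Marked (Function.update lev b (lev b + 1)) dead' := by
  intro e he
  rw [h' e he]
  split_ifs with hH
  · rfl
  · rw [h e he]
    constructor
    · rintro ⟨h1, h2⟩ f hf hT
      by_cases hHf : G.H f = b
      · exact h2 f hf hT hHf
      · have := h1 f hf hT
        simpa [Beats, hH, hHf] using this
    · refine fun h1 => ⟨fun f hf hT => ?_, fun f hf hT _ => h1 f hf hT⟩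
      have := h1 f hf hT
      by_cases hHf : G.H f = b
      · simp only [Beats, Function.update_of_ne hH, hHf, Function.update_self] at this ⊢
        omega
      · simpa [Beats, hH, hHf] using this

/-- The levels are fixed here. The refresh for a house makes the marks of the arcs into it correct,
and the refreshes for later houses preserve them. -/
theorem runs_initMarks (hG : G.Valid) (hW : G.Words W) (hl : G.Loaded s)
    (hlev : ∀ b < G.n, s.arr 7 b ≤ G.n) :
    Runs W (upTo 7 0 refreshProg) s fun s' t =>
      G.Marked (s.arr 7) (s'.arr 8) ∧ t ≤ (200 * (G.N + 1) + 8) * G.n + 6 := by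
  refine (Runs.upTo (by decide) (by decide) (by decide)
    (fun k s' => G.Loaded s' ∧ s'.arr 7 = s.arr 7 ∧
      ∀ e < G.N, G.H e < k → (s'.arr 8 e = 0 ↔ G.Unbeaten (s.arr 7) e)) G.n (200 * (G.N + 1))
    (fun k s v h => ⟨h.1.setReg (by decide) v, h.2⟩)
    (hW.lt (by have := n_le_N (G := G); omega)) (hW.lt (by omega)) ?_
    ⟨hl, rfl, fun e he h => by omega⟩ hl.n_eq).imp ?_
  · rintro k s' hk ⟨hl', a7, h⟩ hi -
    refine (runs_refresh hG hW hl' (by rwa [hi]) (by rwa [a7])).frame.imp ?_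
    rintro s'' t ⟨⟨h', ht⟩, hf⟩
    refine ⟨⟨hl'.of_frame (by decide) hf, (hf.2 7 (by decide)).trans a7, fun e he hlt => ?_⟩, ht⟩
    rw [h' e he, hi, a7]
    split_ifs with hH
    · rfl
    · rw [h e he (by omega)]
      exact ⟨And.left, fun hu => ⟨hu, fun f hf hT _ => hu f hf hT⟩⟩
  · rintro s' t ⟨⟨-, -, h⟩, ht⟩
    exact ⟨fun e he => h e he (hG.H_lt e he), ht⟩

end Net

end PopAlloc

/-! ### A round, and the main loop -/

namespace PopAlloc

open PopAlloc.Expr PopAlloc.Prog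

namespace Net

variable {G : Net} {W : ℕ} {s s' : State} {dead own mate : ℕ → ℕ}

/-- By `hB` at most `L` augmentations succeed. The potential reserves a constant for every house,
`C` for each augmentation still possible, and `C` for the failed search, through register 15. -/
theorem runs_match (hG : G.Valid) (hW : G.Words W) (hl : G.Loaded s) (hd : s.arr 8 = dead)
    (hM : G.Matching dead (s.arr 9) (s.arr 10))
    (hB : ∀ own' mate', G.Matching dead own' mate' → G.size mate' ≤ G.size (s.arr 10) + G.L) :
    Runs W matchProg s fun s' t => G.MatchState dead s' ∧ (s'.reg 15 ≠ 0 → s'.reg 7 = G.n) ∧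
      t ≤ 400 * ((G.L + 2) * (G.N + G.n + 1)) := by
  have w1 : 1 < W := hW.lt (by omega)
  have w0 : 0 < W := by omega
  set C := 300 * (G.N + G.n + 1) + 60 with hC
  set B := G.size (s.arr 10) + G.L with hBdef
  refine Runs.assign_seq w0 (Runs.assign_seq w1 ?_)
  have hcost : Expr.cost (mul (lt (var 7) (var 0)) (var 15)) = 5 := rfl
  refine (Runs.loop (G.MatchState dead)
    (fun s => 60 * (G.n - s.reg 7) + C * (B - G.size (s.arr 10)) + C * s.reg 15) ?_ ?_ ?_).imp ?_
  · intro s h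
    refine ⟨⟨trivial, trivial, w1⟩, trivial, ?_⟩
    have h15 : s.reg 15 ≤ 1 := by have := h.blocked; omega
    rw [eval_lt, eval_var s 15]
    calc _ ≤ 1 * 1 := Nat.mul_le_mul (bit_le_one _) h15
      _ < W := by omega
  · intro s h h0
    refine (MatchState.body hG hW h h0).imp ?_
    rintro s' t ⟨h', hcases⟩
    refine ⟨h', ?_⟩
    have hb := h'.b_le
    have hs' := hB _ _ h'.matching
    rw [hcost]
    rcases hcases with ⟨ht, h7, h10, h15⟩ | ⟨ht, h7, ⟨hlt, h15⟩ | ⟨h10, h15, h15'⟩⟩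
    · rw [h10, h15, h7]
      omega
    · obtain ⟨j, hj⟩ : ∃ j, B - G.size (s.arr 10) = (B - G.size (s'.arr 10)) + 1 + j :=
        ⟨B - G.size (s.arr 10) - (B - G.size (s'.arr 10)) - 1, by omega⟩
      rw [h15, h7, hj, Nat.mul_add, Nat.mul_add]
      omega
    · rw [h10, h15, h15', h7]
      omega
  · refine ⟨(hl.setReg (by decide) _).setReg (by decide) _, hd, hM, ?_, ?_, Or.inl ?_⟩
    · simp [Expr.eval]
    · intro b hb
      simp [Expr.eval] at hb
    · simp [Expr.eval]
  · rintro s' t ⟨h, h0, ht⟩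
    refine ⟨h, fun h15 => ?_, ?_⟩
    · have := h.b_le
      by_contra hne
      have hlt : s'.reg 7 < G.n := by omega
      simp [Expr.eval, h.loaded.n_eq, hlt, h15] at h0
    · simp only [Expr.eval, State.setReg_reg, State.setReg_arr, Nat.reduceEqDiff, if_true,
        if_false, Expr.cost] at ht ⊢
      have hBs : B - G.size (s.arr 10) = G.L := by omega
      rw [hBs] at ht
      have : C * G.L ≤ 360 * (G.L * (G.N + G.n + 1)) := by
        calc C * G.L ≤ (360 * (G.N + G.n + 1)) * G.L := Nat.mul_le_mul_right _ (by omega)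
          _ = _ := by ring
      rw [Nat.add_mul]
      omega

theorem runs_reset (hW : G.Words W) (hn : s.reg 0 = G.n) :
    Runs W (upTo 6 0 resetBody) s fun s' t =>
      (∀ x ∈ [9, 10, 11, 12, 13], ∀ i < G.n, s'.arr x i = 0) ∧ t ≤ 30 * (G.n + 1) := by
  have hnN : G.n ≤ G.N := n_le_N
  have w1 : 1 < W := hW.lt (by omega)
  have w0 : 0 < W := by omega
  refine (Runs.upTo (by decide) (by decide) (by decide)
    (fun k s => ∀ x ∈ [9, 10, 11, 12, 13], ∀ i < k, s.arr x i = 0) G.n resetBody.maxCost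
    (fun k s v h => h) (hW.lt (by omega)) w1 ?_ (fun _ _ i hi => by omega) hn).imp ?_
  · rintro k s hk h hi -
    refine Runs.of_wp (Q := fun s => ∀ x ∈ [9, 10, 11, 12, 13], ∀ i < k + 1, s.arr x i = 0) ?_
    refine ⟨trivial, w0, trivial, w0, trivial, w0, trivial, w0, trivial, w0, fun _ => ?_⟩
    intro x hx i hik
    have hx' := h x hx
    simp only [List.mem_cons, List.not_mem_nil, or_false] at hx
    rcases Nat.lt_succ_iff_lt_or_eq.1 hik with hik | rfl
    · have hne : i ≠ k := by omega
      have := hx' i hik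
      rcases hx with rfl | rfl | rfl | rfl | rfl <;> simpa [Expr.eval, hi, hne] using this
    · rcases hx with rfl | rfl | rfl | rfl | rfl <;> simp [Expr.eval, hi]
  · rintro s' t ⟨h, ht⟩
    have hc : resetBody.maxCost + 8 ≤ 30 := by decide
    have := Nat.mul_le_mul_right G.n hc
    exact ⟨h, by omega⟩

/-- The invariant of the main loop; the levels satisfy `J`. -/
structure MainState (G : Net) (J : (ℕ → ℕ) → Prop) (s : State) : Prop where
  loaded : G.Loaded s
  levels : J (s.arr 7)
  marked : s.reg 2 = 1 ∨ s.reg 5 = 1 → G.Marked (s.arr 7) (s.arr 8)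
  running : s.reg 5 = 1 → s.reg 2 = 0 ∧ ∀ b < G.n, s.arr 7 b < G.n
  done : s.reg 5 = 1 ∨ s.reg 5 = 0 ∧
    ((s.reg 2 = 1 ∧ G.Matching (s.arr 8) (s.arr 9) (s.arr 10) ∧ ∀ b < G.n, s.arr 10 b ≠ 0) ∨
      (s.reg 2 = 0 ∧ ∃ b < G.n, G.n ≤ s.arr 7 b))

/-- The sum of the levels. -/
def levelSum (G : Net) (lev : ℕ → ℕ) : ℕ := ∑ b ∈ Finset.range G.n, lev b

/-- A level may be raised when there is no augmenting path from its house. -/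
def RaiseClosed (G : Net) (J : (ℕ → ℕ) → Prop) : Prop :=
  ∀ lev dead own mate b, b < G.n → J lev → G.Marked lev dead → G.Matching dead own mate →
    G.Blocked dead own b → J (Function.update lev b (lev b + 1))

variable {J : (ℕ → ℕ) → Prop}

/-- The property `J` of the levels stays abstract, which keeps housing markets out of the analysis
of the program; it is later taken to be `HousingMarket.Below`. -/
theorem runs_round (hG : G.Valid) (hW : G.Words W) (hJ : G.RaiseClosed J) (h : G.MainState J s)
    (h5 : s.reg 5 = 1) :
    Runs W roundProg s fun s' t => G.MainState J s' ∧
      ((G.levelSum (s'.arr 7) = G.levelSum (s.arr 7) + 1 ∧ s'.reg 5 = 1) ∨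
        (G.levelSum (s.arr 7) ≤ G.levelSum (s'.arr 7) ∧ s'.reg 5 = 0)) ∧
      t ≤ 1000 * ((G.L + 2) * (G.N + G.n + 1)) := by
  have hnN : G.n ≤ G.N := n_le_N
  have w1 : 1 < W := hW.lt (by omega)
  have w0 : 0 < W := by omega
  have hl := h.loaded
  obtain ⟨h2, hlev⟩ := h.running h5
  have hmk := h.marked (Or.inr h5)
  refine Runs.seq ((runs_reset hW hl.n_eq).frame.imp ?_)
  rintro s₁ t₁ ⟨⟨hz, ht₁⟩, hf₁⟩
  have hl₁ : G.Loaded s₁ := hl.of_frame (by decide) hf₁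
  have a8₁ : s₁.arr 8 = s.arr 8 := hf₁.2 8 (by decide)
  refine Runs.seq ((runs_auction hG hW hl₁ a8₁ fun x hx => hz x
    (by simp only [List.mem_cons, List.not_mem_nil, or_false] at hx ⊢; omega)).frame.imp ?_)
  rintro s₂ t₂ ⟨⟨hA, h7, h8, ht₂⟩, hf₂⟩
  have hA' := hA.auction
  rw [h7, h8] at hA'
  have a10₂ : s₂.arr 10 = s₁.arr 10 := hf₂.2 10 (by decide)
  refine Runs.seq ((runs_mates hW hG hA' hA.loaded rfl
    (by rw [a10₂]; exact hz 10 (by decide))).frame.imp ?_)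
  rintro s₃ t₃ ⟨⟨hM₃, ht₃⟩, hf₃⟩
  have a9₃ : s₃.arr 9 = s₂.arr 9 := hf₃.2 9 (by decide)
  have a8₃ : s₃.arr 8 = s.arr 8 := (hf₃.2 8 (by decide)).trans hA.dead_eq
  have hl₃ : G.Loaded s₃ := hA.loaded.of_frame (by decide) hf₃
  rw [← a9₃] at hA'
  refine Runs.seq ((runs_match hG hW hl₃ a8₃ hM₃
    fun own' mate' h' => hA'.size_le_size hG hM₃ h').frame.imp ?_)
  rintro s₄ t₄ ⟨⟨hM₄, h15, ht₄⟩, hf₄⟩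
  have r2₄ : s₄.reg 2 = 0 := by
    rw [hf₄.1 2 (by decide), hf₃.1 2 (by decide), hf₂.1 2 (by decide), hf₁.1 2 (by decide), h2]
  have a7₄ : s₄.arr 7 = s.arr 7 := by
    rw [hf₄.2 7 (by decide), hf₃.2 7 (by decide), hf₂.2 7 (by decide), hf₁.2 7 (by decide)]
  have hl₄ := hM₄.loaded
  set X := (G.L + 2) * (G.N + G.n + 1) with hX
  have hsum : t₁ + t₂ + t₃ + t₄ + 250 * (G.N + 1) ≤ 999 * X := by
    have h1 : X = G.L * (G.N + G.n + 1) + 2 * (G.N + G.n + 1) := by rw [hX]; ring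
    have h2 : G.L * (G.N + G.n + 1) = G.L * (G.N + G.n) + G.L := by ring
    have h3 : G.L * (G.N + G.n) = G.L * G.N + G.n * G.L := by ring
    omega
  have hX1 : 2 ≤ X := Nat.mul_le_mul (show 2 ≤ G.L + 2 by omega) (show 1 ≤ G.N + G.n + 1 by omega)
  refine Runs.cond trivial (fun hr => ?_) (fun hr => ?_)
  · rw [eval_var] at hr
    have hfull := hM₄.matched
    rw [h15 hr] at hfull
    refine (Runs.of_wp (Q := fun s' => s' = (s₄.setReg 5 0).setReg 2 1) ?_).imp ?_
    · exact ⟨w0, w1, fun _ => rfl⟩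
    rintro _ t₅ ⟨rfl, ht₅⟩
    have ht₅' : t₅ ≤ 4 := ht₅
    have hc : Expr.cost (var 15) = 1 := rfl
    refine ⟨⟨(hl₄.setReg (by decide) _).setReg (by decide) _, ?_, fun _ => ?_, ?_, Or.inr ⟨?_,
      Or.inl ⟨?_, ?_, ?_⟩⟩⟩, Or.inr ⟨?_, ?_⟩, by omega⟩
    · simpa [a7₄] using h.levels
    · simpa [a7₄, hM₄.dead_eq] using hmk
    · simp
    · simp
    · simp
    · simpa [hM₄.dead_eq] using hM₄.matching
    · simpa using hfull
    · simp [a7₄]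
    · simp
  · rw [eval_var] at hr
    obtain ⟨-, hb, hblk⟩ := hM₄.blocked.resolve_left (by omega)
    set b := s₄.reg 7 with hbdef
    have hlb := hlev b hb
    have hJ' : J (Function.update (s.arr 7) b (s.arr 7 b + 1)) :=
      hJ _ _ _ _ b hb h.levels hmk hM₄.matching hblk
    have hlsum : G.levelSum (Function.update (s.arr 7) b (s.arr 7 b + 1)) =
        G.levelSum (s.arr 7) + 1 := by
      have := sum_range_add_eq (f := s.arr 7) (g := Function.update (s.arr 7) b (s.arr 7 b + 1)) hb
        fun i hi => Function.update_of_ne hi _ _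
      rw [Function.update_self] at this
      unfold levelSum
      omega
    refine Runs.store_seq trivial ⟨trivial, w1, hW.lt ?_⟩ ?_
    · simp only [Expr.eval, a7₄, ← hbdef]
      omega
    simp only [Expr.eval, ← hbdef]
    set s₅ := s₄.setArr 7 b (s₄.arr 7 b + 1) with hs₅
    have hl₅ : G.Loaded s₅ := hl₄.setArr (by decide) _ _
    have a7₅ : s₅.arr 7 = Function.update (s.arr 7) b (s.arr 7 b + 1) := by simp [hs₅, a7₄]
    have a8₅ : s₅.arr 8 = s.arr 8 := by simp [hs₅, hM₄.dead_eq]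
    have r7₅ : s₅.reg 7 = b := rfl
    have r2₅ : s₅.reg 2 = 0 := r2₄
    have hle₅ : ∀ i < G.n, s₅.arr 7 i ≤ G.n := by
      intro i hi
      rw [a7₅]
      by_cases hib : i = b
      · subst hib; rw [Function.update_self]; exact hlb
      · rw [Function.update_of_ne hib]; exact (hlev i hi).le
    have hc₁ : Expr.cost (var 15) = 1 := rfl
    have hc₂ : Expr.cost (var 7) = 1 := rfl
    have hc₃ : Expr.cost (add (get 7 (var 7)) (const 1)) = 4 := rfl
    have hc₄ : Expr.cost (lt (get 7 (var 7)) (var 0)) = 4 := rfl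
    refine Runs.cond ⟨trivial, trivial, w1⟩ (fun hlt => ?_) (fun hge => ?_)
    · rw [eval_lt, ne_eq, bit_eq_zero, not_not, eval_get, eval_var, eval_var, hl₅.n_eq, r7₅] at hlt
      refine (runs_refresh hG hW hl₅ hb hle₅).frame.imp ?_
      rintro s₆ t₆ ⟨⟨hd, ht₆⟩, hf₆⟩
      have a7₆ : s₆.arr 7 = s₅.arr 7 := hf₆.2 7 (by decide)
      have r5₆ : s₆.reg 5 = 1 := by
        rw [hf₆.1 5 (by decide), hs₅, State.setArr_reg, hf₄.1 5 (by decide), hf₃.1 5 (by decide),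
          hf₂.1 5 (by decide), hf₁.1 5 (by decide), h5]
      have r2₆ : s₆.reg 2 = 0 := (hf₆.1 2 (by decide)).trans r2₅
      refine ⟨⟨hl₅.of_frame (by decide) hf₆, ?_, fun _ => ?_, fun _ => ⟨r2₆, fun i hi => ?_⟩,
        Or.inl r5₆⟩, Or.inl ⟨?_, r5₆⟩, ?_⟩
      · rw [a7₆, a7₅]; exact hJ'
      · rw [a7₆, a7₅]
        rw [a7₅, a8₅, r7₅] at hd
        exact hmk.raise hd
      · rw [a7₆]
        by_cases hib : i = b
        · rw [hib]; exact hlt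
        · rw [a7₅, Function.update_of_ne hib]; exact hlev i hi
      · rw [a7₆, a7₅, hlsum]
      · omega
    · rw [eval_lt, bit_eq_zero, not_lt, eval_get, eval_var, eval_var, hl₅.n_eq, r7₅] at hge
      refine (Runs.of_wp (Q := fun s' => s' = s₅.setReg 5 0) ?_).imp ?_
      · exact ⟨w0, fun _ => rfl⟩
      rintro _ t₆ ⟨rfl, ht₆⟩
      have ht₆' : t₆ ≤ 2 := ht₆
      refine ⟨⟨hl₅.setReg (by decide) _, ?_, fun hor => ?_, fun h => ?_, Or.inr ⟨?_, Or.inr ⟨?_, b, hb,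
        hge⟩⟩⟩, Or.inr ⟨?_, ?_⟩, by omega⟩
      · rw [State.setReg_arr, a7₅]; exact hJ'
      · simp [r2₅] at hor
      · simp at h
      · simp
      · simpa using r2₅
      · rw [State.setReg_arr, a7₅, hlsum]; omega
      · simp

/-- Every round that does not end the loop raises the sum of the levels by one and leaves all levels
below `n`, so there are at most `n * n` of them. Register 5 pays for the final round. -/
theorem runs_main (hG : G.Valid) (hW : G.Words W) (hJ : G.RaiseClosed J) (h : G.MainState J s)
    (h5 : s.reg 5 = 1) :
    Runs W (loop (var 5) roundProg) s fun s' t => G.MainState J s' ∧ s'.reg 5 = 0 ∧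
      t ≤ 1002 * ((G.L + 2) * (G.N + G.n + 1)) * (G.n * G.n + 1) + 2 := by
  set X := (G.L + 2) * (G.N + G.n + 1) with hX
  have hX1 : 2 ≤ X := Nat.mul_le_mul (show 2 ≤ G.L + 2 by omega) (show 1 ≤ G.N + G.n + 1 by omega)
  have hc : Expr.cost (var 5) = 1 := rfl
  refine (Runs.loop (G.MainState J)
    (fun s => 1002 * X * (G.n * G.n - G.levelSum (s.arr 7)) + 1002 * X * s.reg 5)
    (fun s _ => by exact trivial) ?_ h).imp ?_
  · intro s h h0
    have h5 : s.reg 5 = 1 := by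
      have := h.done
      rw [eval_var] at h0
      omega
    refine (runs_round hG hW hJ h h5).imp ?_
    rintro s' t ⟨h', hcases, ht⟩
    refine ⟨h', ?_⟩
    rw [← hX] at ht
    rw [hc, h5]
    rcases hcases with ⟨hs, h5'⟩ | ⟨hs, h5'⟩
    · have hle : G.levelSum (s'.arr 7) ≤ G.n * G.n := by
        have := Finset.sum_le_card_nsmul (Finset.range G.n) (s'.arr 7) G.n
          fun b hb => ((h'.running h5').2 b (Finset.mem_range.1 hb)).le
        simpa [levelSum] using this
      have hsub : G.n * G.n - G.levelSum (s.arr 7) = G.n * G.n - G.levelSum (s'.arr 7) + 1 := by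
        omega
      rw [h5', hsub, Nat.mul_add]
      omega
    · have := Nat.mul_le_mul_left (1002 * X) (show G.n * G.n - G.levelSum (s'.arr 7) ≤
        G.n * G.n - G.levelSum (s.arr 7) by omega)
      rw [h5']
      omega
  · rintro s' t ⟨h', h0, ht⟩
    refine ⟨h', h0, ht.trans ?_⟩
    rw [h5, hc, Nat.mul_add (1002 * X)]
    have := Nat.mul_le_mul_left (1002 * X) (Nat.sub_le (G.n * G.n) (G.levelSum (s.arr 7)))
    omega

theorem runs_output (hW : G.Words W) (h : G.MainState J s) (h5 : s.reg 5 = 0) :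
    Runs W outputProg s fun s' t =>
      s'.reg 2 = s.reg 2 ∧ (s.reg 2 = 1 → ∀ a < G.n, s'.arr 3 a = s.arr 9 a - 1) ∧
        t ≤ 50 * (G.n + 1) := by
  have hnN : G.n ≤ G.N := n_le_N
  have w1 : 1 < W := hW.lt (by omega)
  have hc : Expr.cost (var 2) = 1 := rfl
  refine Runs.cond trivial (fun h2 => ?_) (fun h2 => ?_)
  · refine (Runs.upTo (by decide) (by decide) (by decide)
      (fun k s' => s'.arr 9 = s.arr 9 ∧ ∀ a < k, s'.arr 3 a = s.arr 9 a - 1) G.n 6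
      (fun k s v h => h) (hW.lt (by omega)) w1 ?_ ⟨rfl, fun a ha => by omega⟩
      h.loaded.n_eq).frame.imp ?_
    · rintro k s' hk ⟨h9, h3⟩ hi -
      refine (Runs.of_wp (Q := fun s' => s'.arr 9 = s.arr 9 ∧
        ∀ a < k + 1, s'.arr 3 a = s.arr 9 a - 1) ?_)
      refine ⟨trivial, ⟨trivial, w1⟩, fun _ => ⟨h9, fun a ha => ?_⟩⟩
      rcases Nat.lt_succ_iff_lt_or_eq.1 ha with ha | rfl
      · have hne : a ≠ k := by omega
        simpa [Expr.eval, hi, hne] using h3 a ha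
      · simp [Expr.eval, hi, h9]
    · rintro s' t ⟨⟨⟨-, h3⟩, ht⟩, hf⟩
      exact ⟨hf.1 2 (by decide), fun _ => h3, by omega⟩
  · refine (Runs.of_wp (Q := fun s' => s' = s) ?_).imp ?_
    · exact fun _ => rfl
    rintro _ t ⟨rfl, ht⟩
    have ht' : t ≤ 1 := ht
    rw [eval_var] at h2
    exact ⟨rfl, fun h => by omega, by omega⟩

end Net

end PopAlloc

/-! ### Preparing the data -/

namespace PopAlloc

open PopAlloc.Expr PopAlloc.Prog

namespace Net

variable {W : ℕ} {s s' : State}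

/-- The net whose data are in the memory. -/
def ofState (s : State) : Net where
  n := s.reg 0
  m := s.reg 1
  L := s.reg 4
  T := s.arr 0
  H := s.arr 1
  P := s.arr 2
  adj := s.arr 4
  deg := s.arr 5
  E := s.arr 6

theorem Words.of_reg_eq (h : (ofState s).Words W) (h0 : s'.reg 0 = s.reg 0)
    (h1 : s'.reg 1 = s.reg 1) : (ofState s').Words W := by
  unfold Words N ofState at *
  rwa [h0, h1]

theorem runs_loops (hW : (ofState s).Words W) :
    Runs W loopsProg s fun s' t => s'.reg 3 = s.reg 0 + s.reg 1 ∧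
      (∀ x ∈ [0, 1], (∀ e < s.reg 1, s'.arr x e = s.arr x e) ∧
        ∀ i < s.reg 0, s'.arr x (s.reg 1 + i) = i) ∧ t ≤ 50 * (s.reg 0 + 1) := by
  have hN : (ofState s).N = s.reg 0 + s.reg 1 := rfl
  have w1 : 1 < W := hW.lt (by omega)
  refine Runs.assign_seq ⟨trivial, trivial, hW.lt ?_⟩ ?_
  · simp only [Expr.eval]; omega
  simp only [Expr.eval]
  refine (Runs.upTo (s := s.setReg 3 (s.reg 0 + s.reg 1)) (i := 6) (b := 0)
    (p := seq (store 0 (add (var 1) (var 6)) (var 6))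
      (store 1 (add (var 1) (var 6)) (var 6))) (by decide) (by decide) (by decide)
    (fun k s' => s'.reg 1 = s.reg 1 ∧ s'.reg 3 = s.reg 0 + s.reg 1 ∧
      ∀ x ∈ [0, 1], (∀ e < s.reg 1, s'.arr x e = s.arr x e) ∧
        ∀ i < k, s'.arr x (s.reg 1 + i) = i) (s.reg 0) 10
    (fun k s v h => by simpa using h) (hW.lt (by omega)) w1 ?_
    ⟨rfl, rfl, fun x _ => ⟨fun e _ => rfl, fun i hi => by omega⟩⟩ rfl).imp ?_
  · rintro k s' hk ⟨h1, h3, h⟩ hi -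
    refine Runs.of_wp (Q := fun s' => s'.reg 1 = s.reg 1 ∧ s'.reg 3 = s.reg 0 + s.reg 1 ∧
      ∀ x ∈ [0, 1], (∀ e < s.reg 1, s'.arr x e = s.arr x e) ∧
        ∀ i < k + 1, s'.arr x (s.reg 1 + i) = i) ?_
    simp only [Prog.Wp, Fits, Expr.eval, h1, hi, State.setArr_reg, true_and]
    refine ⟨hW.lt (by omega), hW.lt (by omega), fun _ => ⟨h3, fun x hx => ?_⟩⟩
    obtain ⟨hlt, hge⟩ := h x hx
    simp only [List.mem_cons, List.not_mem_nil, or_false] at hx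
    refine ⟨fun e he => ?_, fun i hik => ?_⟩
    · have hne : e ≠ s.reg 1 + k := by omega
      have := hlt e he
      rcases hx with rfl | rfl <;> simpa [hne] using this
    · rcases Nat.lt_succ_iff_lt_or_eq.1 hik with hik | rfl
      · have hne : i ≠ k := by omega
        have := hge i hik
        rcases hx with rfl | rfl <;> simpa [hne] using this
      · rcases hx with rfl | rfl <;> simp
  · rintro s' t ⟨⟨-, h3, h⟩, ht⟩
    have hc : Expr.cost (add (var 0) (var 1)) = 3 := rfl
    exact ⟨h3, h, by omega⟩

/-- The first `k` arcs have been entered into the adjacency lists and the adjacency matrix. -/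
structure Indexed (n N : ℕ) (T H : ℕ → ℕ) (k : ℕ) (adj deg E : ℕ → ℕ) : Prop where
  adj_lt : ∀ h < n, ∀ j < deg h, adj (h * N + j) < k ∧ H (adj (h * N + j)) = h
  adj_surj : ∀ e < k, ∃ j < deg (H e), adj (H e * N + j) = e
  sum_deg : ∑ h ∈ Finset.range n, deg h = k
  E_eq : ∀ e < k, E (T e * n + H e) = e + 1
  E_inv : ∀ a < n, ∀ b < n, E (a * n + b) ≠ 0 → ∃ e < k, T e = a ∧ H e = b ∧ E (a * n + b) = e + 1

theorem mul_add_inj {N h h' j j' : ℕ} (hj : j < N) (hj' : j' < N)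
    (heq : h * N + j = h' * N + j') : h = h' ∧ j = j' := by
  have hN : 0 < N := by omega
  have h1 := congrArg (· / N) heq
  have h2 := congrArg (· % N) heq
  simp only [Nat.mul_add_mod', Nat.mod_eq_of_lt hj, Nat.mod_eq_of_lt hj'] at h2
  simp only [mul_comm _ N, Nat.mul_add_div hN, Nat.div_eq_of_lt hj, Nat.div_eq_of_lt hj',
    add_zero] at h1
  exact ⟨h1, h2⟩

theorem Indexed.deg_le {n N k : ℕ} {T H adj deg E : ℕ → ℕ} (h : Indexed n N T H k adj deg E) {b : ℕ}
    (hb : b < n) : deg b ≤ k := by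
  rw [← h.sum_deg]
  exact Finset.single_le_sum (f := deg) (fun _ _ => Nat.zero_le _) (Finset.mem_range.2 hb)

/-- The new arc goes into the first free cell of the block of its head. A degree is at most `k < N`,
so the blocks do not overlap; distinct arcs have distinct cells of the matrix by `hinj`. -/
theorem Indexed.succ {n N k : ℕ} {T H adj deg E : ℕ → ℕ} (h : Indexed n N T H k adj deg E)
    (hk : k < N) (hH : ∀ e < N, H e < n)
    (hinj : ∀ e < N, ∀ f < N, T e = T f → H e = H f → e = f) :
    Indexed n N T H (k + 1) (Function.update adj (H k * N + deg (H k)) k)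
      (Function.update deg (H k) (deg (H k) + 1)) (Function.update E (T k * n + H k) (k + 1)) := by
  have hdk : ∀ b < n, deg b ≤ k := fun b hb => h.deg_le hb
  have hHk := hdk _ (hH k hk)
  have hold : ∀ b < n, ∀ j < deg b, Function.update adj (H k * N + deg (H k)) k (b * N + j) =
      adj (b * N + j) := by
    intro b hb j hj
    refine Function.update_of_ne (fun heq => ?_) _ _
    obtain ⟨rfl, rfl⟩ := mul_add_inj (by have := hdk b hb; omega) (by omega) heq
    omega
  constructor
  · intro b hb j hj
    by_cases hj' : j < deg b
    · rw [hold b hb j hj']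
      have := h.adj_lt b hb j hj'
      exact ⟨by omega, this.2⟩
    · have hbk : b = H k := by
        by_contra hne
        rw [Function.update_of_ne hne] at hj
        exact hj' hj
      subst hbk
      rw [Function.update_self] at hj
      have hj'' : j = deg (H k) := by omega
      subst hj''
      simp
  · intro e he
    rcases Nat.lt_succ_iff_lt_or_eq.1 he with he | rfl
    · obtain ⟨j, hj, hje⟩ := h.adj_surj e he
      refine ⟨j, hj.trans_le ?_, by rw [hold _ (hH e (by omega)) j hj, hje]⟩
      by_cases hb : H e = H k
      · rw [hb, Function.update_self]; omega
      · rw [Function.update_of_ne hb]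
    · exact ⟨deg (H e), by simp, by simp⟩
  · have := sum_range_add_eq (f := deg) (g := Function.update deg (H k) (deg (H k) + 1)) (hH k hk)
      fun i hi => Function.update_of_ne hi _ _
    rw [Function.update_self, h.sum_deg] at this
    omega
  · intro e he
    rcases Nat.lt_succ_iff_lt_or_eq.1 he with he | rfl
    · rw [Function.update_of_ne, h.E_eq e he]
      intro heq
      obtain ⟨h1, h2⟩ := mul_add_inj (hH e (by omega)) (hH k hk) heq
      have := hinj e (by omega) k hk h1 h2
      omega
    · simp
  · intro a ha b hb
    by_cases heq : a * n + b = T k * n + H k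
    · obtain ⟨rfl, rfl⟩ := mul_add_inj hb (hH k hk) heq
      exact fun _ => ⟨k, by omega, rfl, rfl, by simp⟩
    · rw [Function.update_of_ne heq]
      intro h0
      obtain ⟨e, he, h'⟩ := h.E_inv a ha b hb h0
      exact ⟨e, by omega, h'⟩

theorem runs_adj (hW : (ofState s).Words W) (h3 : s.reg 3 = (ofState s).N)
    (hT : ∀ e < (ofState s).N, s.arr 0 e < s.reg 0) (hH : ∀ e < (ofState s).N, s.arr 1 e < s.reg 0)
    (hinj : ∀ e < (ofState s).N, ∀ f < (ofState s).N, s.arr 0 e = s.arr 0 f →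
      s.arr 1 e = s.arr 1 f → e = f) (h5 : ∀ i, s.arr 5 i = 0) (h6 : ∀ i, s.arr 6 i = 0) :
    Runs W (upTo 6 3 adjBody) s fun s' t =>
      Indexed (s.reg 0) (ofState s).N (s.arr 0) (s.arr 1) (ofState s).N
        (s'.arr 4) (s'.arr 5) (s'.arr 6) ∧ t ≤ 60 * ((ofState s).N + 1) := by
  have hnN : s.reg 0 ≤ (ofState s).N := n_le_N (G := ofState s)
  have w1 : 1 < W := hW.lt (by omega)
  refine (Runs.upTo (by decide) (by decide) (by decide)
    (fun k s' => s'.reg 0 = s.reg 0 ∧ s'.reg 3 = s.reg 3 ∧ s'.arr 0 = s.arr 0 ∧ s'.arr 1 = s.arr 1 ∧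
      Indexed (s.reg 0) (ofState s).N (s.arr 0) (s.arr 1) k (s'.arr 4) (s'.arr 5) (s'.arr 6))
    (ofState s).N adjBody.maxCost
    (fun k s v h => by simpa using h) (hW.lt (by omega)) w1 ?_
    ⟨rfl, rfl, rfl, rfl, ?_⟩ h3).imp ?_
  · rintro k s' hk ⟨r0, r3, a0, a1, h⟩ hi -
    refine Runs.of_wp (Q := fun s' => s'.reg 0 = s.reg 0 ∧ s'.reg 3 = s.reg 3 ∧
      s'.arr 0 = s.arr 0 ∧ s'.arr 1 = s.arr 1 ∧
      Indexed (s.reg 0) (ofState s).N (s.arr 0) (s.arr 1) (k + 1)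
        (s'.arr 4) (s'.arr 5) (s'.arr 6)) ?_
    have hTk := hT k hk
    have hHk := hH k hk
    have hd := h.deg_le hHk
    simp only [adjBody, Prog.Wp, Fits, Expr.eval, hi, r0, r3, a0, a1, State.setArr_reg,
      State.setArr_arr, Nat.reduceEqDiff, if_true, if_false, true_and, h3]
    exact ⟨⟨hW.mul_lt (by omega) (by omega), hW.mul_add_lt (by omega) (by omega) (by omega)⟩,
      ⟨w1, hW.lt (by omega)⟩, ⟨hW.mul_lt (by omega) (by omega),
        hW.mul_add_lt (by omega) (by omega) (by omega)⟩, ⟨w1, hW.lt (by omega)⟩,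
      fun _ => h.succ hk hH hinj⟩
  · exact ⟨fun b _ j hj => by simp [h5] at hj, fun e he => by omega, by simp [h5],
      fun e he => by omega, fun a _ b _ h => absurd (h6 _) h⟩
  · rintro s' t ⟨⟨-, -, -, -, h⟩, ht⟩
    have hc : adjBody.maxCost + 8 ≤ 50 := by decide
    have := Nat.mul_le_mul_right (ofState s).N hc
    exact ⟨h, by omega⟩

theorem runs_sqrt (hW : (ofState s).Words W) (h4 : s.reg 4 = 0) :
    Runs W sqrtProg s fun s' t => s.reg 0 ≤ s'.reg 4 * s'.reg 4 ∧
      (s'.reg 4 = 0 ∨ (s'.reg 4 - 1) * (s'.reg 4 - 1) < s.reg 0) ∧ t ≤ 20 * (s.reg 0 + 1) := by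
  have hnN : s.reg 0 ≤ (ofState s).N := n_le_N (G := ofState s)
  have w1 : 1 < W := hW.lt (by omega)
  refine (Runs.loop_of_wp (fun s' => s'.reg 0 = s.reg 0 ∧ s'.reg 4 ≤ s.reg 0 ∧
    (s'.reg 4 = 0 ∨ (s'.reg 4 - 1) * (s'.reg 4 - 1) < s.reg 0)) (fun s' => s.reg 0 - s'.reg 4)
    ?_ ?_ ⟨rfl, by omega, Or.inl h4⟩).imp ?_
  · rintro s' ⟨h0, hle, -⟩
    refine ⟨⟨trivial, trivial, ?_⟩, trivial, w1⟩
    simp only [Expr.eval]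
    exact hW.mul_lt (by omega) (by omega)
  · rintro s' ⟨h0, hle, -⟩ hlt
    rw [eval_lt, ne_eq, bit_eq_zero, not_not, eval_mul, eval_var, eval_var, h0] at hlt
    have hlt' : s'.reg 4 < s.reg 0 := by nlinarith
    simp only [incr, Prog.Wp, Fits, Expr.eval, State.setReg_reg, if_true, true_and,
      add_tsub_cancel_right, OfNat.zero_ne_ofNat, if_false]
    exact ⟨⟨w1, hW.lt (by omega)⟩, fun _ => ⟨⟨h0, by omega, Or.inr hlt⟩, by omega⟩⟩
  · rintro s' t ⟨⟨h0, hle, hor⟩, hge, ht⟩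
    rw [eval_lt, bit_eq_zero, not_lt, eval_mul, eval_var, eval_var, h0] at hge
    refine ⟨hge, hor, ?_⟩
    have hc : (incr 4).maxCost + (Expr.cost (lt (mul (var 4) (var 4)) (var 0)) + 1) = 10 := rfl
    have hc' : Expr.cost (lt (mul (var 4) (var 4)) (var 0)) = 5 := rfl
    rw [hc, hc'] at ht
    omega

/-- The input without loops: the arcs from `T e` to `H e`, where `e < m`, and their preferences. -/
structure Simple (n m : ℕ) (T H P : ℕ → ℕ) : Prop where
  T_lt : ∀ e < m, T e < n
  H_lt : ∀ e < m, H e < n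
  ne : ∀ e < m, T e ≠ H e
  P_le : ∀ k, P k ≤ 1
  inj : ∀ e < m, ∀ f < m, T e = T f → H e = H f → e = f

/-- The rest `q` of the program is analysed by continuation, because the net `ofState s'` that it
works on is known only after the preparation. -/
theorem runs_init (hW : (ofState s).Words W)
    (hS : Simple (s.reg 0) (s.reg 1) (s.arr 0) (s.arr 1) (s.arr 2)) (h4 : s.reg 4 = 0)
    (h5 : ∀ i, s.arr 5 i = 0) (h6 : ∀ i, s.arr 6 i = 0) {q : Prog} {Q : State → ℕ → Prop}
    (hq : ∀ s' t, (ofState s').Valid → (ofState s').Loaded s' →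
      s'.reg 0 = s.reg 0 → s'.reg 1 = s.reg 1 → s'.reg 2 = s.reg 2 → s'.arr 7 = s.arr 7 →
      s'.arr 2 = s.arr 2 → (∀ e < s.reg 1, s'.arr 0 e = s.arr 0 e ∧ s'.arr 1 e = s.arr 1 e) →
      t ≤ 200 * (s.reg 0 + s.reg 1 + 1) → Runs W q s' fun s'' t' => Q s'' (t + t')) :
    Runs W (seq loopsProg (seq (upTo 6 3 adjBody) (seq sqrtProg q))) s Q := by
  refine Runs.seq ((runs_loops hW).frame.imp ?_)
  rintro s₁ t₁ ⟨⟨h3, hTH, ht₁⟩, hf₁⟩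
  have r0 : s₁.reg 0 = s.reg 0 := hf₁.1 0 (by decide)
  have r1 : s₁.reg 1 = s.reg 1 := hf₁.1 1 (by decide)
  have hW₁ : (ofState s₁).Words W := hW.of_reg_eq r0 r1
  have hN₁ : (ofState s₁).N = s.reg 0 + s.reg 1 := by
    rw [← r0, ← r1]; rfl
  obtain ⟨hT, hT'⟩ := hTH 0 (by decide)
  obtain ⟨hH, hH'⟩ := hTH 1 (by decide)
  have split : ∀ e < s.reg 0 + s.reg 1, e < s.reg 1 ∨ ∃ i < s.reg 0, e = s.reg 1 + i :=
    fun e he => by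
      by_cases h : e < s.reg 1
      · exact Or.inl h
      · exact Or.inr ⟨e - s.reg 1, by omega, by omega⟩
  have hTlt : ∀ e < s.reg 0 + s.reg 1, s₁.arr 0 e < s.reg 0 := by
    intro e he
    rcases split e he with he | ⟨i, hi, rfl⟩
    · rw [hT e he]; exact hS.T_lt e he
    · rw [hT' i hi]; exact hi
  have hHlt : ∀ e < s.reg 0 + s.reg 1, s₁.arr 1 e < s.reg 0 := by
    intro e he
    rcases split e he with he | ⟨i, hi, rfl⟩
    · rw [hH e he]; exact hS.H_lt e he
    · rw [hH' i hi]; exact hi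
  have hinj : ∀ e < s.reg 0 + s.reg 1, ∀ f < s.reg 0 + s.reg 1, s₁.arr 0 e = s₁.arr 0 f →
      s₁.arr 1 e = s₁.arr 1 f → e = f := by
    intro e he f hf
    rcases split e he with he | ⟨i, hi, rfl⟩ <;> rcases split f hf with hf | ⟨j, hj, rfl⟩
    · rw [hT e he, hT f hf, hH e he, hH f hf]
      exact hS.inj e he f hf
    · rw [hT e he, hT' j hj, hH e he, hH' j hj]
      exact fun h1 h2 => absurd (h1.trans h2.symm) (hS.ne e he)
    · rw [hT' i hi, hT f hf, hH' i hi, hH f hf]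
      exact fun h1 h2 => absurd (h1.symm.trans h2) (hS.ne f hf)
    · rw [hT' i hi, hT' j hj]
      omega
  refine Runs.seq ((runs_adj hW₁ (by rw [hN₁, h3]) (by rwa [hN₁, r0]) (by rwa [hN₁, r0])
    (by rwa [hN₁]) (by rwa [hf₁.2 5 (by decide)]) (by rwa [hf₁.2 6 (by decide)])).frame.imp ?_)
  rintro s₂ t₂ ⟨⟨hI, ht₂⟩, hf₂⟩
  rw [hN₁, r0] at hI
  rw [hN₁] at ht₂
  have r0' : s₂.reg 0 = s.reg 0 := (hf₂.1 0 (by decide)).trans r0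
  have r1' : s₂.reg 1 = s.reg 1 := (hf₂.1 1 (by decide)).trans r1
  have r4 : s₂.reg 4 = 0 := by rw [hf₂.1 4 (by decide), hf₁.1 4 (by decide), h4]
  refine Runs.seq ((runs_sqrt (hW.of_reg_eq r0' r1') r4).frame.imp ?_)
  rintro s₃ t₃ ⟨⟨hsq, hsq', ht₃⟩, hf₃⟩
  rw [r0'] at hsq hsq' ht₃
  have r0₃ : s₃.reg 0 = s.reg 0 := (hf₃.1 0 (by decide)).trans r0'
  have r1₃ : s₃.reg 1 = s.reg 1 := (hf₃.1 1 (by decide)).trans r1'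
  have hN : (ofState s₃).N = s.reg 0 + s.reg 1 := by
    rw [← r0₃, ← r1₃]; rfl
  have a0 : s₃.arr 0 = s₁.arr 0 := by rw [hf₃.2 0 (by decide), hf₂.2 0 (by decide)]
  have a1 : s₃.arr 1 = s₁.arr 1 := by rw [hf₃.2 1 (by decide), hf₂.2 1 (by decide)]
  have a2 : s₃.arr 2 = s.arr 2 := by
    rw [hf₃.2 2 (by decide), hf₂.2 2 (by decide), hf₁.2 2 (by decide)]
  rw [← a0] at hT hT' hTlt hinj hI
  rw [← a1] at hH hH' hHlt hinj hI
  rw [← hf₃.2 4 (by decide), ← hf₃.2 5 (by decide), ← hf₃.2 6 (by decide), ← hN, ← r0₃] at hI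
  rw [← hN] at hTlt hHlt hinj
  rw [← r0₃] at hTlt hHlt hT' hH' hsq hsq'
  rw [← r1₃] at hT' hH'
  have hV : (ofState s₃).Valid := by
    constructor
    · exact hTlt
    · exact hHlt
    · exact hT'
    · exact hH'
    · intro k
      have := hS.P_le k
      rwa [← a2] at this
    · exact hinj
    · exact hI.adj_lt
    · exact hI.adj_surj
    · exact hI.sum_deg
    · exact hI.E_eq
    · exact hI.E_inv
    · exact hsq
    · exact hsq'
  have hL : (ofState s₃).Loaded s₃ := by
    constructor <;> try rfl
    rw [hf₃.1 3 (by decide), hf₂.1 3 (by decide), h3, hN]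
  refine (hq s₃ (t₁ + t₂ + t₃) hV hL r0₃ r1₃ ?_ ?_ a2 (fun e he => ⟨hT e he, hH e he⟩)
    (by omega)).imp fun s' t h => ?_
  · rw [hf₃.1 2 (by decide), hf₂.1 2 (by decide), hf₁.1 2 (by decide)]
  · rw [hf₃.2 7 (by decide), hf₂.2 7 (by decide), hf₁.2 7 (by decide)]
  · rwa [← add_assoc, ← add_assoc]

end Net

end PopAlloc

/-! ### Correctness -/

namespace PopAlloc

open PopAlloc.Expr PopAlloc.Prog

variable {n : ℕ}

/-- The arcs of `G` are those of `D` and the loops, with the same preferences. -/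
structure HousingMarket.IsNet (D : HousingMarket (Fin n)) (G : Net) : Prop where
  n_eq : G.n = n
  accepts_iff : ∀ a b : Fin n, D.Accepts a b ↔ ∃ e < G.N, G.T e = a ∧ G.H e = b
  prefBit_eq : ∀ e < G.N, ∀ f < G.N, ∀ a b b' : Fin n, G.T e = a → G.H e = b → G.T f = a →
    G.H f = b' → G.prefBit e f = bit (D.Better a b b')

namespace HousingMarket

variable {D : HousingMarket (Fin n)} {G : Net}

/-- A gain is the difference of two preference bits; moving the negative one to the other side of
the stability inequality gives the comparison of natural numbers in `Beats`. -/
theorem IsNet.unbeaten_iff (hD : D.IsNet G) (hG : G.Valid) {lev : ℕ → ℕ} {e : ℕ} (he : e < G.N)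
    {a b : Fin n} (ha : G.T e = a) (hb : G.H e = b) :
    G.Unbeaten lev e ↔ IsStable D.Accepts D.gain (fun b => lev b) a b := by
  have hgain : ∀ b', D.gain a b b' = (bit (D.Better a b' b) : ℤ) - bit (D.Better a b b') := by
    intro b'
    by_cases h : D.Better a b' b <;> by_cases h' : D.Better a b b' <;> simp [gain, bit, h, h']
  constructor
  · refine fun h => ⟨(hD.accepts_iff a b).2 ⟨e, he, ha, hb⟩, fun b' hb' => ?_⟩
    obtain ⟨f, hf, hfa, hfb⟩ := (hD.accepts_iff a b').1 hb'
    have := h f hf (hfa.trans ha.symm)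
    rw [Net.Beats, hD.prefBit_eq e he f hf a b b' ha hb hfa hfb,
      hD.prefBit_eq f hf e he a b' b hfa hfb ha hb, hb, hfb] at this
    rw [hgain]
    simp only
    omega
  · intro h f hf hT
    have hlt := hG.H_lt f hf
    rw [hD.n_eq] at hlt
    have hfa : G.T f = a := hT.trans ha
    have := h.2 ⟨G.H f, hlt⟩ ((hD.accepts_iff _ _).2 ⟨f, hf, hfa, rfl⟩)
    rw [Net.Beats, hD.prefBit_eq e he f hf a b ⟨G.H f, hlt⟩ ha hb hfa rfl,
      hD.prefBit_eq f hf e he a ⟨G.H f, hlt⟩ b hfa rfl ha hb, hb]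
    rw [hgain] at this
    simp only at this
    omega

/-- The levels are at most those of every stable perfect matching. -/
def Below (D : HousingMarket (Fin n)) (lev : ℕ → ℕ) : Prop :=
  ∀ (σ : Equiv.Perm (Fin n)) (l : Fin n → ℕ), (∀ a, IsStable D.Accepts D.gain l a (σ a)) →
    ∀ b : Fin n, lev b ≤ l b

/-- For the raised house this is `lt_of_unmatched`, applied to each solution `σ`, `l` with the set
that witnesses `Blocked`; nothing changes for the other houses. -/
theorem IsNet.raiseClosed (hD : D.IsNet G) (hG : G.Valid) : G.RaiseClosed D.Below := by
  intro lev dead own mate b hb hJ hmk hM hblk σ l hσ c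
  rw [hD.n_eq] at hb
  by_cases hcb : (c : ℕ) = b
  · obtain rfl := hcb
    rw [Function.update_self]
    obtain ⟨R, hcR, hR, hfree⟩ := hblk
    -- The encoding with zero for unmatched becomes an `Option`; the second test is needed only to
    -- form an element of `Fin n`.
    let own' : Fin n → Option (Fin n) := fun a =>
      if h : own a ≠ 0 ∧ own a - 1 < n then some ⟨own a - 1, h.2⟩ else none
    have hown' : ∀ a b, own' a = some b ↔ own a = b + 1 := by
      intro a b
      have hbn := b.2
      by_cases h : own a ≠ 0 ∧ own a - 1 < n
      · simp only [own', dif_pos h, Option.some.injEq, Fin.ext_iff]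
        omega
      · simp only [own', dif_neg h, reduceCtorEq, false_iff]
        omega
    have hlt : ∀ a : Fin n, (a : ℕ) < G.n := fun a => hD.n_eq ▸ a.2
    refine lt_of_unmatched (l := fun b : Fin n => lev b) (own := own') (R := {b : Fin n | (b : ℕ) ∈ R})
      D.gain_neg (hJ σ l hσ) hσ ?_ ?_ ?_ hcR ?_
    · intro a a' b h h'
      rw [hown'] at h h'
      have h1 := (hM.mate_iff a (hlt a) b (hlt b)).2 h
      have h2 := (hM.mate_iff a' (hlt a') b (hlt b)).2 h'
      exact Fin.ext (by omega)
    · intro a b h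
      rw [hown'] at h
      obtain ⟨e, he, hde, hT, hH⟩ := hM.alive a (hlt a) (by omega)
      exact (hD.unbeaten_iff hG he hT (by omega)).1 ((hmk e he).1 hde)
    · intro b hb a hst
      obtain ⟨e, he, hT, hH⟩ := (hD.accepts_iff a b).1 hst.1
      obtain ⟨h, hh, ho⟩ := hR e he ((hmk e he).2 ((hD.unbeaten_iff hG he hT hH).2 hst))
        (by rw [hH]; exact hb)
      rw [hT] at ho
      have hhn := hM.own_le hG (hlt a)
      rw [hD.n_eq] at hhn
      exact ⟨⟨h, by omega⟩, hh, (hown' a _).2 ho⟩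
    · intro a h
      rw [hown'] at h
      exact hfree a (hlt a) h
  · rw [Function.update_of_ne hcb]
    exact hJ σ l hσ c

/-- A perfect matching of unmarked arcs is a permutation of stable arcs, where `τ` sends a house to
its agent and `τ.symm` is the assignment. Agents matched to their own houses are fixed points and
drop out of the output. -/
theorem IsNet.isPopular (hD : D.IsNet G) (hG : G.Valid) {lev dead own mate : ℕ → ℕ}
    (hmk : G.Marked lev dead) (hM : G.Matching dead own mate) (hfull : ∀ b < G.n, mate b ≠ 0)
    {s : State} (hs : ∀ a < G.n, s.arr 3 a = own a - 1) : D.IsPopular (outputArcs n s) := by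
  have hlt : ∀ a : Fin n, (a : ℕ) < G.n := fun a => hD.n_eq ▸ a.2
  have hmate : ∀ b : Fin n, mate b - 1 < n := by
    intro b
    have h1 := hM.mate_le b (hlt b)
    have h2 := hfull b (hlt b)
    have := hD.n_eq
    omega
  have hown : ∀ b : Fin n, own (mate b - 1) = b + 1 := by
    intro b
    refine (hM.mate_iff _ (by rw [hD.n_eq]; exact hmate b) b (hlt b)).1 ?_
    have := hfull b (hlt b)
    omega
  have hinj : Function.Injective fun b : Fin n => (⟨mate b - 1, hmate b⟩ : Fin n) := by
    intro b b' h
    have h' : mate b - 1 = mate b' - 1 := congrArg Fin.val h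
    have h1 := hown b
    rw [h', hown b'] at h1
    exact Fin.ext (by omega)
  let τ : Equiv.Perm (Fin n) := Equiv.ofBijective _ (Finite.injective_iff_bijective.1 hinj)
  have hσ : ∀ a : Fin n, own a = τ.symm a + 1 := by
    intro a
    have h1 := hown (τ.symm a)
    have h2 : mate (τ.symm a) - 1 = a := congrArg Fin.val (τ.apply_symm_apply a)
    rwa [h2] at h1
  have hout : outputArcs n s = permArcs τ.symm := by
    ext ⟨a, b⟩
    simp only [outputArcs, permArcs, Set.mem_ofPred_eq]
    rw [hs a (hlt a), hσ a, Nat.add_sub_cancel, Fin.ext_iff (a := τ.symm a)]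
  rw [hout]
  refine isPopular_of_isStable (l := fun b : Fin n => lev b) fun a => ?_
  obtain ⟨e, he, hde, hT, hH⟩ := hM.alive a (hlt a) (by rw [hσ]; omega)
  rw [hσ] at hH
  exact (hD.unbeaten_iff hG he hT (by omega)).1 ((hmk e he).1 hde)

/-! ### Reading the market from the memory, and the run of the whole program. -/

section Input

variable {m : ℕ} (D) (arc : Fin m ≃ D.arcs)

theorem input_tail {e : ℕ} (he : e < m) : (D.input arc).arr 0 e = (arc ⟨e, he⟩).1.1 := by
  simp [input, he]

theorem input_head {e : ℕ} (he : e < m) : (D.input arc).arr 1 e = (arc ⟨e, he⟩).1.2 := by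
  simp [input, he]

theorem input_pref {e f : ℕ} (he : e < m) (hf : f < m) :
    (D.input arc).arr 2 (e * m + f) = bit ((arc ⟨e, he⟩).1.1 = (arc ⟨f, hf⟩).1.1 ∧
      D.pref (arc ⟨e, he⟩).1.1 (arc ⟨e, he⟩).1.2 (arc ⟨f, hf⟩).1.2) := by
  have hiff : (∃ i j : Fin m, e * m + f = i * m + j ∧ (arc i).1.1 = (arc j).1.1 ∧
      D.pref (arc i).1.1 (arc i).1.2 (arc j).1.2) ↔ ((arc ⟨e, he⟩).1.1 = (arc ⟨f, hf⟩).1.1 ∧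
      D.pref (arc ⟨e, he⟩).1.1 (arc ⟨e, he⟩).1.2 (arc ⟨f, hf⟩).1.2) := by
    constructor
    · rintro ⟨⟨i, hi⟩, ⟨j, hj⟩, h, h'⟩
      obtain ⟨rfl, rfl⟩ := Net.mul_add_inj hf hj h
      exact h'
    · exact fun h => ⟨⟨e, he⟩, ⟨f, hf⟩, rfl, h⟩
  rw [← propext hiff]
  simp only [input, bit, OfNat.ofNat_ne_zero, OfNat.ofNat_ne_one, if_false, if_true]
  congr

theorem simple_input : Net.Simple n m ((D.input arc).arr 0) ((D.input arc).arr 1)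
    ((D.input arc).arr 2) := by
  constructor
  · intro e he
    rw [input_tail D arc he]; exact Fin.is_lt _
  · intro e he
    rw [input_head D arc he]; exact Fin.is_lt _
  · intro e he h
    rw [input_tail D arc he, input_head D arc he] at h
    have hmem := (arc ⟨e, he⟩).2
    rw [← Prod.mk.eta (p := (arc ⟨e, he⟩).1), ← Fin.ext h] at hmem
    exact D.loopless _ hmem
  · intro k
    simp only [input, OfNat.ofNat_ne_zero, OfNat.ofNat_ne_one, if_false, if_true]
    split_ifs <;> omega
  · intro e he f hf h h'
    rw [input_tail D arc he, input_tail D arc hf] at h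
    rw [input_head D arc he, input_head D arc hf] at h'
    have := arc.injective (Subtype.ext (Prod.ext (Fin.ext h) (Fin.ext h')))
    exact congrArg Fin.val this

theorem isNet_of_input (hG : G.Valid) (hn : G.n = n) (hm : G.m = m)
    (hP : G.P = (D.input arc).arr 2)
    (hTH : ∀ e < m, G.T e = (D.input arc).arr 0 e ∧ G.H e = (D.input arc).arr 1 e) :
    D.IsNet G := by
  have hN : G.N = n + m := by rw [Net.N, hn, hm]
  have hT : ∀ e (he : e < m), G.T e = (arc ⟨e, he⟩).1.1 := fun e he => by
    rw [(hTH e he).1, input_tail D arc he]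
  have hH : ∀ e (he : e < m), G.H e = (arc ⟨e, he⟩).1.2 := fun e he => by
    rw [(hTH e he).2, input_head D arc he]
  have hloop : ∀ e < G.N, m ≤ e → G.T e = G.H e := by
    intro e he hme
    have h1 := hG.T_loop (e - m) (by omega)
    have h2 := hG.H_loop (e - m) (by omega)
    rw [hm, Nat.add_sub_cancel' hme] at h1 h2
    rw [h1, h2]
  refine ⟨hn, fun a b => ⟨?_, ?_⟩, ?_⟩
  · rintro (h | rfl)
    · obtain ⟨⟨e, he⟩, hea⟩ := arc.surjective ⟨_, h⟩
      exact ⟨e, by omega, by rw [hT e he, hea], by rw [hH e he, hea]⟩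
    · have ha : (a : ℕ) < G.n := hn ▸ a.2
      exact ⟨G.m + a, by omega, hG.T_loop a ha, hG.H_loop a ha⟩
  · rintro ⟨e, he, ha, hb⟩
    by_cases hem : e < m
    · refine Or.inl ?_
      rw [hT e hem] at ha
      rw [hH e hem] at hb
      have hmem := (arc ⟨e, hem⟩).2
      rwa [← Prod.mk.eta (p := (arc ⟨e, hem⟩).1), Fin.ext ha, Fin.ext hb] at hmem
    · refine Or.inr (Fin.ext ?_)
      rw [← ha, ← hb, hloop e he (by omega)]
  · intro e he f hf a b b' ha hb ha' hb'
    unfold Net.prefBit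
    rw [hm]
    by_cases hem : e < m
    · have hab : b ≠ a := by
        rintro rfl
        exact (simple_input D arc).ne e hem (by rw [← (hTH e hem).1, ← (hTH e hem).2, ha, hb])
      by_cases hfm : f < m
      · have hab' : b' ≠ a := by
          rintro rfl
          exact (simple_input D arc).ne f hfm (by rw [← (hTH f hfm).1, ← (hTH f hfm).2, ha', hb'])
        rw [hT e hem] at ha
        rw [hH e hem] at hb
        rw [hT f hfm] at ha'
        rw [hH f hfm] at hb'
        rw [hP, input_pref D arc hem hfm, Fin.ext ha, Fin.ext hb, Fin.ext ha', Fin.ext hb']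
        rw [bit_eq_one.2 hem, bit_eq_one.2 hfm, one_mul, one_mul, Nat.sub_self, Nat.add_zero]
        refine congrArg bit (propext ?_)
        simp [Better, hab']
      · have hab' : b' = a := Fin.ext (by rw [← ha', ← hb', hloop f hf (by omega)])
        simp [bit, hem, hfm, Better, hab, hab']
    · have hab : b = a := Fin.ext (by rw [← ha, ← hb, hloop e he (by omega)])
      have hpref : ¬ D.pref a a b' := fun h => D.loopless a (D.pref_arcs _ _ _ h).1
      simp [bit, hem, Better, hab, hpref]

theorem runs_popular (W : ℕ) (hW : 4 * ((n + m + 2) * (n + m + 2)) ≤ W) :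
    Runs W popularProg (D.input arc) fun s t => D.CorrectOutput s ∧
      ∃ L : ℕ, (L = 0 ∨ (L - 1) * (L - 1) < n) ∧ n ≤ L * L ∧
        t ≤ 1002 * ((L + 2) * (n + m + n + 1)) * (n * n + 1) + 300 * (n + m + 1) * (n + 1) := by
  have hW' : (Net.ofState (D.input arc)).Words W := hW
  have hz : ∀ x, 3 ≤ x → ∀ i, (D.input arc).arr x i = 0 := by
    intro x hx i
    simp only [input, show x ≠ 0 by omega, show x ≠ 1 by omega, show x ≠ 2 by omega, if_false]
  refine Net.runs_init hW' (simple_input D arc) rfl (hz 5 (by omega)) (hz 6 (by omega)) ?_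
  intro s₁ t₁ hG hl r0 r1 r2 a7 a2 hTH ht₁
  set G := Net.ofState s₁ with hGdef
  have hn : G.n = n := r0
  have hm : G.m = m := r1
  have hN : G.N = n + m := by rw [Net.N, hn, hm]
  have hD : D.IsNet G := isNet_of_input D arc hG hn hm a2 hTH
  have hWG : G.Words W := by rw [Net.Words, hN]; exact hW
  have ht₁' : t₁ ≤ 200 * (n + m + 1) := ht₁
  have hzero : ∀ b, s₁.arr 7 b = 0 := fun b => by rw [a7]; exact hz 7 (by omega) b
  have w1 : 1 < W := hWG.lt (by omega)
  refine Runs.seq ((Net.runs_initMarks hG hWG hl fun b _ => by rw [hzero]; omega).frame.imp ?_)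
  rintro s₂ t₂ ⟨⟨hmk, ht₂⟩, hf₂⟩
  rw [hN, hn] at ht₂
  refine Runs.assign_seq w1 ?_
  simp only [Expr.eval]
  have a7₂ : s₂.arr 7 = s₁.arr 7 := hf₂.2 7 (by decide)
  have hmain : G.MainState D.Below (s₂.setReg 5 1) := by
    refine ⟨(hl.of_frame (by decide) hf₂).setReg (by decide) _, ?_, fun _ => ?_, fun _ => ⟨?_, ?_⟩,
      Or.inl (by simp)⟩
    · intro σ l hσ b
      rw [State.setReg_arr, a7₂, hzero]
      omega
    · rwa [State.setReg_arr, a7₂]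
    · exact (hf₂.1 2 (by decide)).trans r2
    · intro b hb
      rw [State.setReg_arr, a7₂, hzero]
      omega
  refine Runs.seq ((Net.runs_main hG hWG (hD.raiseClosed hG) hmain (by simp)).imp ?_)
  rintro s₃ t₃ ⟨h₃, h5, ht₃⟩
  rw [hN, hn] at ht₃
  refine (Net.runs_output hWG h₃ h5).imp ?_
  rintro s₄ t₄ ⟨h2, hout, ht₄⟩
  rw [hn] at ht₄
  refine ⟨?_, G.L, hn ▸ hG.sq_lt, hn ▸ hG.le_sq, ?_⟩
  · rcases (h₃.done.resolve_left (by omega)).2 with ⟨h, hM, hfull⟩ | ⟨h, b, hb, hlev⟩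
    · exact Or.inl ⟨h2.trans h, hD.isPopular hG (h₃.marked (Or.inl h)) hM hfull (hout h)⟩
    -- A level has reached `n`. A popular allocation would supply a solution with all prices below
    -- `n`, yet the levels are at most those of every solution.
    · refine Or.inr ⟨h2.trans h, fun ⟨S, hS⟩ => ?_⟩
      obtain ⟨σ, l, hl, hσ⟩ := hS.exists_isStable
      rw [hn] at hb hlev
      have h1 := h₃.levels σ l hσ ⟨b, hb⟩
      have h2 := hl ⟨b, hb⟩
      rw [Fintype.card_fin] at h2
      exact absurd (hlev.trans h1) (not_le.2 h2)
  · have hc : Expr.cost (const 1) = 1 := rfl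
    rw [hc]
    have e1 : (200 * (n + m + 1) + 8) * n = 200 * ((n + m + 1) * n) + 8 * n := by ring
    have e2 : 300 * (n + m + 1) * (n + 1) = 300 * ((n + m + 1) * n) + 300 * (n + m + 1) := by ring
    have e3 : n ≤ (n + m + 1) * n := Nat.le_mul_of_pos_left _ (by omega)
    omega

end Input

end HousingMarket

/-- As `(L - 1) ^ 2 < n` and `1 ≤ √n`, the factor `L` is at most `2 * √n`; the rest of the bound is
of order `(m + n) * n ^ 2`. -/
theorem time_le {n m L t : ℕ} (hn : 0 < n) (hL : L = 0 ∨ (L - 1) * (L - 1) < n) (hL' : n ≤ L * L)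
    (ht : t ≤ 1002 * ((L + 2) * (n + m + n + 1)) * (n * n + 1) + 300 * (n + m + 1) * (n + 1)) :
    (t : ℝ) ≤ 40000 * (((m : ℝ) + n) * (n : ℝ) ^ (5 / 2 : ℝ)) := by
  have hL0 : 0 < L := by
    by_contra h
    have : L = 0 := by omega
    simp_all
  have h1 : t ≤ 20000 * (L * (m + n) * (n * n)) := by
    -- Since `L` and `n` are positive, additive constants are absorbed: `L + 2 ≤ 3 * L` and `2 * n +
    -- m + 1 ≤ 3 * (m + n)`.
    have e1 : (L + 2) * (n + m + n + 1) ≤ (3 * L) * (3 * (m + n)) :=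
      Nat.mul_le_mul (by omega) (by omega)
    have hnn : 1 ≤ n * n := Nat.mul_pos hn hn
    have e2 : 1002 * ((L + 2) * (n + m + n + 1)) * (n * n + 1) ≤
        1002 * ((3 * L) * (3 * (m + n))) * (2 * (n * n)) :=
      Nat.mul_le_mul (Nat.mul_le_mul_left _ e1) (by omega)
    have e3 : 300 * (n + m + 1) * (n + 1) ≤ 300 * (2 * (L * (m + n))) * (2 * (n * n)) := by
      refine Nat.mul_le_mul (Nat.mul_le_mul_left _ ?_) (by nlinarith)
      have := Nat.le_mul_of_pos_left (m + n) hL0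
      omega
    calc t ≤ 1002 * ((3 * L) * (3 * (m + n))) * (2 * (n * n)) +
        300 * (2 * (L * (m + n))) * (2 * (n * n)) := ht.trans (add_le_add e2 e3)
      _ = 19236 * (L * (m + n) * (n * n)) := by ring
      _ ≤ _ := Nat.mul_le_mul_right _ (by norm_num)
  have h2 : (L : ℝ) ≤ 2 * √n := by
    have hs1 : (1 : ℝ) ≤ √n := Real.one_le_sqrt.2 (by exact_mod_cast hn)
    have hlt : ((L - 1 : ℕ) : ℝ) ≤ √n := by
      refine Real.le_sqrt_of_sq_le ?_
      rw [sq]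
      exact_mod_cast (hL.resolve_left hL0.ne').le
    rw [Nat.cast_sub hL0, Nat.cast_one] at hlt
    linarith
  have h3 : (n : ℝ) ^ (5 / 2 : ℝ) = n * n * √n := by
    have hn' : (0 : ℝ) < n := by exact_mod_cast hn
    rw [show (5 / 2 : ℝ) = 2 + 1 / 2 by norm_num, Real.rpow_add hn', Real.sqrt_eq_rpow,
      Real.rpow_two, sq]
  have h4 : (t : ℝ) ≤ 20000 * (L * (m + n) * (n * n)) := by exact_mod_cast h1
  rw [h3]
  calc (t : ℝ) ≤ 20000 * (L * (m + n) * (n * n)) := h4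
    _ ≤ 20000 * ((2 * √n) * (m + n) * (n * n)) := by gcongr
    _ = _ := by ring

end PopAlloc

theorem mainTheorem11 :
    ∃ (p : PopAlloc.Prog) (c : ℕ) (K : ℝ),
      ∀ (n m : ℕ) (D : PopAlloc.HousingMarket (Fin n)) (arc : Fin m ≃ D.arcs),
        ∃ (s : PopAlloc.State) (t : ℕ),
          PopAlloc.Exec ((n + m + 2) ^ c) p (D.input arc) s t ∧
          D.CorrectOutput s ∧
          (0 < n → (t : ℝ) ≤ K * (((m : ℝ) + n) * (n : ℝ) ^ (5 / 2 : ℝ))) := by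
  -- The exponent `4` suffices because `n + m + 2 ≥ 2`: two of the four factors already provide the
  -- constant `4` in the word length that is required.
  refine ⟨PopAlloc.popularProg, 4, 40000, fun n m D arc => ?_⟩
  obtain ⟨s, t, hst, hs, L, hL, hL', ht⟩ := D.runs_popular arc ((n + m + 2) ^ 4) (by
    have h : 2 * 2 ≤ (n + m + 2) * (n + m + 2) := Nat.mul_le_mul (by omega) (by omega)
    calc 4 * ((n + m + 2) * (n + m + 2)) ≤
        (n + m + 2) * (n + m + 2) * ((n + m + 2) * (n + m + 2)) := Nat.mul_le_mul_right _ h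
      _ = _ := by ring)
  exact ⟨s, t, hst, hs, fun hn => PopAlloc.time_le hn hL hL' ht⟩
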